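/- Let $k\subset\mathbb C$ be a field, $n\ge 0$, and $\Sigma=\{\sigma_0,\dots,\sigma_n\}\subset k$ distinct points with $\sigma_0=0$; put $X_\Sigma=\mathbb A^1_k\setminus\Sigma$. Let $\underline s=(s_0,\dots,s_n)\in\mathbb C^{n+1}$ be generic: none of $s_0,\dots,s_n,\ s_0+\cdots+s_n$ is an integer. Put $\mathbb Q^{\mathrm{dR}}_{\underline s}=\mathbb Q(s_0,\dots,s_n)$, $k^{\mathrm{dR}}_{\underline s}=k(s_0,\dots,s_n)$ and $\mathbb Q^{\mathrm B}_{\underline s}=\mathbb Q(e^{2\pi i s_0},\dots,e^{2\pi i s_n})$. *The category.* Let $\mathcal T$ be the category of triples $V=(V_{\mathrm B},V_{\mathrm{dR}},c)$, where $V_{\mathrm B}$, $V_{\mathrm{dR}}$ are finite-dimensional vector spaces over $\mathbb Q^{\mathrm B}_{\underline s}$, $\mathbb Q^{\mathrm{dR}}_{\underline s}$ and $c:V_{\mathrm{dR}}\otimes\mathbb C\to V_{\mathrm B}\otimes\mathbb C$ is a $\mathbb C$-linear isomorphism; morphisms are pairs of linear maps compatible with $c$. Let $\mathcal P^{\mathfrak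 m}=\mathcal O(\mathrm{Isom}^\otimes(\omega_{\mathrm{dR}},\omega_{\mathrm B}))$ and $\mathcal P^{\mathfrak{dr}}=\mathcal O(\mathrm{Aut}^\otimes(\omega_{\mathrm{dR}}))$ for the two forgetful fibre functors. They are spanned by matrix coefficients $[V,\sigma,\omega]^{\mathfrak m}$ ($\sigma\in V_{\mathrm B}^\vee$, $\omega\in V_{\mathrm{dR}}$), respectively $[V,f,\omega]^{\mathfrak{dr}}$ ($f\in V_{\mathrm{dR}}^\vee$, $\omega\in V_{\mathrm{dR}}$), which are bilinear, natural in $V$, and multiplicative for tensor products. The coaction $\Delta:\mathcal P^{\mathfrak m}\to\mathcal P^{\mathfrak m}\otimes_{\mathbb Q^{\mathrm{dR}}_{\underline s}}\mathcal P^{\mathfrak{dr}}$ is the algebra homomorphism with $\Delta[V,\sigma,\omega]^{\mathfrak m}=\sum_i[V,\sigma,e_i]^{\mathfrak m}\otimes[V,e_i^\vee,\omega]^{\mathfrak{dr}}$ for any basis $(e_i)$ of $V_{\mathrm{dR}}$. *The object.* Let $\omega_i=\frac{dx}{x-\sigma_i}$ and $\nabla_{\pm\underline s}=d\pm\sum_{i=0}^n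 s_i\omega_i$ on $\mathcal O_{X_\Sigma}$ over $k^{\mathrm{dR}}_{\underline s}$, and let $H^1_\varpi(X_\Sigma,\nabla_{\pm\underline s})$ be the $\mathbb Q^{\mathrm{dR}}_{\underline s}$-subspace of $H^1_{\mathrm{dR}}(X_\Sigma,\nabla_{\pm\underline s})$ spanned by the classes of $\omega_0,\dots,\omega_n$. Let $\mathcal L_{\underline s}$ be the rank one local system of $\mathbb Q^{\mathrm B}_{\underline s}$-vector spaces on $\mathbb C\setminus\Sigma$ generated by the branches of $x^{-s_0}\prod_{k=1}^n(1-x\sigma_k^{-1})^{-s_k}$. Then $H^1(\mathbb C\setminus\Sigma,\mathcal L_{\underline s})$ is finite-dimensional, the comparison map $\mathrm{comp}:H^1_\varpi(X_\Sigma,\nabla_{\underline s})\otimes\mathbb C\to H^1(\mathbb C\setminus\Sigma,\mathcal L_{\underline s})\otimes\mathbb C$ (which sends the class of a form $\omega$ to the obstruction to gluing the local holomorphic solutions $u$ of $\nabla_{\underline s}u=\omega$) is an isomorphism, and so $$M_\Sigma=\bigl(H^1(\mathbb C\setminus\Sigma,\mathcal L_{\underline s}),\ H^1_\varpi(X_\Sigma,\nabla_{\underline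 s}),\ \mathrm{comp}\bigr)$$ is an object of $\mathcal T$. *Duality.* There is a de Rham intersection pairing $\langle\ ,\ \rangle:H^1_\varpi(X_\Sigma,\nabla_{-\underline s})\times H^1_\varpi(X_\Sigma,\nabla_{\underline s})\to\mathbb Q^{\mathrm{dR}}_{\underline s}$, given by $\langle\nu,\omega\rangle=\frac1{2\pi i}\iint_{\mathbb C}\widetilde\nu\wedge\omega$ for logarithmic forms $\nu,\omega$, where $\widetilde\nu$ is a smooth form with compact support in $\mathbb C\setminus\Sigma$ such that $\widetilde\nu-\nu=\nabla_{-\underline s}\varphi$ with $\varphi$ smooth. The classes of $-s_j\omega_j$ ($1\le j\le n$) form a basis of $H^1_\varpi(X_\Sigma,\nabla_{\underline s})$, and the classes of $\nu_i=\frac{dx}{x-\sigma_i}-\frac{dx}{x}$ ($1\le i\le n$) in $H^1_\varpi(X_\Sigma,\nabla_{-\underline s})$ form the dual basis for this pairing. *Coaction.* For $1\le i\le n$ let $\delta_i:(0,1)\to\mathbb C\setminus\Sigma$ be a continuous path from $0$ to $\sigma_i$ with a chosen branch of $x^{s_0}\prod_{k=1}^n(1-x\sigma_k^{-1})^{s_k}$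 along it, and view the locally finite twisted chain $\delta_i\otimes x^{s_0}\prod_k(1-x\sigma_k^{-1})^{s_k}$ as a functional on $H^1(\mathbb C\setminus\Sigma,\mathcal L_{\underline s})$ (by evaluation on compactly supported representatives). Define $n\times n$ matrices over $\mathcal P^{\mathfrak m}$ and $\mathcal P^{\mathfrak{dr}}$ by $$(L^{\mathfrak m}_\Sigma)_{ij}=\Bigl[M_\Sigma,\ \delta_i\otimes x^{s_0}\textstyle\prod_{k=1}^n(1-x\sigma_k^{-1})^{s_k},\ -s_j\omega_j\Bigr]^{\mathfrak m},\qquad (L^{\mathfrak{dr}}_\Sigma)_{ij}=\bigl[M_\Sigma,\ \langle\nu_i,\cdot\rangle,\ -s_j\omega_j\bigr]^{\mathfrak{dr}}.$$ Then $\Delta L^{\mathfrak m}_\Sigma=L^{\mathfrak m}_\Sigma\otimes L^{\mathfrak{dr}}_\Sigma$, that is, for all $1\le i,j\le n$, $$\Delta\,(L^{\mathfrak m}_\Sigma)_{ij}=\sum_{l=1}^n (L^{\mathfrak m}_\Sigma)_{il}\otimes(L^{\mathfrak{dr}}_\Sigma)_{lj}.$$ -/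

import Mathlib

open scoped TensorProduct Topology

noncomputable section

namespace Lauricella

/-! ## The category of Betti-de Rham triples -/

section Category

variable (QB kdR : IntermediateField ℚ ℂ)

/-- A triple `(V_B, V_dR, c)`: finite-dimensional vector spaces over `QB` and `kdR`, and a
`ℂ`-linear isomorphism between their complexifications. -/
structure Triple where
  VB : Type
  VdR : Type
  [acgB : AddCommGroup VB]
  [modB : Module QB VB]
  [finB : FiniteDimensional QB VB]
  [acgdR : AddCommGroup VdR]
  [moddR : Module kdR VdR]
  [findR : FiniteDimensional kdR VdR]
  c : (ℂ ⊗[kdR] VdR) ≃ₗ[ℂ] (ℂ ⊗[QB] VB)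

attribute [instance] Triple.acgB Triple.modB Triple.finB Triple.acgdR Triple.moddR Triple.findR

variable {QB kdR}

/-- Morphisms of triples: pairs of linear maps compatible with the comparison isomorphisms. -/
@[ext]
structure Triple.Hom (V W : Triple QB kdR) where
  fB : V.VB →ₗ[QB] W.VB
  fdR : V.VdR →ₗ[kdR] W.VdR
  comm : ∀ x, (fB.baseChange ℂ) (V.c x) = W.c ((fdR.baseChange ℂ) x)

instance : CategoryTheory.Category (Triple QB kdR) where
  Hom := Triple.Hom
  id V := ⟨LinearMap.id, LinearMap.id, fun x => by simp⟩
  comp f g := ⟨g.fB ∘ₗ f.fB, g.fdR ∘ₗ f.fdR, fun x => by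
    simp [LinearMap.baseChange_comp, f.comm, g.comm]⟩

variable (QB kdR) in
/-- The unit object `(QB, kdR, 1 ↦ 1)`. -/
def Triple.unit : Triple QB kdR where
  VB := QB
  VdR := kdR
  c := (TensorProduct.AlgebraTensorModule.rid kdR ℂ ℂ).trans
    (TensorProduct.AlgebraTensorModule.rid QB ℂ ℂ).symm

/-- The tensor product of two triples, taken componentwise. -/
def Triple.tensor (V W : Triple QB kdR) : Triple QB kdR where
  VB := V.VB ⊗[QB] W.VB
  VdR := V.VdR ⊗[kdR] W.VdR
  c := (TensorProduct.AlgebraTensorModule.distribBaseChange kdR ℂ V.VdR W.VdR).trans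
    ((TensorProduct.congr V.c W.c).trans
      (TensorProduct.AlgebraTensorModule.distribBaseChange QB ℂ V.VB W.VB).symm)

end Category

/-! ## Rings of Betti-de Rham and de Rham-de Rham matrix coefficients -/

section Periods

variable {QB kdR : IntermediateField ℚ ℂ}

/-- The Betti functional `σ ⊗ τ` on `V ⊗ W`. -/
def Triple.tensorB (V W : Triple QB kdR) (σ : Module.Dual QB V.VB) (τ : Module.Dual QB W.VB) :
    Module.Dual QB (V.tensor W).VB := TensorProduct.dualDistrib QB V.VB W.VB (σ ⊗ₜ τ)

/-- The de Rham functional `f ⊗ g` on `V ⊗ W`. -/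
def Triple.tensorDual (V W : Triple QB kdR) (f : Module.Dual kdR V.VdR)
    (g : Module.Dual kdR W.VdR) : Module.Dual kdR (V.tensor W).VdR :=
  TensorProduct.dualDistrib kdR V.VdR W.VdR (f ⊗ₜ g)

/-- The de Rham vector `ω ⊗ η` of `V ⊗ W`. -/
def Triple.tensorVec (V W : Triple QB kdR) (ω : V.VdR) (η : W.VdR) : (V.tensor W).VdR :=
  (ω ⊗ₜ[kdR] η : V.VdR ⊗[kdR] W.VdR)

variable (QB kdR)

/-- The identity functional on the Betti space of the unit object. -/
def Triple.unitB : Module.Dual QB (Triple.unit QB kdR).VB := (LinearMap.id : QB →ₗ[QB] QB)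

/-- The identity functional on the de Rham space of the unit object. -/
def Triple.unitDual : Module.Dual kdR (Triple.unit QB kdR).VdR :=
  (LinearMap.id : kdR →ₗ[kdR] kdR)

/-- The vector `1` in the de Rham space of the unit object. -/
def Triple.unitVec : (Triple.unit QB kdR).VdR := (1 : kdR)

/-- The ring over which both fibre functors are defined: `QB ⊗ kdR`. -/
def Base : Type := QB ⊗[ℚ] kdR

instance : CommRing (Base QB kdR) := inferInstanceAs (CommRing (QB ⊗[ℚ] kdR))

/-- The inclusion `a ↦ a ⊗ 1`. -/
def Base.left : QB →+* Base QB kdR :=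
  { toFun := fun a => (a ⊗ₜ[ℚ] 1 : QB ⊗[ℚ] kdR)
    map_one' := rfl
    map_mul' := map_mul (Algebra.TensorProduct.includeLeft : QB →ₐ[ℚ] QB ⊗[ℚ] kdR)
    map_zero' := TensorProduct.zero_tmul _ _
    map_add' := fun _ _ => TensorProduct.add_tmul _ _ _ }

/-- The inclusion `b ↦ 1 ⊗ b`. -/
def Base.right : kdR →+* Base QB kdR :=
  { toFun := fun b => (1 ⊗ₜ[ℚ] b : QB ⊗[ℚ] kdR)
    map_one' := rfl
    map_mul' := map_mul (Algebra.TensorProduct.includeRight : kdR →ₐ[ℚ] QB ⊗[ℚ] kdR)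
    map_zero' := TensorProduct.tmul_zero _ _
    map_add' := fun _ _ => TensorProduct.tmul_add _ _ _ }

/-- Symbols `(V, σ, ω)` with `σ ∈ V_B^∨` and `ω ∈ V_dR`. -/
abbrev MSymbol := Σ V : Triple QB kdR, Module.Dual QB V.VB × V.VdR

/-- Symbols `(V, f, ω)` with `f ∈ V_dR^∨` and `ω ∈ V_dR`. -/
abbrev DSymbol := Σ V : Triple QB kdR, Module.Dual kdR V.VdR × V.VdR

variable {QB kdR}

/-- The symbol `(V, σ, ω)` as a polynomial variable. -/
def mvar (V : Triple QB kdR) (σ : Module.Dual QB V.VB) (ω : V.VdR) :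
    MvPolynomial (MSymbol QB kdR) (Base QB kdR) := MvPolynomial.X ⟨V, σ, ω⟩

/-- The symbol `(V, f, ω)` as a polynomial variable. -/
def dvar (V : Triple QB kdR) (f : Module.Dual kdR V.VdR) (ω : V.VdR) :
    MvPolynomial (DSymbol QB kdR) kdR := MvPolynomial.X ⟨V, f, ω⟩

open MvPolynomial in
/-- The relations between Betti-de Rham matrix coefficients: bilinearity, naturality with respect
to all morphisms of triples, and compatibility with tensor products and the unit. -/
inductive MRel : MvPolynomial (MSymbol QB kdR) (Base QB kdR) →
    MvPolynomial (MSymbol QB kdR) (Base QB kdR) → Prop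
  | add_left (V : Triple QB kdR) (σ τ : Module.Dual QB V.VB) (ω : V.VdR) :
      MRel (mvar V (σ + τ) ω) (mvar V σ ω + mvar V τ ω)
  | smul_left (V : Triple QB kdR) (a : QB) (σ : Module.Dual QB V.VB) (ω : V.VdR) :
      MRel (mvar V (a • σ) ω) (C (Base.left QB kdR a) * mvar V σ ω)
  | add_right (V : Triple QB kdR) (σ : Module.Dual QB V.VB) (ω η : V.VdR) :
      MRel (mvar V σ (ω + η)) (mvar V σ ω + mvar V σ η)
  | smul_right (V : Triple QB kdR) (b : kdR) (σ : Module.Dual QB V.VB) (ω : V.VdR) :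
      MRel (mvar V σ (b • ω)) (C (Base.right QB kdR b) * mvar V σ ω)
  | natural (V W : Triple QB kdR) (φ : V.Hom W) (σ : Module.Dual QB W.VB) (ω : V.VdR) :
      MRel (mvar V (σ ∘ₗ φ.fB) ω) (mvar W σ (φ.fdR ω))
  | tensor (V W : Triple QB kdR) (σ : Module.Dual QB V.VB) (τ : Module.Dual QB W.VB)
      (ω : V.VdR) (η : W.VdR) :
      MRel (mvar (V.tensor W) (V.tensorB W σ τ) (V.tensorVec W ω η)) (mvar V σ ω * mvar W τ η)
  | unit : MRel (mvar (Triple.unit QB kdR) (Triple.unitB QB kdR) (Triple.unitVec QB kdR)) 1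

open MvPolynomial in
/-- The analogous relations between de Rham-de Rham matrix coefficients. -/
inductive DRel : MvPolynomial (DSymbol QB kdR) kdR → MvPolynomial (DSymbol QB kdR) kdR → Prop
  | add_left (V : Triple QB kdR) (f g : Module.Dual kdR V.VdR) (ω : V.VdR) :
      DRel (dvar V (f + g) ω) (dvar V f ω + dvar V g ω)
  | smul_left (V : Triple QB kdR) (a : kdR) (f : Module.Dual kdR V.VdR) (ω : V.VdR) :
      DRel (dvar V (a • f) ω) (C a * dvar V f ω)
  | add_right (V : Triple QB kdR) (f : Module.Dual kdR V.VdR) (ω η : V.VdR) :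
      DRel (dvar V f (ω + η)) (dvar V f ω + dvar V f η)
  | smul_right (V : Triple QB kdR) (b : kdR) (f : Module.Dual kdR V.VdR) (ω : V.VdR) :
      DRel (dvar V f (b • ω)) (C b * dvar V f ω)
  | natural (V W : Triple QB kdR) (φ : V.Hom W) (f : Module.Dual kdR W.VdR) (ω : V.VdR) :
      DRel (dvar V (f ∘ₗ φ.fdR) ω) (dvar W f (φ.fdR ω))
  | tensor (V W : Triple QB kdR) (f : Module.Dual kdR V.VdR) (g : Module.Dual kdR W.VdR)
      (ω : V.VdR) (η : W.VdR) :
      DRel (dvar (V.tensor W) (V.tensorDual W f g) (V.tensorVec W ω η)) (dvar V f ω * dvar W g η)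
  | unit : DRel (dvar (Triple.unit QB kdR) (Triple.unitDual QB kdR) (Triple.unitVec QB kdR)) 1

variable (QB kdR)

/-- The ideal generated by the relations between Betti-de Rham matrix coefficients. -/
def MIdeal : Ideal (MvPolynomial (MSymbol QB kdR) (Base QB kdR)) :=
  Ideal.span {p | ∃ x y : MvPolynomial (MSymbol QB kdR) (Base QB kdR), MRel x y ∧ p = x - y}

/-- The ideal generated by the relations between de Rham-de Rham matrix coefficients. -/
def DIdeal : Ideal (MvPolynomial (DSymbol QB kdR) kdR) :=
  Ideal.span {p | ∃ x y : MvPolynomial (DSymbol QB kdR) kdR, DRel x y ∧ p = x - y}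

/-- The ring of Betti-de Rham periods, the coordinate ring of `Isom^⊗(ω_dR, ω_B)`. Its points in
a `QB ⊗ kdR`-algebra `R` are, by construction, the tensor-compatible natural families of
`R`-linear maps from `V_dR ⊗ R` to `V_B ⊗ R`; such families consist of isomorphisms because all
objects have duals. -/
def PM : Type 1 := MvPolynomial (MSymbol QB kdR) (Base QB kdR) ⧸ MIdeal QB kdR

/-- The ring of de Rham-de Rham periods, the coordinate ring of `Aut^⊗(ω_dR)`. -/
def PDR : Type 1 := MvPolynomial (DSymbol QB kdR) kdR ⧸ DIdeal QB kdR

instance : CommRing (PM QB kdR) :=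
  inferInstanceAs (CommRing (MvPolynomial (MSymbol QB kdR) (Base QB kdR) ⧸ MIdeal QB kdR))

instance : Algebra (Base QB kdR) (PM QB kdR) :=
  inferInstanceAs (Algebra (Base QB kdR)
    (MvPolynomial (MSymbol QB kdR) (Base QB kdR) ⧸ MIdeal QB kdR))

instance : CommRing (PDR QB kdR) :=
  inferInstanceAs (CommRing (MvPolynomial (DSymbol QB kdR) kdR ⧸ DIdeal QB kdR))

instance : Algebra kdR (PDR QB kdR) :=
  inferInstanceAs (Algebra kdR (MvPolynomial (DSymbol QB kdR) kdR ⧸ DIdeal QB kdR))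

/-- The quotient map onto the ring of Betti-de Rham periods. -/
def PM.mk : MvPolynomial (MSymbol QB kdR) (Base QB kdR) →ₐ[Base QB kdR] PM QB kdR :=
  Ideal.Quotient.mkₐ (Base QB kdR) (MIdeal QB kdR)

/-- The quotient map onto the ring of de Rham-de Rham periods. -/
def PDR.mk : MvPolynomial (DSymbol QB kdR) kdR →ₐ[kdR] PDR QB kdR :=
  Ideal.Quotient.mkₐ kdR (DIdeal QB kdR)

variable {QB kdR} in
theorem PM.mk_rel {x y : MvPolynomial (MSymbol QB kdR) (Base QB kdR)} (h : MRel x y) :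
    PM.mk QB kdR x = PM.mk QB kdR y :=
  Ideal.Quotient.eq.2 (Ideal.subset_span ⟨x, y, h, rfl⟩)

variable {QB kdR} in
theorem PDR.mk_rel {x y : MvPolynomial (DSymbol QB kdR) kdR} (h : DRel x y) :
    PDR.mk QB kdR x = PDR.mk QB kdR y :=
  Ideal.Quotient.eq.2 (Ideal.subset_span ⟨x, y, h, rfl⟩)

/-- The `kdR`-algebra structure on the ring of Betti-de Rham periods, from the right factor of
`QB ⊗ kdR`. -/
instance : Algebra kdR (PM QB kdR) :=
  RingHom.toAlgebra ((algebraMap (Base QB kdR) (PM QB kdR)).comp (Base.right QB kdR))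

theorem smul_PM (b : kdR) (x : PM QB kdR) :
    b • x = algebraMap (Base QB kdR) (PM QB kdR) (Base.right QB kdR b) * x := rfl

instance : SMulCommClass kdR (Base QB kdR) (PM QB kdR) :=
  ⟨fun b a x => by rw [smul_PM, smul_PM, Algebra.smul_def, Algebra.smul_def]; ring⟩

instance : SMulCommClass (Base QB kdR) kdR (PM QB kdR) := SMulCommClass.symm _ _ _

variable {QB kdR}

/-- The class `[V, σ, ω]^m`. -/
def mcoeff (V : Triple QB kdR) (σ : Module.Dual QB V.VB) (ω : V.VdR) : PM QB kdR :=
  PM.mk QB kdR (mvar V σ ω)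

/-- The class `[V, f, ω]^dr`. -/
def dcoeff (V : Triple QB kdR) (f : Module.Dual kdR V.VdR) (ω : V.VdR) : PDR QB kdR :=
  PDR.mk QB kdR (dvar V f ω)

theorem mcoeff_add_left (V : Triple QB kdR) (σ τ : Module.Dual QB V.VB) (ω : V.VdR) :
    mcoeff V (σ + τ) ω = mcoeff V σ ω + mcoeff V τ ω :=
  (PM.mk_rel (MRel.add_left V σ τ ω)).trans (map_add _ _ _)

theorem mcoeff_smul_left (V : Triple QB kdR) (a : QB) (σ : Module.Dual QB V.VB) (ω : V.VdR) :
    mcoeff V (a • σ) ω = algebraMap (Base QB kdR) (PM QB kdR) (Base.left QB kdR a) * mcoeff V σ ω := by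
  refine (PM.mk_rel (MRel.smul_left V a σ ω)).trans ((map_mul _ _ _).trans ?_)
  rw [← MvPolynomial.algebraMap_eq, AlgHom.commutes]; rfl

theorem mcoeff_add_right (V : Triple QB kdR) (σ : Module.Dual QB V.VB) (ω η : V.VdR) :
    mcoeff V σ (ω + η) = mcoeff V σ ω + mcoeff V σ η :=
  (PM.mk_rel (MRel.add_right V σ ω η)).trans (map_add _ _ _)

theorem mcoeff_smul_right (V : Triple QB kdR) (b : kdR) (σ : Module.Dual QB V.VB) (ω : V.VdR) :
    mcoeff V σ (b • ω) = b • mcoeff V σ ω := by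
  refine (PM.mk_rel (MRel.smul_right V b σ ω)).trans ((map_mul _ _ _).trans ?_)
  rw [← MvPolynomial.algebraMap_eq, AlgHom.commutes, smul_PM]; rfl

theorem mcoeff_natural {V W : Triple QB kdR} (φ : V.Hom W) (σ : Module.Dual QB W.VB)
    (ω : V.VdR) : mcoeff V (σ ∘ₗ φ.fB) ω = mcoeff W σ (φ.fdR ω) :=
  PM.mk_rel (MRel.natural V W φ σ ω)

theorem mcoeff_tensor (V W : Triple QB kdR) (σ : Module.Dual QB V.VB) (τ : Module.Dual QB W.VB)
    (ω : V.VdR) (η : W.VdR) :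
    mcoeff (V.tensor W) (V.tensorB W σ τ) (V.tensorVec W ω η) = mcoeff V σ ω * mcoeff W τ η :=
  (PM.mk_rel (MRel.tensor V W σ τ ω η)).trans (map_mul _ _ _)

theorem mcoeff_unit :
    mcoeff (Triple.unit QB kdR) (Triple.unitB QB kdR) (Triple.unitVec QB kdR) = 1 :=
  (PM.mk_rel MRel.unit).trans (map_one _)

theorem dcoeff_add_left (V : Triple QB kdR) (f g : Module.Dual kdR V.VdR) (ω : V.VdR) :
    dcoeff V (f + g) ω = dcoeff V f ω + dcoeff V g ω :=
  (PDR.mk_rel (DRel.add_left V f g ω)).trans (map_add _ _ _)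

theorem dcoeff_smul_left (V : Triple QB kdR) (a : kdR) (f : Module.Dual kdR V.VdR) (ω : V.VdR) :
    dcoeff V (a • f) ω = a • dcoeff V f ω := by
  refine (PDR.mk_rel (DRel.smul_left V a f ω)).trans ((map_mul _ _ _).trans ?_)
  rw [← MvPolynomial.algebraMap_eq, AlgHom.commutes, Algebra.smul_def]; rfl

theorem dcoeff_add_right (V : Triple QB kdR) (f : Module.Dual kdR V.VdR) (ω η : V.VdR) :
    dcoeff V f (ω + η) = dcoeff V f ω + dcoeff V f η :=
  (PDR.mk_rel (DRel.add_right V f ω η)).trans (map_add _ _ _)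

theorem dcoeff_smul_right (V : Triple QB kdR) (b : kdR) (f : Module.Dual kdR V.VdR)
    (ω : V.VdR) : dcoeff V f (b • ω) = b • dcoeff V f ω := by
  refine (PDR.mk_rel (DRel.smul_right V b f ω)).trans ((map_mul _ _ _).trans ?_)
  rw [← MvPolynomial.algebraMap_eq, AlgHom.commutes, Algebra.smul_def]; rfl

theorem dcoeff_natural {V W : Triple QB kdR} (φ : V.Hom W) (f : Module.Dual kdR W.VdR)
    (ω : V.VdR) : dcoeff V (f ∘ₗ φ.fdR) ω = dcoeff W f (φ.fdR ω) :=
  PDR.mk_rel (DRel.natural V W φ f ω)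

theorem dcoeff_tensor (V W : Triple QB kdR) (f : Module.Dual kdR V.VdR)
    (g : Module.Dual kdR W.VdR) (ω : V.VdR) (η : W.VdR) :
    dcoeff (V.tensor W) (V.tensorDual W f g) (V.tensorVec W ω η) =
      dcoeff V f ω * dcoeff W g η :=
  (PDR.mk_rel (DRel.tensor V W f g ω η)).trans (map_mul _ _ _)

theorem dcoeff_unit :
    dcoeff (Triple.unit QB kdR) (Triple.unitDual QB kdR) (Triple.unitVec QB kdR) = 1 :=
  (PDR.mk_rel DRel.unit).trans (map_one _)

/-- The sum `∑ [V, σ, e_i]^m ⊗ [V, e_i^∨, ω]^dr` over a basis `e` of `V_dR`. -/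
def coactionSum {ι : Type*} [Fintype ι] (V : Triple QB kdR) (e : Module.Basis ι kdR V.VdR)
    (σ : Module.Dual QB V.VB) (ω : V.VdR) : PM QB kdR ⊗[kdR] PDR QB kdR :=
  ∑ i, mcoeff V σ (e i) ⊗ₜ[kdR] dcoeff V (e.coord i) ω

theorem mcoeff_sum_right {ι : Type*} (t : Finset ι) (V : Triple QB kdR)
    (σ : Module.Dual QB V.VB) (b : ι → kdR) (v : ι → V.VdR) :
    mcoeff V σ (∑ i ∈ t, b i • v i) = ∑ i ∈ t, b i • mcoeff V σ (v i) := by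
  have h : ∀ w, mcoeff V σ w = (⟨⟨mcoeff V σ, mcoeff_add_right V σ⟩,
    fun b w => mcoeff_smul_right V b σ w⟩ : V.VdR →ₗ[kdR] PM QB kdR) w := fun _ => rfl
  rw [h, map_sum]
  exact Finset.sum_congr rfl fun i _ => mcoeff_smul_right V (b i) σ (v i)

theorem dcoeff_sum_left {ι : Type*} (t : Finset ι) (V : Triple QB kdR) (ω : V.VdR)
    (b : ι → kdR) (f : ι → Module.Dual kdR V.VdR) :
    dcoeff V (∑ i ∈ t, b i • f i) ω = ∑ i ∈ t, b i • dcoeff V (f i) ω := by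
  have h : ∀ g, dcoeff V g ω = (⟨⟨fun g => dcoeff V g ω, fun f g => dcoeff_add_left V f g ω⟩,
    fun b g => dcoeff_smul_left V b g ω⟩ : Module.Dual kdR V.VdR →ₗ[kdR] PDR QB kdR) g :=
    fun _ => rfl
  rw [h, map_sum]
  exact Finset.sum_congr rfl fun i _ => dcoeff_smul_left V (b i) (f i) ω

theorem coactionSum_natural {ι κ : Type*} [Fintype ι] [Fintype κ] {V W : Triple QB kdR}
    (e : Module.Basis ι kdR V.VdR) (e' : Module.Basis κ kdR W.VdR) (φ : V.Hom W)
    (σ : Module.Dual QB W.VB) (ω : V.VdR) :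
    coactionSum V e (σ ∘ₗ φ.fB) ω = coactionSum W e' σ (φ.fdR ω) := by
  have h1 : ∀ i, mcoeff V (σ ∘ₗ φ.fB) (e i) =
      ∑ j, e'.coord j (φ.fdR (e i)) • mcoeff W σ (e' j) := fun i => by
    rw [mcoeff_natural, ← mcoeff_sum_right]
    congr 1
    exact (e'.sum_repr _).symm
  have h2 : ∀ j, dcoeff W (e'.coord j) (φ.fdR ω) =
      ∑ i, e'.coord j (φ.fdR (e i)) • dcoeff V (e.coord i) ω := fun j => by
    rw [← dcoeff_natural, ← dcoeff_sum_left]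
    congr 1
    refine e.ext fun i => ?_
    classical
    simp [Finsupp.single_apply]
  simp only [coactionSum, h1, h2, TensorProduct.sum_tmul, TensorProduct.tmul_sum]
  rw [Finset.sum_comm]
  exact Finset.sum_congr rfl fun j _ => Finset.sum_congr rfl fun i _ =>
    TensorProduct.smul_tmul _ _ _

/-- The tensor product of bases of `V_dR` and `W_dR`. -/
def Triple.tensorBasis {ι κ : Type*} {V W : Triple QB kdR}
    (e : Module.Basis ι kdR V.VdR) (e' : Module.Basis κ kdR W.VdR) :
    Module.Basis (ι × κ) kdR (V.tensor W).VdR :=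
  (e.tensorProduct e' : Module.Basis (ι × κ) kdR (V.VdR ⊗[kdR] W.VdR))

theorem Triple.tensorBasis_apply {ι κ : Type*} {V W : Triple QB kdR}
    (e : Module.Basis ι kdR V.VdR) (e' : Module.Basis κ kdR W.VdR) (ij : ι × κ) :
    Triple.tensorBasis e e' ij = V.tensorVec W (e ij.1) (e' ij.2) :=
  Module.Basis.tensorProduct_apply e e' ij.1 ij.2

theorem Triple.tensorBasis_coord {ι κ : Type*} {V W : Triple QB kdR}
    (e : Module.Basis ι kdR V.VdR) (e' : Module.Basis κ kdR W.VdR) (ij : ι × κ) :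
    (Triple.tensorBasis e e').coord ij = V.tensorDual W (e.coord ij.1) (e'.coord ij.2) := by
  have h : ((e.tensorProduct e' : Module.Basis (ι × κ) kdR (V.VdR ⊗[kdR] W.VdR)).coord ij) =
      TensorProduct.dualDistrib kdR V.VdR W.VdR (e.coord ij.1 ⊗ₜ e'.coord ij.2) := by
    refine TensorProduct.ext' fun x y => ?_
    obtain ⟨i, j⟩ := ij
    simp [Module.Basis.coord_apply, Module.Basis.tensorProduct_repr_tmul_apply, mul_comm]
  exact h

theorem coactionSum_tensor {ι κ : Type*} [Fintype ι] [Fintype κ] {V W : Triple QB kdR}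
    (e : Module.Basis ι kdR V.VdR) (e' : Module.Basis κ kdR W.VdR)
    (σ : Module.Dual QB V.VB) (τ : Module.Dual QB W.VB) (ω : V.VdR) (η : W.VdR) :
    coactionSum (V.tensor W) (Triple.tensorBasis e e') (V.tensorB W σ τ) (V.tensorVec W ω η) =
      coactionSum V e σ ω * coactionSum W e' τ η := by
  simp only [coactionSum]
  rw [Finset.sum_mul_sum, ← Finset.sum_product', ← Finset.univ_product_univ]
  refine Finset.sum_congr rfl fun ij _ => ?_
  rw [Algebra.TensorProduct.tmul_mul_tmul, ← mcoeff_tensor, ← dcoeff_tensor,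
    Triple.tensorBasis_apply, Triple.tensorBasis_coord]

/-- The basis `1` of the de Rham space of the unit object. -/
def Triple.unitBasis : Module.Basis Unit kdR (Triple.unit QB kdR).VdR :=
  (Module.Basis.singleton Unit kdR : Module.Basis Unit kdR kdR)

theorem coactionSum_unit :
    coactionSum (Triple.unit QB kdR) Triple.unitBasis (Triple.unitB QB kdR)
      (Triple.unitVec QB kdR) = 1 := by
  have h1 : (Triple.unitBasis (QB := QB) (kdR := kdR)) default = Triple.unitVec QB kdR :=
    Module.Basis.singleton_apply Unit kdR default
  have h2 : (Triple.unitBasis (QB := QB) (kdR := kdR)).coord default = Triple.unitDual QB kdR :=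
    (LinearMap.ext fun x => by simp :
      (Module.Basis.singleton Unit kdR : Module.Basis Unit kdR kdR).coord default =
        LinearMap.id)
  simp only [coactionSum, Finset.univ_unique, Finset.sum_singleton]
  rw [h1, h2, mcoeff_unit, dcoeff_unit]
  rfl

/-- The identity morphism of a triple. -/
def Triple.Hom.id (V : Triple QB kdR) : V.Hom V :=
  ⟨LinearMap.id, LinearMap.id, fun x => by simp⟩

theorem coactionSum_basis {ι κ : Type*} [Fintype ι] [Fintype κ] {V : Triple QB kdR}
    (e : Module.Basis ι kdR V.VdR) (e' : Module.Basis κ kdR V.VdR)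
    (σ : Module.Dual QB V.VB) (ω : V.VdR) : coactionSum V e σ ω = coactionSum V e' σ ω :=
  coactionSum_natural e e' (Triple.Hom.id V) σ ω

variable (QB kdR)

/-- The assignment `(V, σ, ω) ↦ ∑ [V, σ, e_i]^m ⊗ [V, e_i^∨, ω]^dr` on polynomials in symbols. -/
def preCoaction : MvPolynomial (MSymbol QB kdR) (Base QB kdR) →ₐ[Base QB kdR]
    PM QB kdR ⊗[kdR] PDR QB kdR :=
  MvPolynomial.aeval fun g => coactionSum g.1 (Module.finBasis kdR g.1.VdR) g.2.1 g.2.2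

variable {QB kdR}

theorem preCoaction_mvar (V : Triple QB kdR) (σ : Module.Dual QB V.VB) (ω : V.VdR) :
    preCoaction QB kdR (mvar V σ ω) = coactionSum V (Module.finBasis kdR V.VdR) σ ω := by
  simp [mvar, preCoaction]

theorem preCoaction_C (a : Base QB kdR) (x : PM QB kdR ⊗[kdR] PDR QB kdR) :
    preCoaction QB kdR (MvPolynomial.C a) * x = a • x := by
  rw [preCoaction, MvPolynomial.aeval_C, ← Algebra.smul_def]

theorem preCoaction_rel {x y : MvPolynomial (MSymbol QB kdR) (Base QB kdR)} (h : MRel x y) :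
    preCoaction QB kdR x = preCoaction QB kdR y := by
  induction h with
  | add_left V σ τ ω =>
    simp only [preCoaction_mvar, map_add]
    simp only [coactionSum, mcoeff_add_left, TensorProduct.add_tmul, Finset.sum_add_distrib]
  | smul_left V a σ ω =>
    simp only [map_mul, preCoaction_mvar, preCoaction_C]
    simp only [coactionSum, mcoeff_smul_left, ← Algebra.smul_def]
    rw [Finset.smul_sum]
    exact Finset.sum_congr rfl fun i _ => (TensorProduct.smul_tmul' _ _ _).symm
  | add_right V σ ω η =>
    simp only [preCoaction_mvar, map_add]
    simp only [coactionSum, dcoeff_add_right, TensorProduct.tmul_add, Finset.sum_add_distrib]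
  | smul_right V b σ ω =>
    simp only [map_mul, preCoaction_mvar, preCoaction_C]
    simp only [coactionSum, dcoeff_smul_right, Finset.smul_sum]
    refine Finset.sum_congr rfl fun i _ => ?_
    rw [← TensorProduct.smul_tmul, TensorProduct.smul_tmul', smul_PM, Algebra.smul_def]
  | natural V W φ σ ω =>
    simp only [preCoaction_mvar]
    exact coactionSum_natural _ _ φ σ ω
  | tensor V W σ τ ω η =>
    simp only [map_mul, preCoaction_mvar]
    rw [← coactionSum_tensor]
    exact coactionSum_basis _ _ _ _
  | unit =>
    rw [preCoaction_mvar, map_one, ← coactionSum_unit]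
    exact coactionSum_basis _ _ _ _

variable (QB kdR)

/-- The coaction on the ring of Betti-de Rham periods: the ring homomorphism with
`[V, σ, ω]^m ↦ ∑ [V, σ, e_i]^m ⊗ [V, e_i^∨, ω]^dr`. -/
def coaction : PM QB kdR →ₐ[Base QB kdR] PM QB kdR ⊗[kdR] PDR QB kdR :=
  Ideal.Quotient.liftₐ (MIdeal QB kdR) (preCoaction QB kdR) fun a ha => by
    have : MIdeal QB kdR ≤ RingHom.ker (preCoaction QB kdR) := by
      refine Ideal.span_le.2 ?_
      rintro _ ⟨x, y, h, rfl⟩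
      simp [RingHom.mem_ker, preCoaction_rel h]
    exact this ha

end Periods

/-! ## Algebraic de Rham cohomology of the punctured line with coefficients -/

section DeRham

variable {n : ℕ} (Q F : Type) [Field Q] [Field F] [Algebra Q F] (σ a : Fin (n + 1) → F)

/-- The coordinate ring of the affine line over `F` minus the points `σ i`. -/
abbrev CoordRing := Localization.Away (∏ i, (Polynomial.X - Polynomial.C (σ i)))

/-- The logarithmic form `dx / (x - σ i)`. -/
def omega (i : Fin (n + 1)) : Ω[CoordRing F σ⁄F] :=
  Ring.inverse (algebraMap (Polynomial F) (CoordRing F σ) (Polynomial.X - Polynomial.C (σ i))) •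
    KaehlerDifferential.D F (CoordRing F σ) (algebraMap (Polynomial F) (CoordRing F σ) Polynomial.X)

/-- The connection `f ↦ df + f ∑ a i dx / (x - σ i)` on the trivial line bundle. -/
def nabla : CoordRing F σ →ₗ[F] Ω[CoordRing F σ⁄F] :=
  (KaehlerDifferential.D F (CoordRing F σ)).toLinearMap +
    (LinearMap.toSpanSingleton (CoordRing F σ) _ (∑ i, a i • omega F σ i)).restrictScalars F

/-- The first algebraic de Rham cohomology group with coefficients in the connection; since the
punctured line is an affine curve, it is the cokernel of the connection on global sections. -/
abbrev HdR := Ω[CoordRing F σ⁄F] ⧸ LinearMap.range (nabla F σ a)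

/-- The submodule over `Q` of the first de Rham cohomology group that is spanned by the classes of
the logarithmic forms `dx / (x - σ i)`. -/
def logSpan : Submodule Q (HdR F σ a) :=
  Submodule.span Q (Set.range fun i => (LinearMap.range (nabla F σ a)).mkQ (omega F σ i))

/-- The `Q`-structure on the first de Rham cohomology group: the vector space over `Q` spanned by
the classes of the logarithmic forms `dx / (x - σ i)`. -/
def Hvarpi : Type := logSpan Q F σ a

instance : AddCommGroup (Hvarpi Q F σ a) := inferInstanceAs (AddCommGroup (logSpan Q F σ a))

instance : Module Q (Hvarpi Q F σ a) := inferInstanceAs (Module Q (logSpan Q F σ a))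

instance : FiniteDimensional Q (Hvarpi Q F σ a) :=
  FiniteDimensional.span_of_finite Q (Set.finite_range _)

/-- The class of `dx / (x - σ i)`. -/
def omegaClass (i : Fin (n + 1)) : Hvarpi Q F σ a :=
  ⟨(LinearMap.range (nabla F σ a)).mkQ (omega F σ i), Submodule.subset_span ⟨i, rfl⟩⟩

end DeRham

/-! ## Cohomology of the punctured complex plane with coefficients in a rank one local system -/

section Betti

variable {n : ℕ} (K : Type) [Field K] [Algebra K ℂ] (σ a : Fin (n + 1) → ℂ)

/-- The factors `x` (for `k = 0`) and `1 - x / σ k` (for `k ≠ 0`). -/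
def factor (k : Fin (n + 1)) (x : ℂ) : ℂ := if k = 0 then x else 1 - x / σ k

/-- Near `x`, the function `f` is a branch of the product of the `factor σ k ^ a k`, for some
choice of continuous logarithms of the factors. -/
def IsBranchAt (x : ℂ) (f : ℂ → ℂ) : Prop :=
  ∃ l : Fin (n + 1) → ℂ → ℂ, ∀ᶠ y in 𝓝 x,
    (∀ k, ContinuousAt (l k) y ∧ Complex.exp (l k y) = factor σ k y) ∧
      f y = Complex.exp (∑ k, a k * l k y)

/-- The functions whose germ at `x` belongs to the rank one local system of `K`-vector spaces
generated by the branches of the product of the `factor σ k ^ a k`. -/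
def stalk (x : ℂ) : Submodule K (ℂ → ℂ) := Submodule.span K {f | IsBranchAt σ a x f}

/-- Let `L` be the local system above and `C` the flasque sheaf of all complex-valued functions on
the plane minus the points `σ i`. An element of this submodule represents a global section of the
sheaf `C / L`: at a point `x` it is given by the germ at `x` of the function `u x`. -/
def cocycles : Submodule K (ℂ → ℂ → ℂ) where
  carrier := {u | ∀ x ∉ Set.range σ, ∀ᶠ y in 𝓝 x, u x - u y ∈ stalk K σ a y}
  zero_mem' := fun x _ => Filter.Eventually.of_forall fun y => by simp
  add_mem' := fun {u v} hu hv x hx => by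
    filter_upwards [hu x hx, hv x hx] with y h1 h2
    have : (u + v) x - (u + v) y = (u x - u y) + (v x - v y) := by
      simp only [Pi.add_apply]; abel
    rw [this]
    exact add_mem h1 h2
  smul_mem' := fun b u hu x hx => by
    filter_upwards [hu x hx] with y h1
    have : (b • u) x - (b • u) y = b • (u x - u y) := by
      simp only [Pi.smul_apply, smul_sub]
    rw [this]
    exact Submodule.smul_mem _ _ h1

/-- The representatives of those global sections of `C / L` that lift to a global section of `C`,
that is, to a function `f`. -/
def coboundaries : Submodule K (ℂ → ℂ → ℂ) where
  carrier := {u | ∃ f : ℂ → ℂ, ∀ x ∉ Set.range σ, u x - f ∈ stalk K σ a x}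
  zero_mem' := ⟨0, fun x _ => by simp⟩
  add_mem' := by
    rintro u v ⟨f, hf⟩ ⟨g, hg⟩
    refine ⟨f + g, fun x hx => ?_⟩
    have : (u + v) x - (f + g) = (u x - f) + (v x - g) := by
      simp only [Pi.add_apply]; abel
    rw [this]
    exact add_mem (hf x hx) (hg x hx)
  smul_mem' := by
    rintro b u ⟨f, hf⟩
    refine ⟨b • f, fun x hx => ?_⟩
    have : (b • u) x - b • f = b • (u x - f) := by
      simp only [Pi.smul_apply, smul_sub]
    rw [this]
    exact Submodule.smul_mem _ _ (hf x hx)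

/-- The first sheaf cohomology group of the plane minus the points `σ i` with coefficients in `L`,
computed by the flasque sheaf `C`: the cokernel of `Γ(C) → Γ(C / L)`. -/
abbrev H1 := cocycles K σ a ⧸ (coboundaries K σ a).submoduleOf (cocycles K σ a)

/-- The class of a cocycle. -/
def H1.mk : cocycles K σ a →ₗ[K] H1 K σ a :=
  ((coboundaries K σ a).submoduleOf (cocycles K σ a)).mkQ

theorem stalk_le (x : ℂ) {f : ℂ → ℂ} (hf : f ∈ stalk K σ a x) : f ∈ stalk ℂ σ a x :=
  Submodule.span_le_restrictScalars K ℂ _ hf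

/-- A cocycle with coefficients in `L`, seen as a cocycle with coefficients in `L ⊗ ℂ`. -/
def cocyclesToComplex : cocycles K σ a →ₗ[K] cocycles ℂ σ a where
  toFun u := ⟨u.1, fun x hx => (u.2 x hx).mono fun y h => stalk_le K σ a y h⟩
  map_add' _ _ := rfl
  map_smul' b u := Subtype.ext (by
    change b • u.1 = b • u.1
    rfl)

/-- The map on cohomology induced by the inclusion of `L` into `L ⊗ ℂ`. -/
def H1.toComplex : H1 K σ a →ₗ[K] H1 ℂ σ a :=
  Submodule.liftQ _ ((H1.mk ℂ σ a).restrictScalars K ∘ₗ cocyclesToComplex K σ a) (by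
    rintro u ⟨f, hf⟩
    refine (Submodule.Quotient.mk_eq_zero _).2 ?_
    exact ⟨f, fun x hx => stalk_le K σ a x (hf x hx)⟩)

/-- The natural map from `H¹(L) ⊗ ℂ` to `H¹(L ⊗ ℂ)`. -/
def H1.complexify : ℂ ⊗[K] H1 K σ a →ₗ[ℂ] H1 ℂ σ a := (H1.toComplex K σ a).liftBaseChange ℂ

/-- A path `δ : (0, 1) → ℂ ∖ {σ 0, …, σ n}` from `σ 0` to `σ i`, with a continuous branch `h` along
it of the product of the `factor σ k ^ a k`. -/
structure IsTwistedPath (i : Fin (n + 1)) (δ h : ℝ → ℂ) : Prop where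
  continuousOn : ContinuousOn δ (Set.Ioo 0 1)
  avoids : ∀ t ∈ Set.Ioo (0 : ℝ) 1, δ t ∉ Set.range σ
  source : Filter.Tendsto δ (𝓝[>] 0) (𝓝 (σ 0))
  target : Filter.Tendsto δ (𝓝[<] 1) (𝓝 (σ i))
  branch : ∃ l : Fin (n + 1) → ℝ → ℂ, (∀ k, ContinuousOn (l k) (Set.Ioo 0 1)) ∧
    ∀ t ∈ Set.Ioo (0 : ℝ) 1, (∀ k, Complex.exp (l k t) = factor σ k (δ t)) ∧
      h t = Complex.exp (∑ k, a k * l k t)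

/-- Let `δ` be a path between two punctures and `h` a section along `δ` of the dual of `L`. The
functional `κ` on `H¹(L)` is given by the locally finite chain `δ ⊗ h`: every class is represented
by a cocycle `u` with compact support, and if `v` is a lift of the pullback of `u` to a function
along `δ`, then `h * v` is constant near both ends of `δ`, and `κ` sends the class of `u` to the
difference of the two constants. -/
def IsChainFunctional (δ h : ℝ → ℂ) (κ : Module.Dual K (H1 K σ a)) : Prop :=
  ∀ u : cocycles K σ a,
    (∃ S : Set ℂ, IsCompact S ∧ Disjoint S (Set.range σ) ∧
      ∀ x ∉ Set.range σ, x ∉ S → u.1 x ∈ stalk K σ a x) →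
    ∀ (v : ℝ → ℂ) (p q : ℂ),
      (∀ t ∈ Set.Ioo (0 : ℝ) 1, ∃ g ∈ stalk K σ a (δ t),
        ∀ᶠ t' in 𝓝 t, v t' = u.1 (δ t) (δ t') + g (δ t')) →
      (∀ᶠ t in 𝓝[>] (0 : ℝ), h t * v t = p) →
      (∀ᶠ t in 𝓝[<] (1 : ℝ), h t * v t = q) →
      algebraMap K ℂ (κ (H1.mk K σ a u)) = q - p

end Betti

/-! ## Intersection numbers of twisted logarithmic forms -/

section Intersection

variable {n : ℕ} (σ s : Fin (n + 1) → ℂ)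

/-- The coefficient of `dz` in the form `∑ p k dz / (z - σ k)`. -/
def logCoeff (p : Fin (n + 1) → ℂ) (z : ℂ) : ℂ := ∑ k, p k / (z - σ k)

/-- The value at `z` of the smooth form `ν + ∇φ`, where `ν = ∑ p k dz / (z - σ k)` and
`∇φ = dφ - φ ∑ s k dz / (z - σ k)`. -/
def twistedForm (p : Fin (n + 1) → ℂ) (φ : ℂ → ℂ) (z : ℂ) : ℂ →L[ℝ] ℂ :=
  fderiv ℝ φ z + (logCoeff σ p z - φ z * logCoeff σ s z) • ContinuousLinearMap.id ℝ ℂ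

/-- `w` is the intersection number of the class of `ν = ∑ p k dz / (z - σ k)` for the connection
with exponents `-s` and the class of `ω = ∑ q k dz / (z - σ k)` for the connection with exponents
`s`: it is `(2πi)⁻¹ ∬ ν' ∧ ω` for a smooth form `ν'` with compact support in the punctured plane
that differs from `ν` by some `∇φ`. -/
def IsIntersectionNumber (p q : Fin (n + 1) → ℂ) (w : ℂ) : Prop :=
  ∃ φ : ℂ → ℂ, ContDiffOn ℝ (⊤ : ℕ∞) φ (Set.range σ)ᶜ ∧
    (∃ S : Set ℂ, IsCompact S ∧ Disjoint S (Set.range σ) ∧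
      ∀ z ∉ Set.range σ, z ∉ S → twistedForm σ s p φ z = 0) ∧
    w = (2 * Real.pi * Complex.I)⁻¹ *
      ∫ z : ℂ, (twistedForm σ s p φ z 1 * (logCoeff σ q z * Complex.I) -
        twistedForm σ s p φ z Complex.I * (logCoeff σ q z * 1))

end Intersection

/-! ## The object attached to the punctured line and its Lauricella matrices -/

section Lauricella

variable {n : ℕ} (k : IntermediateField ℚ ℂ) (σ : Fin (n + 1) → k) (s : Fin (n + 1) → ℂ)

/-- The field generated by the exponents `s i`. -/
abbrev QdR : IntermediateField ℚ ℂ := IntermediateField.adjoin ℚ (Set.range s)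

/-- The field generated by the numbers `exp (2πi s i)`. -/
abbrev QB : IntermediateField ℚ ℂ :=
  IntermediateField.adjoin ℚ (Set.range fun i => Complex.exp (2 * Real.pi * Complex.I * s i))

/-- The field generated by `k` and the exponents `s i`. -/
abbrev kdR : IntermediateField (QdR s) ℂ := IntermediateField.adjoin (QdR s) (k : Set ℂ)

/-- The exponents as elements of the field that they generate. -/
def expo (i : Fin (n + 1)) : QdR s := ⟨s i, IntermediateField.subset_adjoin _ _ ⟨i, rfl⟩⟩

/-- The exponents as elements of `k(s)`. -/
def expoK (i : Fin (n + 1)) : kdR k s := algebraMap (QdR s) (kdR k s) (expo s i)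

/-- The punctures as elements of `k(s)`. -/
def punctK (i : Fin (n + 1)) : kdR k s :=
  ⟨(σ i : ℂ), IntermediateField.subset_adjoin _ _ (σ i).2⟩

/-- The punctures as complex numbers. -/
def punct (i : Fin (n + 1)) : ℂ := (σ i : ℂ)

/-- The Betti space `H¹(ℂ ∖ Σ, L_s)`, where `L_s` is generated by the branches of
`x ^ (-s 0) ∏ (1 - x / σ k) ^ (-s k)`. -/
abbrev MB : Type := H1 (QB s) (punct k σ) (-s)

/-- The de Rham space `H¹_ϖ(X_Σ, ∇_s)`. -/
abbrev MdR : Type := Hvarpi (QdR s) (kdR k s) (punctK k σ s) (expoK k s)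

/-- The de Rham space `H¹_ϖ(X_Σ, ∇_{-s})`. -/
abbrev MdRneg : Type := Hvarpi (QdR s) (kdR k s) (punctK k σ s) (-expoK k s)

/-- The class of `ω_i` in `H¹_ϖ(X_Σ, ∇_s)`. -/
def om (i : Fin (n + 1)) : MdR k σ s :=
  omegaClass (QdR s) (kdR k s) (punctK k σ s) (expoK k s) i

/-- The class of `ω_i` in `H¹_ϖ(X_Σ, ∇_{-s})`. -/
def omNeg (i : Fin (n + 1)) : MdRneg k σ s :=
  omegaClass (QdR s) (kdR k s) (punctK k σ s) (-expoK k s) i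

/-- The class of `-s_j ω_j`, for `1 ≤ j ≤ n`. -/
def dRvec (j : Fin n) : MdR k σ s := (-expo s j.succ) • om k σ s j.succ

/-- The class of `ν_i = dx / (x - σ i) - dx / x` in `H¹_ϖ(X_Σ, ∇_{-s})`, for `1 ≤ i ≤ n`. -/
def nu (i : Fin n) : MdRneg k σ s := omNeg k σ s i.succ - omNeg k σ s 0

variable {k σ s}

/-- `c` is the comparison isomorphism: it sends the class of a form `ω_i` to its image under the
connecting map of `0 → L_s ⊗ ℂ → 𝒪 → Ω¹ → 0`, which is represented by any family of local
holomorphic solutions `u` of `∇_s u = ω_i`. -/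
def IsComparison (c : (ℂ ⊗[QdR s] MdR k σ s) ≃ₗ[ℂ] (ℂ ⊗[QB s] MB k σ s)) : Prop :=
  ∀ i, ∃ u : cocycles ℂ (punct k σ) (-s),
    (∀ x ∉ Set.range (punct k σ), ∀ᶠ y in 𝓝 x, HasDerivAt (u.1 x)
      (1 / (y - punct k σ i) - logCoeff (punct k σ) s y * u.1 x y) y) ∧
    H1.complexify (QB s) (punct k σ) (-s) (c (1 ⊗ₜ om k σ s i)) = H1.mk ℂ _ _ u

/-- `P` is the de Rham intersection pairing. -/
def IsDeRhamPairing (P : MdRneg k σ s →ₗ[QdR s] MdR k σ s →ₗ[QdR s] QdR s) : Prop :=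
  ∀ p q : Fin (n + 1) → QdR s,
    IsIntersectionNumber (punct k σ) s (fun i => (p i : ℂ)) (fun i => (q i : ℂ))
      (P (∑ i, p i • omNeg k σ s i) (∑ i, q i • om k σ s i) : ℂ)

/-- The object `M_Σ = (H¹_B, H¹_ϖ, comp)`. -/
abbrev MSigma [FiniteDimensional (QB s) (MB k σ s)]
    (c : (ℂ ⊗[QdR s] MdR k σ s) ≃ₗ[ℂ] (ℂ ⊗[QB s] MB k σ s)) : Triple (QB s) (QdR s) where
  VB := MB k σ s
  VdR := MdR k σ s
  c := c

/-- The matrix with entries `[M_Σ, κ_i, -s_j ω_j]^m`. -/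
def lauricellaM [FiniteDimensional (QB s) (MB k σ s)]
    (c : (ℂ ⊗[QdR s] MdR k σ s) ≃ₗ[ℂ] (ℂ ⊗[QB s] MB k σ s))
    (κ : Fin n → Module.Dual (QB s) (MB k σ s)) :
    Matrix (Fin n) (Fin n) (PM (QB s) (QdR s)) :=
  Matrix.of fun i j => mcoeff (MSigma c) (κ i) (dRvec k σ s j)

/-- The matrix with entries `[M_Σ, ν_i, -s_j ω_j]^dr`, where `ν_i` is seen as a functional through
the pairing `P`. -/
def lauricellaDR [FiniteDimensional (QB s) (MB k σ s)]
    (c : (ℂ ⊗[QdR s] MdR k σ s) ≃ₗ[ℂ] (ℂ ⊗[QB s] MB k σ s))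
    (P : MdRneg k σ s →ₗ[QdR s] MdR k σ s →ₗ[QdR s] QdR s) :
    Matrix (Fin n) (Fin n) (PDR (QB s) (QdR s)) :=
  Matrix.of fun i j => dcoeff (MSigma c) (P (nu k σ s i)) (dRvec k σ s j)

end Lauricella

end Lauricella

end

/-! The coaction sends a matrix coefficient to a sum over a basis of the de Rham space, and
naturality for the identity morphism makes this sum independent of the basis (`coaction_mcoeff`). If
the classes of `-s_j ω_j` form a basis whose coordinate functionals are the pairings with the `ν_i`,
the matrix identity is that sum written out. The substance is the construction of the object and of
this pair of dual bases.

Everything rests on one fact: the classes of `ω_0, …, ω_n` satisfy the single relation `∑ s_i ω_i =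
0`, up to scalars. The relation holds because the connection form is `∇ 1`. Conversely, a linear
relation yields a single-valued holomorphic `f` on the punctured plane that solves a first order
equation with regular singularities at the punctures and at infinity. Since no `s_k` is an integer,
nonzero homogeneous solutions have nontrivial monodromy around each puncture, so `f` must be the
unique solution that is holomorphic there; since `∑ s_k` is not an integer, the same happens at
infinity. By Liouville `f` is constant, and comparing residues shows that the relation is a multiple
of the known one (`exists_eq_mul_of_isSolution`). This serves for algebraic forms
(`exists_eq_mul_of_mem_range_nabla`) and for the classes of their local solutions in `H¹`
(`sum_smul_mk_eq_zero_iff`).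

On the Betti side the plane is cut along disjoint rays from the punctures. Cocycles become trivial
on the cut plane and near each cut, so a class is determined by `n + 1` constants, the jumps across
the cuts, modulo the jumps of a multiple of the branch on the cut plane (`jumpClass_surjective`,
`jumpClass_eq_zero_iff`). The dimension is therefore `n` over any field that contains the monodromy,
and extension of scalars to `ℂ` is an isomorphism (`complexify_bijective`). The comparison map then
matches two bases with `n` elements.

For the pairing, the local holomorphic solutions at the punctures and at infinity are glued by
cutoff functions. The mean value property turns the area integral into a sum of residues, with value
`∑ p * ∑ q / ∑ s - ∑ p_k q_k / s_k` (`isIntersectionNumber`). This form vanishes when either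
argument is a multiple of `s`, so it descends to cohomology, and at `ν_i` and `-s_j ω_j` it is the
Kronecker symbol. -/

open scoped TensorProduct Topology

noncomputable section

namespace Lauricella

/-! ## Cocycles with constant coefficients on simply connected spaces -/

section Vanishing

variable {T K : Type*} [TopologicalSpace T] [AddCommGroup K]

/-- The space of local primitives of the cocycle `d`: the element `(x, c)` is the germ at `x` with
value `c`, and it continues to `(y, c + d x y)` for `y` near `x`. -/
structure PrimitiveSpace (d : T → T → K) where
  pt : T
  val : K

variable {d : T → T → K}

/-- The étale topology: a set is open when with each germ it contains the nearby continuations of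
that germ. The cocycle condition enters only in showing that the sheets `y ↦ c + d x y` are open. -/
instance : TopologicalSpace (PrimitiveSpace d) where
  IsOpen O := ∀ p ∈ O, ∀ᶠ y in 𝓝 p.pt, ⟨y, p.val + d p.pt y⟩ ∈ O
  isOpen_univ _ _ := Filter.Eventually.of_forall fun _ => trivial
  isOpen_inter _ _ hs ht p hp := (hs p hp.1).and (ht p hp.2)
  isOpen_sUnion S hS p := by
    rintro ⟨O, hO, hp⟩
    exact (hS O hO p hp).mono fun y hy => ⟨O, hO, hy⟩

theorem PrimitiveSpace.continuous_pt : Continuous (pt : PrimitiveSpace d → T) :=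
  continuous_def.2 fun _ hU p hp => IsOpen.mem_nhds hU (show p.pt ∈ _ from hp)

/-- Where the cocycle relation based at `x` holds, subtracting `d x y` from the value over `y` turns
continuation into constancy. This trivializes the projection with fibre `K`, taken with the discrete
topology. -/
theorem PrimitiveSpace.isCoveringMap
    (hd : ∀ x, ∀ᶠ y in 𝓝 x, ∀ᶠ z in 𝓝 y, d x z = d x y + d y z) :
    IsCoveringMap (pt : PrimitiveSpace d → T) := by
  let _ : TopologicalSpace K := ⊥
  have : DiscreteTopology K := ⟨rfl⟩
  intro x
  obtain ⟨U, hU, hUo, hxU⟩ := eventually_nhds_iff.1 (hd x)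
  have key : IsEvenlyCovered (pt : PrimitiveSpace d → T) x K := by
    refine ⟨inferInstance, U, hxU, hUo, hUo.preimage continuous_pt,
      { toFun := fun p => (⟨p.1.pt, p.2⟩, p.1.val - d x p.1.pt)
        invFun := fun q => ⟨⟨q.1, q.2 + d x q.1⟩, q.1.2⟩
        left_inv := fun p => by simp
        right_inv := fun q => by simp
        continuous_toFun := ?_
        continuous_invFun := ?_ }, fun p => rfl⟩
    · refine Continuous.prodMk ((continuous_pt.comp continuous_subtype_val).subtype_mk _) ?_
      refine continuous_discrete_rng.2 fun c => isOpen_induced_iff.2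
        ⟨{p | p.pt ∈ U ∧ p.val - d x p.pt = c}, ?_, ?_⟩
      · rintro p ⟨hp, hc⟩
        filter_upwards [hU _ hp, hUo.mem_nhds hp] with z hz hzU
        refine ⟨hzU, ?_⟩
        simp only [hz, ← hc]
        abel
      · ext p
        exact ⟨fun h => h.2, fun h => ⟨p.2, h⟩⟩
    · refine Continuous.subtype_mk (continuous_prod_of_discrete_right.2 fun c =>
        continuous_def.2 fun O hO => isOpen_iff_mem_nhds.2 fun y hy => ?_) _
      rw [nhds_subtype_eq_comap]
      have h1 := hO _ hy
      refine ⟨_, (hU _ y.2).and h1, fun z hz => ?_⟩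
      change (⟨z.1, c + d x z.1⟩ : PrimitiveSpace d) ∈ O
      rw [hz.1, ← add_assoc]
      exact hz.2
  exact key.to_isEvenlyCovered_preimage

/-- A cocycle with constant coefficients on a simply connected space is a coboundary. -/
theorem exists_primitive [SimplyConnectedSpace T] [LocallyPathConnectedSpace T]
    (hd : ∀ x, ∀ᶠ y in 𝓝 x, ∀ᶠ z in 𝓝 y, d x z = d x y + d y z) :
    ∃ g : T → K, ∀ x, ∀ᶠ y in 𝓝 x, g y = g x + d x y := by
  have cov := PrimitiveSpace.isCoveringMap hd
  obtain ⟨x₀⟩ : Nonempty T := PathConnectedSpace.nonempty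
  -- Simple connectedness lifts the identity of `T` to a section of the covering; its values are the
  -- primitive.
  obtain ⟨F, ⟨-, hF⟩, -⟩ := cov.existsUnique_continuousMap_lifts (ContinuousMap.id T) x₀
    ⟨x₀, 0⟩ rfl
  have hF1 : ∀ y, (F y).pt = y := fun y => congrFun hF y
  refine ⟨fun y => (F y).val, fun x => ?_⟩
  obtain ⟨U, hU, hUo, hxU⟩ := eventually_nhds_iff.1 (hd x)
  -- The sheet through `F x`. Once it is known to be open, continuity keeps `F y` on it for `y` near
  -- `x`.
  have hO : IsOpen {p : PrimitiveSpace d | p.pt ∈ U ∧ p.val = (F x).val - d x x + d x p.pt} := by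
    rintro p ⟨hp, hc⟩
    filter_upwards [hU _ hp, hUo.mem_nhds hp] with z hz hzU
    refine ⟨hzU, ?_⟩
    simp only [hz, hc]
    abel
  have hxx : d x x = 0 := by simpa using (hU _ hxU).self_of_nhds
  have := F.continuous.continuousAt.preimage_mem_nhds
    (hO.mem_nhds (show F x ∈ _ from ⟨by rw [hF1]; exact hxU, by rw [hF1]; abel⟩))
  filter_upwards [this] with y hy
  have := hy.2
  rw [hF1, hxx, sub_zero] at this
  exact this

end Vanishing

/-! ## Germs of sections of the local system -/

section Stalks

variable {n : ℕ} {K : Type} [Field K] [Algebra K ℂ] {σ a : Fin (n + 1) → ℂ}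

theorem IsBranchAt.congr {x : ℂ} {f g : ℂ → ℂ} (hf : IsBranchAt σ a x f) (h : g =ᶠ[𝓝 x] f) :
    IsBranchAt σ a x g := by
  obtain ⟨l, hl⟩ := hf
  exact ⟨l, by filter_upwards [hl, h] with y hy hgy using ⟨hy.1, hgy.trans hy.2⟩⟩

theorem IsBranchAt.eventually_ne_zero {x : ℂ} {f : ℂ → ℂ} (hf : IsBranchAt σ a x f) :
    ∀ᶠ y in 𝓝 x, f y ≠ 0 := by
  obtain ⟨l, hl⟩ := hf
  exact hl.mono fun y hy => by rw [hy.2]; exact Complex.exp_ne_zero _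

theorem IsBranchAt.ne_zero {x : ℂ} {f : ℂ → ℂ} (hf : IsBranchAt σ a x f) : f x ≠ 0 :=
  hf.eventually_ne_zero.self_of_nhds

/-- Two branches differ by the exponential of an integral combination of the `2πi a k`. -/
theorem IsBranchAt.exists_int {x : ℂ} {f g : ℂ → ℂ} (hf : IsBranchAt σ a x f)
    (hg : IsBranchAt σ a x g) : ∃ m : Fin (n + 1) → ℤ, ∀ᶠ y in 𝓝 x,
      f y = Complex.exp (∑ k, m k * (2 * Real.pi * Complex.I * a k)) * g y := by
  obtain ⟨l, hl⟩ := hf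
  obtain ⟨l', hl'⟩ := hg
  have hm : ∀ k, ∃ m : ℤ, ∀ᶠ y in 𝓝 x, l k y = l' k y + m * (2 * Real.pi * Complex.I) := by
    intro k
    have h1 : ∀ᶠ y in 𝓝 x, ∃ m : ℤ, l k y = l' k y + m * (2 * Real.pi * Complex.I) := by
      filter_upwards [hl, hl'] with y hy hy'
      exact Complex.exp_eq_exp_iff_exists_int.1 ((hy.1 k).2.trans (hy'.1 k).2.symm)
    obtain ⟨m, hm⟩ := h1.self_of_nhds
    refine ⟨m, ?_⟩
    -- This quotient takes integer values near `x`. By continuity it moves by less than `1` there,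
    -- hence not at all.
    have hc : ContinuousAt (fun y => (l k y - l' k y) / (2 * Real.pi * Complex.I)) x :=
      (((hl.self_of_nhds.1 k).1).sub (hl'.self_of_nhds.1 k).1).div_const _
    have h2 : ∀ᶠ y in 𝓝 x, dist ((l k y - l' k y) / (2 * Real.pi * Complex.I))
        ((l k x - l' k x) / (2 * Real.pi * Complex.I)) < 1 :=
      hc.eventually (Metric.ball_mem_nhds _ one_pos)
    filter_upwards [h1, h2] with y ⟨m', hm'⟩ hy
    rw [hm, hm', add_sub_cancel_left, add_sub_cancel_left,
      mul_div_cancel_right₀ _ Complex.two_pi_I_ne_zero,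
      mul_div_cancel_right₀ _ Complex.two_pi_I_ne_zero, dist_eq_norm, ← Int.cast_sub,
      Complex.norm_intCast] at hy
    have : m' - m = 0 := Int.abs_lt_one_iff.1 (by exact_mod_cast hy)
    rw [hm', sub_eq_zero.1 this]
  choose m hm using hm
  refine ⟨m, ?_⟩
  filter_upwards [hl, hl', Filter.eventually_all.2 hm] with y hy hy' h
  rw [hy.2, hy'.2, ← Complex.exp_add, ← Finset.sum_add_distrib]
  congr 1
  refine Finset.sum_congr rfl fun k _ => ?_
  rw [h k]
  ring

/-- The field `K` contains the monodromy of the local system with exponents `a`. -/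
def HasMonodromy (K : Type) [Field K] [Algebra K ℂ] (a : Fin (n + 1) → ℂ) : Prop :=
  ∀ k, ∃ c : K, algebraMap K ℂ c = Complex.exp (2 * Real.pi * Complex.I * a k)

theorem hasMonodromy_complex (a : Fin (n + 1) → ℂ) : HasMonodromy ℂ a := fun _ => ⟨_, rfl⟩

theorem HasMonodromy.exists_exp (hK : HasMonodromy K a) (m : Fin (n + 1) → ℤ) :
    ∃ c : K, algebraMap K ℂ c = Complex.exp (∑ k, m k * (2 * Real.pi * Complex.I * a k)) := by
  choose c hc using hK
  refine ⟨∏ k, c k ^ m k, ?_⟩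
  rw [map_prod, Complex.exp_sum]
  refine Finset.prod_congr rfl fun k _ => ?_
  rw [map_zpow₀, hc, ← Complex.exp_int_mul]

/-- All branches at `x` are germwise `K`-multiples of one of them, because `K` contains the
monodromy factors. Sections are thereby reduced to scalars. -/
theorem mem_stalk_iff (hK : HasMonodromy K a) {x : ℂ} {b f : ℂ → ℂ} (hb : IsBranchAt σ a x b) :
    f ∈ stalk K σ a x ↔ ∃ c : K, ∀ᶠ y in 𝓝 x, f y = algebraMap K ℂ c * b y := by
  constructor
  · intro hf
    induction hf using Submodule.span_induction with
    | mem g hg =>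
      obtain ⟨m, hm⟩ := IsBranchAt.exists_int hg hb
      obtain ⟨c, hc⟩ := hK.exists_exp m
      exact ⟨c, by simpa only [hc] using hm⟩
    | zero => exact ⟨0, by simp⟩
    | add f g _ _ hf hg =>
      obtain ⟨c, hc⟩ := hf
      obtain ⟨d, hd⟩ := hg
      refine ⟨c + d, ?_⟩
      filter_upwards [hc, hd] with y h1 h2
      rw [Pi.add_apply, h1, h2, map_add, add_mul]
    | smul r f _ hf =>
      obtain ⟨c, hc⟩ := hf
      refine ⟨r * c, ?_⟩
      filter_upwards [hc] with y h1
      rw [Pi.smul_apply, h1, Algebra.smul_def, map_mul, mul_assoc]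
  · rintro ⟨c, hc⟩
    -- The stalk consists of globally defined functions, and `f` agrees with `c • b` only near `x`.
    -- The correction is a difference of two branches, since being a branch depends only on the
    -- germ.
    have h1 : f = c • b + ((b + (f - c • b)) - b) := by abel
    rw [h1]
    refine add_mem (Submodule.smul_mem _ _ (Submodule.subset_span hb))
      (sub_mem (Submodule.subset_span (hb.congr ?_)) (Submodule.subset_span hb))
    filter_upwards [hc] with y hy
    simp [hy, Algebra.smul_def]

theorem mem_stalk_of_eventuallyEq (hK : HasMonodromy K a) {x : ℂ} {b f : ℂ → ℂ}
    (hb : IsBranchAt σ a x b) (c : K) (h : ∀ᶠ y in 𝓝 x, f y = algebraMap K ℂ c * b y) :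
    f ∈ stalk K σ a x := (mem_stalk_iff hK hb).2 ⟨c, h⟩

theorem stalk_congr (hK : HasMonodromy K a) {x : ℂ} {b f g : ℂ → ℂ} (hb : IsBranchAt σ a x b)
    (hf : f ∈ stalk K σ a x) (h : ∀ᶠ y in 𝓝 x, g y = f y) : g ∈ stalk K σ a x := by
  obtain ⟨c, hc⟩ := (mem_stalk_iff hK hb).1 hf
  exact (mem_stalk_iff hK hb).2 ⟨c, by filter_upwards [hc, h] with y h1 h2 using h2.trans h1⟩

theorem exists_isBranchAt {x : ℂ} (hσ0 : σ 0 = 0) (hσ : ∀ k ≠ 0, σ k ≠ 0)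
    (hx : x ∉ Set.range σ) : ∃ b, IsBranchAt σ a x b := by
  have hcont : ∀ k, Continuous (factor σ k) := fun k => by
    unfold factor; split_ifs <;> fun_prop
  have hne : ∀ k, factor σ k x ≠ 0 := fun k h => hx ⟨k, by
    unfold factor at h
    split_ifs at h with hk
    · rw [hk, hσ0, h]
    · have := hσ k hk
      field_simp at h
      linear_combination h⟩
  -- Dividing by the value at `x` brings the argument of the principal logarithm near `1`, away from
  -- its cut.
  refine ⟨fun y => Complex.exp (∑ k, a k * (Complex.log (factor σ k y / factor σ k x) +
    Complex.log (factor σ k x))), fun k y => Complex.log (factor σ k y / factor σ k x) +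
    Complex.log (factor σ k x), ?_⟩
  have h1 : ∀ k, ∀ᶠ y in 𝓝 x, factor σ k y / factor σ k x ∈ Complex.slitPlane := fun k =>
    ((hcont k).div_const _).continuousAt.eventually
      (Complex.isOpen_slitPlane.mem_nhds (by simp [div_self (hne k)]))
  filter_upwards [Filter.eventually_all.2 h1] with y hy
  refine ⟨fun k => ⟨?_, ?_⟩, rfl⟩
  · exact (((hcont k).div_const _).continuousAt.clog (hy k)).add continuousAt_const
  · rw [Complex.exp_add, Complex.exp_log (Complex.slitPlane_ne_zero (hy k)),
      Complex.exp_log (hne k), div_mul_cancel₀ _ (hne k)]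

/-- A section of the local system over a connected open set with a global branch `b` is a multiple
of `b`. -/
theorem exists_eq_mul_branch (hK : HasMonodromy K a) {W : Set ℂ} (hW : IsPreconnected W)
    (hWo : IsOpen W) {b f : ℂ → ℂ} (hb : ∀ x ∈ W, IsBranchAt σ a x b)
    (hf : ∀ x ∈ W, f ∈ stalk K σ a x) : ∃ c : K, ∀ x ∈ W, f x = algebraMap K ℂ c * b x := by
  choose! c hc using fun x hx => (mem_stalk_iff hK (hb x hx)).1 (hf x hx)
  have hloc : ∀ x ∈ W, ∀ᶠ y in 𝓝 x, c y = c x := by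
    intro x hx
    filter_upwards [(hc x hx), hWo.mem_nhds hx] with y hy hyW
    have h2 := (hc y hyW).self_of_nhds
    rw [hy] at h2
    exact ((algebraMap K ℂ).injective (mul_right_cancel₀ (hb y hyW).ne_zero h2)).symm
  have hconst : ∀ x ∈ W, ∀ y ∈ W, c x = c y := by
    have : PreconnectedSpace W := isPreconnected_iff_preconnectedSpace.1 hW
    have hlc : IsLocallyConstant fun x : W => c x := by
      refine (IsLocallyConstant.iff_eventually_eq _).2 fun x => ?_
      have := hloc x x.2
      rw [← map_nhds_subtype_coe_eq_nhds x.2 (hWo.mem_nhds x.2), Filter.eventually_map] at this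
      exact this
    intro x hx y hy
    exact hlc.apply_eq_of_preconnectedSpace ⟨x, hx⟩ ⟨y, hy⟩
  rcases W.eq_empty_or_nonempty with rfl | ⟨x₀, hx₀⟩
  · exact ⟨0, by simp⟩
  · refine ⟨c x₀, fun x hx => ?_⟩
    rw [hconst x₀ hx₀ x hx]
    exact (hc x hx).self_of_nhds

/-- Over a simply connected open set with a global branch, every cocycle lifts to a function. -/
theorem exists_lift (hK : HasMonodromy K a) {W : Set ℂ} [SimplyConnectedSpace W]
    (hWo : IsOpen W) (hWσ : ∀ x ∈ W, x ∉ Set.range σ) {b : ℂ → ℂ}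
    (hb : ∀ x ∈ W, IsBranchAt σ a x b) {u : ℂ → ℂ → ℂ} (hu : u ∈ cocycles K σ a) :
    ∃ f : ℂ → ℂ, ∀ x ∈ W, u x - f ∈ stalk K σ a x := by
  have hlp : LocallyPathConnectedSpace W := hWo.locallyPathConnectedSpace
  -- The constant `d x y` expresses `u x - u y` near `y` as a multiple of the global branch; it is
  -- arbitrary when this makes no sense. These constants form a cocycle on `W`.
  have hd0 : ∀ x y : ℂ, ∃ c : K, y ∈ W → u x - u y ∈ stalk K σ a y →
      ∀ᶠ z in 𝓝 y, u x z - u y z = algebraMap K ℂ c * b z := by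
    intro x y
    by_cases h : y ∈ W ∧ u x - u y ∈ stalk K σ a y
    · obtain ⟨c, hc⟩ := (mem_stalk_iff hK (hb y h.1)).1 h.2
      exact ⟨c, fun _ _ => hc⟩
    · exact ⟨0, fun h1 h2 => (h ⟨h1, h2⟩).elim⟩
  choose d hd using hd0
  have hloc : ∀ x ∈ W, ∀ᶠ y in 𝓝 x, ∀ᶠ z in 𝓝 y, d x z = d x y + d y z := by
    intro x hx
    have h1 := hu x (hWσ x hx)
    filter_upwards [h1.eventually_nhds, hWo.mem_nhds hx] with y hy hyW
    have h2 := hd x y hyW hy.self_of_nhds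
    filter_upwards [hy, hu y (hWσ y hyW), h2.eventually_nhds, hWo.mem_nhds hyW] with z h3 h4 h5 hzW
    have h6 := (hd x z hzW h3).self_of_nhds
    have h7 := (hd y z hzW h4).self_of_nhds
    have h8 := h5.self_of_nhds
    apply (algebraMap K ℂ).injective
    apply mul_right_cancel₀ (hb z hzW).ne_zero
    rw [map_add, add_mul, ← h6, ← h7, ← h8]
    ring
  obtain ⟨g, hg⟩ := exists_primitive (T := W) (d := fun x y => d x y) fun x => by
    have := hloc x x.2
    rw [← map_nhds_subtype_coe_eq_nhds x.2 (hWo.mem_nhds x.2), Filter.eventually_map] at this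
    filter_upwards [this] with y hy
    rw [← map_nhds_subtype_coe_eq_nhds y.2 (hWo.mem_nhds y.2), Filter.eventually_map] at hy
    exact hy
  classical
  -- A lift may be any function, so it can be given by diagonal values. Near `x` one has `u x y - u
  -- y y = d x y * b y` and `g y = g x + d x y`, hence `u x - f = -g x * b`.
  refine ⟨fun y => u y y + algebraMap K ℂ (if h : y ∈ W then g ⟨y, h⟩ else 0) * b y,
    fun x hx => ?_⟩
  refine mem_stalk_of_eventuallyEq hK (hb x hx) (-g ⟨x, hx⟩) ?_
  have h1 := hg ⟨x, hx⟩
  have h2 : ∀ᶠ y in 𝓝 x, ∀ h : y ∈ W, g ⟨y, h⟩ = g ⟨x, hx⟩ + d x y := by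
    rw [← map_nhds_subtype_coe_eq_nhds hx (hWo.mem_nhds hx), Filter.eventually_map]
    exact h1.mono fun y hy _ => hy
  filter_upwards [h2, hu x (hWσ x hx), hWo.mem_nhds hx] with y h3 h4 hyW
  have h5 := (hd x y hyW h4).self_of_nhds
  rw [Pi.sub_apply, dif_pos hyW, h3 hyW, map_neg, map_add]
  linear_combination h5

end Stalks

/-! ## Cutting the punctured plane along rays -/

section Cuts

variable {n : ℕ} (σ : Fin (n + 1) → ℂ) (p : ℂ) (ε : ℝ)

/-- The affine coordinate that vanishes at `σ k`, is `-1` at `p`, and is positive on the ray from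
`σ k` in the direction away from `p`. -/
def zeta (k : Fin (n + 1)) (z : ℂ) : ℂ := (z - σ k) / (σ k - p)

/-- The plane cut along the rays from the punctures in the directions away from `p`. -/
def slitDomain : Set ℂ := {z | ∀ k, -zeta σ p k z ∈ Complex.slitPlane}

/-- A narrow open sector around the ray from `σ i` in the direction away from `p`. -/
def sector (i : Fin (n + 1)) : Set ℂ :=
  {z | |(zeta σ p i z).im| < ε * (zeta σ p i z).re}

/-- The open ray from `σ i` in the direction away from `p`. -/
def cut (i : Fin (n + 1)) : Set ℂ := {z | (zeta σ p i z).im = 0 ∧ 0 < (zeta σ p i z).re}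

/-- The point `p` is on no line through two punctures, and the sectors of aperture `ε` are
separated from the cuts other than their own. -/
structure IsCutBase : Prop where
  pos : 0 < ε
  ne : ∀ k, σ k - p ≠ 0
  sep : ∀ i k, i ≠ k → ε * |((σ k - p) / (σ i - p)).re| < |((σ k - p) / (σ i - p)).im|

variable {σ} in
-- The base point is sought on the parabola `t ↦ (t, t ^ 2)`: a line through two punctures meets it
-- in finitely many points, so all but finitely many `t` are admissible. For such `t`, every small
-- enough aperture separates the rays.
theorem exists_isCutBase (hσ : Function.Injective σ) : ∃ p ε, IsCutBase σ p ε := by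
  let pt : ℝ → ℂ := fun t => ⟨t, t ^ 2⟩
  have h1 : ∀ k, ∀ᶠ t : ℝ in Filter.cofinite, σ k - pt t ≠ 0 := fun k => by
    refine (Set.finite_singleton (σ k).re).subset fun t ht => ?_
    have : σ k - pt t = 0 := by simpa using ht
    exact (congrArg Complex.re (sub_eq_zero.1 this)).symm
  have h2 : ∀ i k, ∀ᶠ t : ℝ in Filter.cofinite, i ≠ k →
      ((σ k - pt t) / (σ i - pt t)).im ≠ 0 := fun i k => by
    by_cases hik : i = k
    · exact Filter.Eventually.of_forall fun _ h => (h hik).elim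
    -- The collinearity determinant of `σ i`, `σ k` and the point with parameter `t`; its cubic
    -- terms cancel. Its coefficients in degrees 1 and 2 are, up to sign, the coordinates of `σ k -
    -- σ i`.
    let P : Polynomial ℝ := Polynomial.C ((σ k).im * (σ i).re - (σ k).re * (σ i).im) +
      Polynomial.C ((σ i).im - (σ k).im) * Polynomial.X +
      Polynomial.C ((σ k).re - (σ i).re) * Polynomial.X ^ 2
    have hP : P ≠ 0 := fun h0 => hik <| hσ <| by
      have c1 : P.coeff 1 = 0 := by rw [h0]; simp
      have c2 : P.coeff 2 = 0 := by rw [h0]; simp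
      simp only [P, Polynomial.coeff_add, Polynomial.coeff_C_mul, Polynomial.coeff_X,
        Polynomial.coeff_C, Polynomial.coeff_X_pow] at c1 c2
      norm_num at c1 c2
      exact Complex.ext (by linarith) (by linarith)
    have hfin := Polynomial.finite_setOfPred_isRoot hP
    filter_upwards [hfin.compl_mem_cofinite, h1 i] with t ht hti _ him
    refine ht ?_
    have hn : Complex.normSq (σ i - pt t) ≠ 0 := by simpa using hti
    rw [Complex.div_im, div_sub_div_same, div_eq_zero_iff, or_iff_left hn] at him
    simp only [Set.mem_ofPred_eq, Polynomial.IsRoot.def, P, Polynomial.eval_add,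
      Polynomial.eval_mul, Polynomial.eval_C, Polynomial.eval_X, Polynomial.eval_pow]
    simp only [pt, Complex.sub_re, Complex.sub_im] at him
    linear_combination him
  obtain ⟨t, ht1, ht2⟩ := ((Filter.eventually_all.2 h1).and
    (Filter.eventually_all.2 fun i => Filter.eventually_all.2 (h2 i))).exists
  have h3 : ∀ i k, ∀ᶠ ε : ℝ in 𝓝[>] 0, i ≠ k →
      ε * |((σ k - pt t) / (σ i - pt t)).re| < |((σ k - pt t) / (σ i - pt t)).im| := fun i k => by
    by_cases hik : i = k
    · exact Filter.Eventually.of_forall fun _ h => (h hik).elim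
    refine Filter.Eventually.mono ?_ fun _ h _ => h
    refine eventually_nhdsWithin_of_eventually_nhds ?_
    refine (continuous_id.mul continuous_const).continuousAt.eventually_lt continuousAt_const ?_
    simpa using ht2 i k hik
  obtain ⟨ε, hε, hε0⟩ := ((Filter.eventually_all.2 fun i => Filter.eventually_all.2 (h3 i)).and
    self_mem_nhdsWithin).exists
  exact ⟨pt t, ε, hε0, ht1, hε⟩

variable {σ p ε}

theorem zeta_self (k : Fin (n + 1)) : zeta σ p k (σ k) = 0 := by simp [zeta]

theorem continuous_zeta (k : Fin (n + 1)) : Continuous (zeta σ p k) := by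
  unfold zeta; fun_prop

theorem zeta_combo (k : Fin (n + 1)) (x y : ℂ) {s t : ℝ} (hst : s + t = 1) :
    zeta σ p k (s • x + t • y) = s • zeta σ p k x + t • zeta σ p k y := by
  have : (s : ℂ) + t = 1 := by exact_mod_cast hst
  simp only [zeta, Complex.real_smul]
  rw [← mul_div_assoc, ← mul_div_assoc, ← add_div]
  congr 1
  linear_combination (σ k) * this

theorem isOpen_slitDomain : IsOpen (slitDomain σ p) := by
  have : slitDomain σ p = ⋂ k, (fun z => -zeta σ p k z) ⁻¹' Complex.slitPlane := by
    ext; simp [slitDomain]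
  rw [this]
  exact isOpen_iInter_of_finite fun k =>
    Complex.isOpen_slitPlane.preimage (continuous_zeta k).neg

theorem isOpen_sector (i : Fin (n + 1)) : IsOpen (sector σ p ε i) :=
  isOpen_lt (Complex.continuous_im.comp (continuous_zeta i)).abs
    (continuous_const.mul (Complex.continuous_re.comp (continuous_zeta i)))

theorem convex_sector (i : Fin (n + 1)) : Convex ℝ (sector σ p ε i) := by
  intro x hx y hy s t hs ht hst
  simp only [sector, Set.mem_ofPred_eq] at hx hy ⊢
  rw [zeta_combo i x y hst]
  simp only [Complex.add_im, Complex.add_re, Complex.smul_im, Complex.smul_re, smul_eq_mul]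
  rw [abs_lt] at hx hy ⊢
  rcases hs.eq_or_lt with rfl | hs
  · obtain rfl : t = 1 := by linarith
    constructor <;> linarith
  · constructor <;> nlinarith

theorem convex_im_zeta_lt (i : Fin (n + 1)) : Convex ℝ {z | (zeta σ p i z).im < 0} := by
  intro x hx y hy s t hs ht hst
  simp only [Set.mem_ofPred_eq] at hx hy ⊢
  rw [zeta_combo i x y hst]
  simp only [Complex.add_im, Complex.smul_im, smul_eq_mul]
  rcases hs.eq_or_lt with rfl | hs
  · obtain rfl : t = 1 := by linarith
    linarith
  · nlinarith

theorem convex_im_zeta_pos (i : Fin (n + 1)) : Convex ℝ {z | 0 < (zeta σ p i z).im} := by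
  intro x hx y hy s t hs ht hst
  simp only [Set.mem_ofPred_eq] at hx hy ⊢
  rw [zeta_combo i x y hst]
  simp only [Complex.add_im, Complex.smul_im, smul_eq_mul]
  rcases hs.eq_or_lt with rfl | hs
  · obtain rfl : t = 1 := by linarith
    linarith
  · nlinarith

theorem isOpen_im_zeta_pos (i : Fin (n + 1)) : IsOpen {z | 0 < (zeta σ p i z).im} :=
  isOpen_lt continuous_const (Complex.continuous_im.comp (continuous_zeta i))

theorem isOpen_im_zeta_lt (i : Fin (n + 1)) : IsOpen {z | (zeta σ p i z).im < 0} :=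
  isOpen_lt (Complex.continuous_im.comp (continuous_zeta i)) continuous_const

theorem slitDomain_not_mem_range {z : ℂ} (hz : z ∈ slitDomain σ p) : z ∉ Set.range σ := by
  rintro ⟨k, rfl⟩
  have := hz k
  simp [zeta_self] at this

theorem cut_not_mem_slitDomain {i : Fin (n + 1)} {z : ℂ} (hz : z ∈ cut σ p i) :
    z ∉ slitDomain σ p := fun h => by
  rcases Complex.mem_slitPlane_iff.1 (h i) with h | h
  · have := hz.2
    simp at h
    linarith
  · exact h (by simp [hz.1])

namespace IsCutBase

variable (hp : IsCutBase σ p ε)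
include hp

theorem base_mem_slitDomain : p ∈ slitDomain σ p := fun k => by
  have : -zeta σ p k p = 1 := by
    rw [zeta, ← neg_div, neg_sub, div_self (hp.ne k)]
  rw [this]
  exact Complex.one_mem_slitPlane

/-- Each affine map `-zeta σ p k` sends `p` to `1`, and the slit plane is star-shaped about `1`; so
the cut plane is star-shaped about `p`. -/
theorem simplyConnectedSpace_slitDomain : SimplyConnectedSpace (slitDomain σ p) := by
  have hstar : StarConvex ℝ p (slitDomain σ p) := by
    intro y hy s t hs ht hst k
    have h1 : -zeta σ p k p = 1 := by
      rw [zeta, ← neg_div, neg_sub, div_self (hp.ne k)]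
    rw [zeta_combo k p y hst, neg_add, ← smul_neg, ← smul_neg, h1]
    exact Complex.starConvex_one_slitPlane (hy k) hs ht hst
  have := hstar.contractibleSpace ⟨p, hp.base_mem_slitDomain⟩
  infer_instance

theorem sector_nonempty (i : Fin (n + 1)) :
    ((sector σ p ε i) ∩ {z | (zeta σ p i z).im < 0}).Nonempty ∧
    ((sector σ p ε i) ∩ {z | 0 < (zeta σ p i z).im}).Nonempty ∧ (cut σ p i).Nonempty := by
  have key : ∀ w : ℂ, zeta σ p i (σ i + w * (σ i - p)) = w := fun w => by
    rw [zeta, add_sub_cancel_left, mul_div_cancel_right₀ _ (hp.ne i)]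
  have hpos := hp.pos
  refine ⟨⟨σ i + (⟨1, -(ε / 2)⟩ : ℂ) * (σ i - p), ?_, ?_⟩,
    ⟨σ i + (⟨1, ε / 2⟩ : ℂ) * (σ i - p), ?_, ?_⟩, ⟨σ i + 1 * (σ i - p), ?_⟩⟩
  · simp only [sector, Set.mem_ofPred_eq, key, abs_neg]
    rw [abs_of_pos] <;> linarith
  · simp only [Set.mem_ofPred_eq, key]; linarith
  · simp only [sector, Set.mem_ofPred_eq, key]
    rw [abs_of_pos] <;> linarith
  · simp only [Set.mem_ofPred_eq, key]; linarith
  · simp only [cut, Set.mem_ofPred_eq, key]; simp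

theorem simplyConnectedSpace_sector (i : Fin (n + 1)) :
    SimplyConnectedSpace (sector σ p ε i) := by
  have := (convex_sector (σ := σ) (p := p) (ε := ε) i).contractibleSpace
    ((hp.sector_nonempty i).1.mono Set.inter_subset_left)
  infer_instance

theorem sector_re_pos {i : Fin (n + 1)} {z : ℂ} (hz : z ∈ sector σ p ε i) :
    0 < (zeta σ p i z).re :=
  (mul_pos_iff_of_pos_left hp.pos).1 ((abs_nonneg _).trans_lt hz)

theorem cut_subset_sector (i : Fin (n + 1)) : cut σ p i ⊆ sector σ p ε i := fun z hz => by
  simp only [sector, Set.mem_ofPred_eq, hz.1, abs_zero]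
  exact mul_pos hp.pos hz.2

/-- A point on the closed ray from `σ k` has `zeta σ p k z = t ≥ 0`, so its `i`-th coordinate is `(1
+ t) * ρ - 1` with `ρ = (σ k - p) / (σ i - p)`. By `sep` its imaginary part is too large, relative
to its real part, for the sector. -/
theorem sector_mem_slitPlane {i k : Fin (n + 1)} (hik : i ≠ k) {z : ℂ}
    (hz : z ∈ sector σ p ε i) : -zeta σ p k z ∈ Complex.slitPlane := by
  by_contra h
  rw [Complex.mem_slitPlane_iff, not_or, not_lt, not_not] at h
  obtain ⟨h1, h2⟩ := h
  simp only [Complex.neg_re, Complex.neg_im, neg_eq_zero, Left.neg_nonpos_iff] at h1 h2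
  set t := (zeta σ p k z).re with ht
  have h3 : zeta σ p k z = (t : ℂ) := Complex.ext rfl (by simp [h2])
  have h4 : zeta σ p i z = ((1 + t : ℝ) : ℂ) * ((σ k - p) / (σ i - p)) - 1 := by
    have hk := hp.ne k
    have hi := hp.ne i
    rw [zeta, div_eq_iff hk] at h3
    rw [zeta]
    field_simp
    push_cast
    linear_combination h3
  have h5 := hp.sep i k hik
  simp only [sector, Set.mem_ofPred_eq, h4] at hz
  simp only [Complex.sub_im, Complex.re_ofReal_mul, Complex.im_ofReal_mul, Complex.one_im,
    sub_zero, Complex.sub_re, Complex.one_re, abs_mul, abs_of_nonneg (by linarith : 0 ≤ 1 + t)]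
    at hz
  have h6 := le_abs_self ((σ k - p) / (σ i - p)).re
  have h7 := hp.pos
  nlinarith [mul_le_mul_of_nonneg_left h6 (mul_nonneg h7.le (by linarith : 0 ≤ 1 + t)),
    mul_lt_mul_of_pos_left h5 (by linarith : 0 < 1 + t)]

theorem sector_subset_slitDomain {i : Fin (n + 1)} {z : ℂ} (hz : z ∈ sector σ p ε i)
    (him : (zeta σ p i z).im ≠ 0) : z ∈ slitDomain σ p := fun k => by
  rcases eq_or_ne i k with rfl | hik
  · exact Complex.mem_slitPlane_iff.2 (Or.inr (by simpa using him))
  · exact hp.sector_mem_slitPlane hik hz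

theorem sector_not_mem_range {i : Fin (n + 1)} {z : ℂ} (hz : z ∈ sector σ p ε i) :
    z ∉ Set.range σ := by
  rintro ⟨k, rfl⟩
  rcases eq_or_ne i k with rfl | hik
  · have := hp.sector_re_pos hz
    simp [zeta_self] at this
  · have := hp.sector_mem_slitPlane hik hz
    simp [zeta_self] at this

theorem cut_disjoint {i k : Fin (n + 1)} (hik : i ≠ k) {z : ℂ} (hz : z ∈ cut σ p i) :
    z ∉ cut σ p k := fun h => by
  rcases Complex.mem_slitPlane_iff.1
    (hp.sector_mem_slitPlane hik (hp.cut_subset_sector i hz)) with h' | h'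
  · have := h.2
    simp at h'
    linarith
  · exact h' (by simp [h.1])

theorem mem_slitDomain_or_cut {z : ℂ} (hz : z ∉ Set.range σ) :
    z ∈ slitDomain σ p ∨ ∃ i, z ∈ cut σ p i := by
  by_contra! h
  obtain ⟨h1, h2⟩ := h
  simp only [slitDomain, Set.mem_ofPred_eq, not_forall, Complex.mem_slitPlane_iff, not_or, not_lt,
    not_not, Complex.neg_re, Complex.neg_im, neg_eq_zero, Left.neg_nonpos_iff] at h1
  obtain ⟨k, hk1, hk2⟩ := h1
  rcases hk1.eq_or_lt with h0 | h0
  · refine hz ⟨k, ?_⟩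
    have : zeta σ p k z = 0 := Complex.ext h0.symm hk2
    rw [zeta, div_eq_zero_iff, or_iff_left (hp.ne k)] at this
    exact (sub_eq_zero.1 this).symm
  · exact h2 k ⟨hk2, h0⟩

end IsCutBase

/-! ### Branches on the cut plane and on the sectors. -/

variable (σ p) (a : Fin (n + 1) → ℂ)

/-- A logarithm of `factor σ k` on the plane cut along the ray from `σ k`. -/
def slitLog (k : Fin (n + 1)) (z : ℂ) : ℂ :=
  Complex.log (-zeta σ p k z) + Complex.log (factor σ k p)

/-- A branch on the cut plane. -/
def slitBranch (z : ℂ) : ℂ := Complex.exp (∑ k, a k * slitLog σ p k z)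

/-- The branch on a sector that agrees with `slitBranch` on one side of the cut. -/
def sectorBranch (i : Fin (n + 1)) (z : ℂ) : ℂ :=
  Complex.exp (∑ k, a k * if k = i then
    Complex.log (zeta σ p i z) + Real.pi * Complex.I + Complex.log (factor σ i p)
    else slitLog σ p k z)

variable {σ p}

/-- Both sides are affine in `z`, vanish at `σ k`, and agree at `p`, where `-zeta` equals `1`. -/
theorem factor_eq_zeta_mul (hp : IsCutBase σ p ε) (hσ0 : σ 0 = 0) (hσ : ∀ k ≠ 0, σ k ≠ 0)
    (k : Fin (n + 1)) (z : ℂ) : factor σ k z = -zeta σ p k z * factor σ k p := by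
  have h := hp.ne k
  unfold factor zeta
  split_ifs with hk
  · subst hk
    rw [hσ0] at h ⊢
    field_simp
    ring
  · have h2 := hσ k hk
    field_simp
    ring

theorem factor_base_ne_zero (hp : IsCutBase σ p ε) (hσ0 : σ 0 = 0) (hσ : ∀ k ≠ 0, σ k ≠ 0)
    (k : Fin (n + 1)) : factor σ k p ≠ 0 := by
  have h := hp.ne k
  unfold factor
  split_ifs with hk
  · subst hk
    rw [hσ0] at h
    simpa using h
  · intro h1
    have := hσ k hk
    exact h (by linear_combination σ k * h1 + div_mul_cancel₀ p this)

theorem exp_slitLog (hp : IsCutBase σ p ε) (hσ0 : σ 0 = 0) (hσ : ∀ k ≠ 0, σ k ≠ 0)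
    {k : Fin (n + 1)} {z : ℂ} (hz : -zeta σ p k z ∈ Complex.slitPlane) :
    Complex.exp (slitLog σ p k z) = factor σ k z := by
  rw [slitLog, Complex.exp_add, Complex.exp_log (Complex.slitPlane_ne_zero hz),
    Complex.exp_log (factor_base_ne_zero hp hσ0 hσ k), factor_eq_zeta_mul hp hσ0 hσ k z]

theorem continuousAt_slitLog {k : Fin (n + 1)} {z : ℂ} (hz : -zeta σ p k z ∈ Complex.slitPlane) :
    ContinuousAt (slitLog σ p k) z :=
  ((continuous_zeta k).neg.continuousAt.clog hz).add continuousAt_const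

theorem isBranchAt_slitBranch (hp : IsCutBase σ p ε) (hσ0 : σ 0 = 0) (hσ : ∀ k ≠ 0, σ k ≠ 0)
    {z : ℂ} (hz : z ∈ slitDomain σ p) : IsBranchAt σ a z (slitBranch σ p a) := by
  refine ⟨slitLog σ p, ?_⟩
  filter_upwards [isOpen_slitDomain.mem_nhds hz] with y hy
  exact ⟨fun k => ⟨continuousAt_slitLog (hy k), exp_slitLog hp hσ0 hσ (hy k)⟩, rfl⟩

theorem isBranchAt_sectorBranch (hp : IsCutBase σ p ε) (hσ0 : σ 0 = 0) (hσ : ∀ k ≠ 0, σ k ≠ 0)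
    {i : Fin (n + 1)} {z : ℂ} (hz : z ∈ sector σ p ε i) :
    IsBranchAt σ a z (sectorBranch σ p a i) := by
  refine ⟨fun k z => if k = i then
    Complex.log (zeta σ p i z) + Real.pi * Complex.I + Complex.log (factor σ i p)
    else slitLog σ p k z, ?_⟩
  filter_upwards [(isOpen_sector i).mem_nhds hz] with y hy
  refine ⟨fun k => ?_, rfl⟩
  split_ifs with hk
  · subst hk
    have h1 : zeta σ p k y ∈ Complex.slitPlane :=
      Complex.mem_slitPlane_iff.2 (Or.inl (hp.sector_re_pos hy))
    refine ⟨(((continuous_zeta k).continuousAt.clog h1).add continuousAt_const).add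
      continuousAt_const, ?_⟩
    rw [Complex.exp_add, Complex.exp_add, Complex.exp_log (Complex.slitPlane_ne_zero h1),
      Complex.exp_log (factor_base_ne_zero hp hσ0 hσ k), Complex.exp_pi_mul_I,
      factor_eq_zeta_mul hp hσ0 hσ k y]
    ring
  · have h1 := hp.sector_mem_slitPlane (Ne.symm hk) hy
    exact ⟨continuousAt_slitLog h1, exp_slitLog hp hσ0 hσ h1⟩

theorem log_neg_of_im_neg {z : ℂ} (hz : z.im < 0 ∨ z.im = 0 ∧ 0 < z.re) :
    Complex.log (-z) = Complex.log z + Real.pi * Complex.I := by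
  have h : (-z).arg = z.arg + Real.pi := Complex.arg_neg_eq_arg_add_pi_iff.2 (by tauto)
  rw [Complex.log, Complex.log, norm_neg, h]
  push_cast
  ring

theorem log_neg_of_im_pos {z : ℂ} (hz : 0 < z.im) :
    Complex.log (-z) = Complex.log z - Real.pi * Complex.I := by
  rw [Complex.log, Complex.log, norm_neg, Complex.arg_neg_eq_arg_sub_pi_of_im_pos hz]
  push_cast
  ring

/-- The cut itself goes with the side of negative imaginary part, because the principal argument is
`π` on the negative real axis. -/
theorem slitBranch_of_im_neg {i : Fin (n + 1)} {z : ℂ}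
    (hz : (zeta σ p i z).im < 0 ∨ z ∈ cut σ p i) : slitBranch σ p a z = sectorBranch σ p a i z := by
  unfold slitBranch sectorBranch
  congr 1
  refine Finset.sum_congr rfl fun k _ => ?_
  split_ifs with hk
  · subst hk
    rw [slitLog, log_neg_of_im_neg hz]
  · rfl

/-- On this side `log (-ζ)` is `log ζ - πi`, while `sectorBranch` continues `log ζ + πi` from the
other side. The discrepancy `-2πi` in the `i`-th logarithm produces the monodromy factor. -/
theorem slitBranch_of_im_pos {i : Fin (n + 1)} {z : ℂ} (hz : 0 < (zeta σ p i z).im) :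
    slitBranch σ p a z =
      Complex.exp (-(2 * Real.pi * Complex.I * a i)) * sectorBranch σ p a i z := by
  unfold slitBranch sectorBranch
  rw [← Complex.exp_add]
  congr 1
  rw [← Finset.add_sum_erase _ _ (Finset.mem_univ i), ← Finset.add_sum_erase (a := i) _
    (fun k => a k * if k = i then _ else _) (Finset.mem_univ i), ← add_assoc]
  congr 1
  · rw [if_pos rfl, slitLog, log_neg_of_im_pos hz]
    ring
  · refine Finset.sum_congr rfl fun k hk => ?_
    rw [if_neg (Finset.ne_of_mem_erase hk)]

end Cuts

/-! ## The first cohomology group of the punctured plane -/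

section BettiDimension

variable {n : ℕ} {K : Type} [Field K] [Algebra K ℂ] {σ a : Fin (n + 1) → ℂ} {p : ℂ} {ε : ℝ}

variable (σ p a) in
open scoped Classical in
/-- The function on the sector around the `i`-th cut that is `c i` times the branch on one side of
the cut, and zero on the other side. -/
def jump (c : Fin (n + 1) → K) (x z : ℂ) : ℂ :=
  ∑ i, if x ∈ cut σ p i ∧ 0 < (zeta σ p i z).im then
    algebraMap K ℂ (c i) * sectorBranch σ p a i z else 0

theorem jump_of_mem_slitDomain (c : Fin (n + 1) → K) {x : ℂ} (hx : x ∈ slitDomain σ p) :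
    jump σ a p c x = 0 := by
  funext z
  refine Finset.sum_eq_zero fun i _ => if_neg fun h => ?_
  exact cut_not_mem_slitDomain h.1 hx

theorem jump_of_mem_cut (hp : IsCutBase σ p ε) (c : Fin (n + 1) → K) {i : Fin (n + 1)} {x : ℂ}
    (hx : x ∈ cut σ p i) (z : ℂ) : jump σ a p c x z =
      if 0 < (zeta σ p i z).im then algebraMap K ℂ (c i) * sectorBranch σ p a i z else 0 := by
  classical
  unfold jump
  rw [Finset.sum_eq_single i]
  · simp only [hx, true_and]
  · exact fun k _ hk => if_neg fun h => hp.cut_disjoint hk.symm hx h.1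
  · exact fun h => (h (Finset.mem_univ i)).elim

/-- On a sector, comparing a point of the cut with a nearby point gives `0` below the cut, `c i`
times the branch above it, and `0` on it: in each case a section of the local system. -/
theorem jump_mem_cocycles (hK : HasMonodromy K a) (hp : IsCutBase σ p ε) (hσ0 : σ 0 = 0)
    (hσ : ∀ k ≠ 0, σ k ≠ 0) (c : Fin (n + 1) → K) : jump σ a p c ∈ cocycles K σ a := by
  intro x hx
  rcases hp.mem_slitDomain_or_cut hx with h | ⟨i, hi⟩
  · filter_upwards [isOpen_slitDomain.mem_nhds h] with y hy
    rw [jump_of_mem_slitDomain c h, jump_of_mem_slitDomain c hy, sub_zero]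
    exact zero_mem _
  · filter_upwards [(isOpen_sector i).mem_nhds (hp.cut_subset_sector i hi)] with y hy
    rcases lt_trichotomy (zeta σ p i y).im 0 with him | him | him
    · rw [jump_of_mem_slitDomain c (hp.sector_subset_slitDomain hy him.ne), sub_zero]
      refine mem_stalk_of_eventuallyEq hK (isBranchAt_sectorBranch a hp hσ0 hσ hy) 0 ?_
      filter_upwards [(isOpen_im_zeta_lt i).mem_nhds him] with z hz
      rw [jump_of_mem_cut hp c hi, if_neg (not_lt.2 (le_of_lt hz)), map_zero, zero_mul]
    · have hyc : y ∈ cut σ p i := ⟨him, hp.sector_re_pos hy⟩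
      have : jump σ a p c x - jump σ a p c y = 0 := by
        funext z
        rw [Pi.sub_apply, jump_of_mem_cut hp c hi, jump_of_mem_cut hp c hyc, sub_self,
          Pi.zero_apply]
      rw [this]
      exact zero_mem _
    · rw [jump_of_mem_slitDomain c (hp.sector_subset_slitDomain hy him.ne'), sub_zero]
      refine mem_stalk_of_eventuallyEq hK (isBranchAt_sectorBranch a hp hσ0 hσ hy) (c i) ?_
      filter_upwards [(isOpen_im_zeta_pos i).mem_nhds him] with z hz
      rw [jump_of_mem_cut hp c hi, if_pos hz]

variable (K) in
/-- The map sending the jumps along the cuts to the corresponding cohomology class. -/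
def jumpClass (hK : HasMonodromy K a) (hp : IsCutBase σ p ε) (hσ0 : σ 0 = 0)
    (hσ : ∀ k ≠ 0, σ k ≠ 0) : (Fin (n + 1) → K) →ₗ[K] H1 K σ a :=
  H1.mk K σ a ∘ₗ
    { toFun := fun c => ⟨jump σ a p c, jump_mem_cocycles hK hp hσ0 hσ c⟩
      map_add' := fun c d => Subtype.ext <| by
        funext x z
        change jump σ a p (c + d) x z = jump σ a p c x z + jump σ a p d x z
        unfold jump
        rw [← Finset.sum_add_distrib]
        refine Finset.sum_congr rfl fun i _ => ?_
        split_ifs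
        · rw [Pi.add_apply, map_add, add_mul]
        · rw [add_zero]
      map_smul' := fun r c => Subtype.ext <| by
        funext x z
        change jump σ a p (r • c) x z = r • jump σ a p c x z
        unfold jump
        rw [Finset.smul_sum]
        refine Finset.sum_congr rfl fun i _ => ?_
        split_ifs
        · rw [Pi.smul_apply, smul_eq_mul, map_mul, Algebra.smul_def, mul_assoc]
        · rw [smul_zero] }

theorem H1.mk_eq_zero_iff (u : cocycles K σ a) :
    H1.mk K σ a u = 0 ↔ ∃ f : ℂ → ℂ, ∀ x ∉ Set.range σ, u.1 x - f ∈ stalk K σ a x :=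
  Submodule.Quotient.mk_eq_zero _

theorem H1.mk_eq_mk_iff (u v : cocycles K σ a) : H1.mk K σ a u = H1.mk K σ a v ↔
    ∃ f : ℂ → ℂ, ∀ x ∉ Set.range σ, u.1 x - v.1 x - f ∈ stalk K σ a x := by
  rw [← sub_eq_zero, ← map_sub, H1.mk_eq_zero_iff]
  rfl

/-- A cocycle lifts to `f` on the cut plane and to `g i` on each sector. The difference `g i - f` is
`c i` times the branch below the cut and `d i` times it above, so the cocycle is cohomologous to the
jumps `d i - c i`. -/
theorem jumpClass_surjective (hK : HasMonodromy K a) (hp : IsCutBase σ p ε) (hσ0 : σ 0 = 0)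
    (hσ : ∀ k ≠ 0, σ k ≠ 0) : Function.Surjective (jumpClass K hK hp hσ0 hσ) := by
  classical
  intro ξ
  obtain ⟨u, rfl⟩ := Submodule.mkQ_surjective _ ξ
  have : SimplyConnectedSpace (slitDomain σ p) := hp.simplyConnectedSpace_slitDomain
  obtain ⟨f, hf⟩ := exists_lift hK isOpen_slitDomain (fun x => slitDomain_not_mem_range)
    (fun x hx => isBranchAt_slitBranch a hp hσ0 hσ hx) u.2
  have hlift : ∀ i, ∃ g : ℂ → ℂ, ∀ x ∈ sector σ p ε i, u.1 x - g ∈ stalk K σ a x := fun i => by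
    have : SimplyConnectedSpace (sector σ p ε i) := hp.simplyConnectedSpace_sector i
    exact exists_lift hK (isOpen_sector i) (fun x hx => hp.sector_not_mem_range hx)
      (fun x hx => isBranchAt_sectorBranch a hp hσ0 hσ hx) u.2
  choose g hg using hlift
  have hside : ∀ i (W : Set ℂ), IsOpen W → Convex ℝ W → (∀ z ∈ W, (zeta σ p i z).im ≠ 0) →
      ∃ c : K, ∀ z ∈ sector σ p ε i ∩ W,
        (g i - f) z = algebraMap K ℂ c * sectorBranch σ p a i z := by
    intro i W hWo hWc hW
    refine exists_eq_mul_branch hK ((convex_sector i).inter hWc).isPreconnected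
      ((isOpen_sector i).inter hWo)
      (fun x hx => isBranchAt_sectorBranch a hp hσ0 hσ hx.1) fun x hx => ?_
    have h1 := hf x (hp.sector_subset_slitDomain hx.1 (hW x hx.2))
    have h2 := hg i x hx.1
    have : g i - f = (u.1 x - f) - (u.1 x - g i) := by abel
    rw [this]
    exact sub_mem h1 h2
  have hneg := fun i => hside i _ (isOpen_im_zeta_lt i) (convex_im_zeta_lt i)
    fun z hz => ne_of_lt hz
  have hpos := fun i => hside i _ (isOpen_im_zeta_pos i) (convex_im_zeta_pos i)
    fun z hz => ne_of_gt hz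
  choose c hc using hneg
  choose d hd using hpos
  refine ⟨fun i => d i - c i, ?_⟩
  -- On the cuts `f` carries no information. There `F` takes the values that continue the identity
  -- `f = g i - c i * branch`, valid below the cut.
  let F : ℂ → ℂ := fun z => if h : ∃ i, z ∈ cut σ p i then
    g h.choose z - algebraMap K ℂ (c h.choose) * sectorBranch σ p a h.choose z else f z
  have hFcut : ∀ i, ∀ z ∈ cut σ p i,
      F z = g i z - algebraMap K ℂ (c i) * sectorBranch σ p a i z := fun i z hz => by
    have h : ∃ i, z ∈ cut σ p i := ⟨i, hz⟩
    have hi : h.choose = i := by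
      by_contra hne
      exact hp.cut_disjoint hne h.choose_spec hz
    simp only [F, dif_pos h, hi]
  have hFslit : ∀ z ∈ slitDomain σ p, F z = f z := fun z hz =>
    dif_neg fun ⟨i, hi⟩ => cut_not_mem_slitDomain hi hz
  refine ((H1.mk_eq_mk_iff _ _).2 ⟨-F, fun x hx => ?_⟩)
  change jump σ a p (fun i => d i - c i) x - u.1 x - -F ∈ stalk K σ a x
  rcases hp.mem_slitDomain_or_cut hx with h | ⟨i, hi⟩
  · rw [jump_of_mem_slitDomain _ h]
    refine stalk_congr hK (isBranchAt_slitBranch a hp hσ0 hσ h) (neg_mem (hf x h)) ?_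
    filter_upwards [isOpen_slitDomain.mem_nhds h] with y hy
    simp only [Pi.sub_apply, Pi.neg_apply, Pi.zero_apply, hFslit y hy]
    ring
  · have hxs := hp.cut_subset_sector i hi
    have hb := isBranchAt_sectorBranch a hp hσ0 hσ hxs
    obtain ⟨e, he⟩ := (mem_stalk_iff hK hb).1 (hg i x hxs)
    refine mem_stalk_of_eventuallyEq hK hb (-e - c i) ?_
    filter_upwards [he, (isOpen_sector i).mem_nhds hxs] with y hy hys
    have hj := jump_of_mem_cut (a := a) hp (fun i => d i - c i) hi y
    simp only [Pi.sub_apply, Pi.neg_apply] at hy ⊢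
    rw [hj]
    rcases lt_trichotomy (zeta σ p i y).im 0 with him | him | him
    · have h1 := hc i y ⟨hys, him⟩
      rw [Pi.sub_apply] at h1
      rw [if_neg (not_lt.2 him.le), hFslit y (hp.sector_subset_slitDomain hys him.ne), map_sub,
        map_neg]
      linear_combination -hy - h1
    · rw [if_neg (not_lt.2 him.le), hFcut i y ⟨him, hp.sector_re_pos hys⟩, map_sub, map_neg]
      linear_combination -hy
    · have h1 := hd i y ⟨hys, him⟩
      rw [Pi.sub_apply] at h1
      rw [if_pos him, hFslit y (hp.sector_subset_slitDomain hys him.ne'), map_sub, map_sub,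
        map_neg]
      linear_combination -hy - h1

/-- The kernel of `jumpClass` consists of the jumps of multiples of the branch on the cut plane. -/
theorem jumpClass_eq_zero_iff (hK : HasMonodromy K a) (hp : IsCutBase σ p ε) (hσ0 : σ 0 = 0)
    (hσ : ∀ k ≠ 0, σ k ≠ 0) (c : Fin (n + 1) → K) : jumpClass K hK hp hσ0 hσ c = 0 ↔
      ∃ β : K, ∀ i, algebraMap K ℂ (c i) =
        algebraMap K ℂ β * (Complex.exp (-(2 * Real.pi * Complex.I * a i)) - 1) := by
  refine (H1.mk_eq_zero_iff _).trans ?_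
  change (∃ f : ℂ → ℂ, ∀ x ∉ Set.range σ, jump σ a p c x - f ∈ stalk K σ a x) ↔ _
  constructor
  · rintro ⟨f, hf⟩
    have : SimplyConnectedSpace (slitDomain σ p) := hp.simplyConnectedSpace_slitDomain
    obtain ⟨β, hβ⟩ := exists_eq_mul_branch hK (W := slitDomain σ p) (f := -f)
      (isPreconnected_iff_preconnectedSpace.2 inferInstance) isOpen_slitDomain
      (fun x hx => isBranchAt_slitBranch a hp hσ0 hσ hx) fun x hx => by
        have := hf x (slitDomain_not_mem_range hx)
        rwa [jump_of_mem_slitDomain c hx, zero_sub] at this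
    refine ⟨-β, fun i => ?_⟩
    obtain ⟨⟨z₁, hz₁, hz₁'⟩, ⟨z₂, hz₂, hz₂'⟩, x, hx⟩ := hp.sector_nonempty i
    obtain ⟨e, he⟩ := exists_eq_mul_branch hK (f := jump σ a p c x - f)
      (convex_sector (σ := σ) (p := p) (ε := ε) i).isPreconnected
      (isOpen_sector i) (fun y hy => isBranchAt_sectorBranch a hp hσ0 hσ hy) fun y hy => by
        rcases eq_or_ne (zeta σ p i y).im 0 with him | him
        · have hyc : y ∈ cut σ p i := ⟨him, hp.sector_re_pos hy⟩
          have : jump σ a p c x = jump σ a p c y := by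
            funext z
            rw [jump_of_mem_cut hp c hx, jump_of_mem_cut hp c hyc]
          rw [this]
          exact hf y (hp.sector_not_mem_range hy)
        · have hys := hp.sector_subset_slitDomain hy him
          have h1 := hf y (hp.sector_not_mem_range hy)
          rw [jump_of_mem_slitDomain c hys] at h1
          have h2 : jump σ a p c x ∈ stalk K σ a y := by
            have hb := isBranchAt_sectorBranch a hp hσ0 hσ hy
            rcases lt_or_gt_of_ne him with him | him
            · refine mem_stalk_of_eventuallyEq hK hb 0 ?_
              filter_upwards [(isOpen_im_zeta_lt i).mem_nhds him] with z hz
              rw [jump_of_mem_cut hp c hx, if_neg (not_lt.2 (le_of_lt hz)), map_zero, zero_mul]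
            · refine mem_stalk_of_eventuallyEq hK hb (c i) ?_
              filter_upwards [(isOpen_im_zeta_pos i).mem_nhds him] with z hz
              rw [jump_of_mem_cut hp c hx, if_pos hz]
          have : jump σ a p c x - f = jump σ a p c x + (0 - f) := by abel
          rw [this]
          exact add_mem h2 h1
    have e1 := he z₁ hz₁
    have e2 := he z₂ hz₂
    have b1 := hβ z₁ (hp.sector_subset_slitDomain hz₁ (ne_of_lt hz₁'))
    have b2 := hβ z₂ (hp.sector_subset_slitDomain hz₂ (ne_of_gt hz₂'))
    have n1 := (isBranchAt_sectorBranch a hp hσ0 hσ hz₁).ne_zero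
    have n2 := (isBranchAt_sectorBranch a hp hσ0 hσ hz₂).ne_zero
    rw [Pi.sub_apply, jump_of_mem_cut hp c hx, if_neg (not_lt.2 (le_of_lt hz₁'))] at e1
    rw [Pi.sub_apply, jump_of_mem_cut hp c hx, if_pos (show 0 < (zeta σ p i z₂).im from hz₂')] at e2
    rw [Pi.neg_apply, slitBranch_of_im_neg a (Or.inl hz₁')] at b1
    rw [Pi.neg_apply, slitBranch_of_im_pos a hz₂'] at b2
    -- Below the cut there is no jump, so the constant `e` of the sector is `β`. Above it, the same
    -- `e` equals `c i + β * exp (-2πi a i)`, which determines `c i`.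
    have h3 : algebraMap K ℂ e = algebraMap K ℂ β := by
      apply mul_right_cancel₀ n1
      linear_combination b1 - e1
    apply mul_right_cancel₀ n2
    rw [map_neg]
    linear_combination e2 - b2 + sectorBranch σ p a i z₂ * h3
  · rintro ⟨β, hβ⟩
    refine ⟨fun z => algebraMap K ℂ β * slitBranch σ p a z, fun x hx => ?_⟩
    rcases hp.mem_slitDomain_or_cut hx with h | ⟨i, hi⟩
    · rw [jump_of_mem_slitDomain c h]
      refine mem_stalk_of_eventuallyEq hK (isBranchAt_slitBranch a hp hσ0 hσ h) (-β)
        (Filter.Eventually.of_forall fun y => ?_)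
      simp
    · have hxs := hp.cut_subset_sector i hi
      refine mem_stalk_of_eventuallyEq hK (isBranchAt_sectorBranch a hp hσ0 hσ hxs) (-β) ?_
      filter_upwards [(isOpen_sector i).mem_nhds hxs] with y hys
      rw [Pi.sub_apply, jump_of_mem_cut hp c hi, map_neg]
      rcases lt_trichotomy (zeta σ p i y).im 0 with him | him | him
      · rw [if_neg (not_lt.2 him.le), slitBranch_of_im_neg a (Or.inl him)]
        ring
      · rw [if_neg (not_lt.2 him.le),
          slitBranch_of_im_neg a (Or.inr ⟨him, hp.sector_re_pos hys⟩)]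
        ring
      · rw [if_pos him, slitBranch_of_im_pos a him, hβ i]
        ring

/-- The generator has components `exp (-2πi a i) - 1`; the one with index `0` is nonzero because `a
0` is not an integer. -/
theorem exists_span_ker_jumpClass (hK : HasMonodromy K a) (hp : IsCutBase σ p ε) (hσ0 : σ 0 = 0)
    (hσ : ∀ k ≠ 0, σ k ≠ 0) (ha : ∀ m : ℤ, a 0 ≠ m) :
    ∃ τ : Fin (n + 1) → K, τ ≠ 0 ∧ LinearMap.ker (jumpClass K hK hp hσ0 hσ) = K ∙ τ := by
  have hK' := hK
  choose c hc using hK'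
  have hτ : ∀ i, algebraMap K ℂ ((c i)⁻¹ - 1) =
      Complex.exp (-(2 * Real.pi * Complex.I * a i)) - 1 := fun i => by
    rw [map_sub, map_inv₀, hc, map_one, Complex.exp_neg]
  refine ⟨fun i => (c i)⁻¹ - 1, fun h => ?_, ?_⟩
  · have h0 := hτ 0
    rw [congrFun h 0, Pi.zero_apply, map_zero, eq_comm, sub_eq_zero, Complex.exp_eq_one_iff] at h0
    obtain ⟨m, hm⟩ := h0
    refine ha (-m) ?_
    apply mul_left_cancel₀ Complex.two_pi_I_ne_zero
    push_cast
    linear_combination -hm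
  · ext v
    rw [LinearMap.mem_ker, jumpClass_eq_zero_iff, Submodule.mem_span_singleton]
    refine exists_congr fun β => ⟨fun h => funext fun i => ?_, fun h i => ?_⟩
    · apply (algebraMap K ℂ).injective
      rw [h i, Pi.smul_apply, smul_eq_mul, map_mul, hτ]
    · rw [← h, Pi.smul_apply, smul_eq_mul, map_mul, hτ]

theorem exists_base (hσ0 : σ 0 = 0) (hσi : Function.Injective σ) :
    (∃ p ε, IsCutBase σ p ε) ∧ ∀ k ≠ 0, σ k ≠ 0 :=
  ⟨exists_isCutBase hσi, fun _ hk h => hk (hσi (h.trans hσ0.symm))⟩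

theorem finiteDimensional_H1 (hK : HasMonodromy K a) (hσ0 : σ 0 = 0)
    (hσi : Function.Injective σ) : FiniteDimensional K (H1 K σ a) := by
  obtain ⟨⟨p, ε, hp⟩, hσ⟩ := exists_base hσ0 hσi
  exact Module.Finite.of_surjective _ (jumpClass_surjective hK hp hσ0 hσ)

theorem finrank_H1 (hK : HasMonodromy K a) (hσ0 : σ 0 = 0) (hσi : Function.Injective σ)
    (ha : ∀ m : ℤ, a 0 ≠ m) : Module.finrank K (H1 K σ a) = n := by
  obtain ⟨⟨p, ε, hp⟩, hσ⟩ := exists_base hσ0 hσi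
  obtain ⟨τ, hτ, hker⟩ := exists_span_ker_jumpClass hK hp hσ0 hσ ha
  have h := (jumpClass K hK hp hσ0 hσ).finrank_range_add_finrank_ker
  rw [LinearMap.range_eq_top.2 (jumpClass_surjective hK hp hσ0 hσ), finrank_top, hker,
    finrank_span_singleton hτ, Module.finrank_fin_fun] at h
  omega

theorem toComplex_jumpClass (hK : HasMonodromy K a) (hp : IsCutBase σ p ε) (hσ0 : σ 0 = 0)
    (hσ : ∀ k ≠ 0, σ k ≠ 0) (c : Fin (n + 1) → K) :
    H1.toComplex K σ a (jumpClass K hK hp hσ0 hσ c) =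
      jumpClass ℂ (hasMonodromy_complex a) hp hσ0 hσ fun i => algebraMap K ℂ (c i) := rfl

/-- Unit jumps are defined over `K` and generate the complex cohomology, which gives surjectivity;
both dimensions are `n`. -/
theorem complexify_bijective (hK : HasMonodromy K a) (hσ0 : σ 0 = 0)
    (hσi : Function.Injective σ) (ha : ∀ m : ℤ, a 0 ≠ m) :
    Function.Bijective (H1.complexify K σ a) := by
  obtain ⟨⟨p, ε, hp⟩, hσ⟩ := exists_base hσ0 hσi
  have hsurj : Function.Surjective (H1.complexify K σ a) := by
    rw [← LinearMap.range_eq_top, eq_top_iff]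
    rintro ξ -
    obtain ⟨c, rfl⟩ := jumpClass_surjective (hasMonodromy_complex a) hp hσ0 hσ ξ
    rw [pi_eq_sum_univ c, map_sum]
    refine Submodule.sum_mem _ fun i _ => ?_
    rw [map_smul]
    refine Submodule.smul_mem _ _ ⟨1 ⊗ₜ jumpClass K hK hp hσ0 hσ fun j => if i = j then 1 else 0, ?_⟩
    rw [H1.complexify, LinearMap.liftBaseChange_tmul, one_smul, toComplex_jumpClass]
    congr 1
    funext j
    split_ifs <;> simp
  have h1 := finiteDimensional_H1 hK hσ0 hσi
  have h2 := finiteDimensional_H1 (hasMonodromy_complex a) hσ0 hσi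
  refine ⟨(LinearMap.injective_iff_surjective_of_finrank_eq_finrank ?_).2 hsurj, hsurj⟩
  rw [Module.finrank_baseChange, finrank_H1 hK hσ0 hσi ha,
    finrank_H1 (hasMonodromy_complex a) hσ0 hσi ha]

end BettiDimension

/-! ## Solutions of the connection near the punctures and at infinity -/

section LocalSolutions

open Metric

/-- On monomials, `w * d/dw + c` multiplies `w ^ m` by `c + m`, so the solution is the power series
of `H` with coefficients divided by `c + m`. -/
theorem exists_solution_of_constant {r : ℝ} {c : ℂ} (hc : ∀ m : ℕ, c + m ≠ 0) {H : ℂ → ℂ}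
    (hH : DifferentiableOn ℂ H (ball 0 r)) :
    ∃ ψ : ℂ → ℂ, ∀ w ∈ ball (0 : ℂ) r, ∃ ψ', HasDerivAt ψ ψ' w ∧ w * ψ' + c * ψ w = H w := by
  let h : ℕ → ℂ := fun m => (m.factorial : ℂ)⁻¹ * iteratedDeriv m H 0
  have hsum : ∀ w ∈ ball (0 : ℂ) r, HasSum (fun m => h m * w ^ m) (H w) := fun w hw => by
    refine (Complex.hasSum_taylorSeries_on_ball hH hw).congr_fun fun m => ?_
    simp only [h, sub_zero, smul_eq_mul]
    ring
  -- A uniform bound on the divisors ensures convergence on the whole disc.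
  obtain ⟨C, hC⟩ : ∃ C, ∀ m : ℕ, ‖(c + m)⁻¹‖ ≤ C := by
    have h1 : Filter.Tendsto (fun m : ℕ => (c + m)⁻¹) Filter.atTop (𝓝 0) :=
      Filter.tendsto_inv₀_cobounded.comp (Filter.Tendsto.comp
        (tendsto_const_add_cobounded c) tendsto_natCast_atTop_cobounded)
    obtain ⟨C, hC⟩ := (Metric.isBounded_range_of_tendsto _ h1).exists_norm_le
    exact ⟨C, fun m => hC _ ⟨m, rfl⟩⟩
  have hC0 : 0 ≤ C := (norm_nonneg _).trans (hC 0)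
  let F : ℕ → ℂ → ℂ := fun m w => h m * (c + m)⁻¹ * w ^ m
  refine ⟨fun w => ∑' m, F m w, fun w hw => ?_⟩
  rw [mem_ball_zero_iff] at hw
  obtain ⟨ρ, hwρ, hρr⟩ := exists_between hw
  have hρ0 : 0 < ρ := (norm_nonneg w).trans_lt hwρ
  have hu : Summable fun m => C * ‖h m * (ρ : ℂ) ^ m‖ :=
    ((hsum ρ (by rw [mem_ball_zero_iff, Complex.norm_real, Real.norm_of_nonneg hρ0.le]
                 exact hρr)).summable.norm).mul_left C
  have hbound : ∀ m, ∀ v ∈ ball (0 : ℂ) ρ, ‖F m v‖ ≤ C * ‖h m * (ρ : ℂ) ^ m‖ := by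
    intro m v hv
    rw [mem_ball_zero_iff] at hv
    simp only [F, norm_mul, norm_pow, Complex.norm_real, Real.norm_of_nonneg hρ0.le]
    rw [mul_comm ‖h m‖ ‖(c + m)⁻¹‖, mul_assoc]
    gcongr
    exact hC m
  have hFd : ∀ m, Differentiable ℂ (F m) := fun m => by fun_prop
  have hwb : w ∈ ball (0 : ℂ) ρ := by rwa [mem_ball_zero_iff]
  have hdiff : DifferentiableOn ℂ (fun w => ∑' m, F m w) (ball 0 ρ) :=
    Complex.differentiableOn_tsum_of_summable_norm hu (fun m => (hFd m).differentiableOn)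
      isOpen_ball hbound
  refine ⟨_, (hdiff.differentiableAt (isOpen_ball.mem_nhds hwb)).hasDerivAt, ?_⟩
  have h1 := Complex.hasSum_deriv_of_summable_norm hu (fun m => (hFd m).differentiableOn)
    isOpen_ball hbound hwb
  have h2 : HasSum (fun m => F m w) (∑' m, F m w) :=
    (Summable.of_norm_bounded hu fun m => hbound m w hwb).hasSum
  refine ((h1.mul_left w).add (h2.mul_left c)).unique ?_
  refine (hsum w (by rwa [mem_ball_zero_iff])).congr_fun fun m => ?_
  have hd : deriv (F m) w = h m * (c + m)⁻¹ * (m * w ^ (m - 1)) :=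
    ((hasDerivAt_pow m w).const_mul _).deriv
  have hw' : w * (m * w ^ (m - 1)) = m * w ^ m := by
    cases m with
    | zero => simp
    | succ m => rw [Nat.add_sub_cancel, pow_succ]; ring
  have := hc m
  rw [hd]
  simp only [F]
  field_simp
  linear_combination h m * hw'

/-- An integrating factor: multiplying a solution by `G` removes `B` and leaves an equation with the
constant exponent `c`. -/
theorem exists_gauge {r : ℝ} {B : ℂ → ℂ} (hB : DifferentiableOn ℂ B (ball 0 r)) :
    ∃ G : ℂ → ℂ, (∀ w, G w ≠ 0) ∧ ∀ w ∈ ball (0 : ℂ) r, HasDerivAt G (G w * B w) w := by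
  obtain ⟨g, hg⟩ := hB.isExactOn_ball
  exact ⟨fun w => Complex.exp (g w), fun w => Complex.exp_ne_zero _, fun w hw => (hg w hw).cexp⟩

/-- Existence of a holomorphic solution of a first order equation at a regular singular point. -/
theorem exists_regular_solution {r : ℝ} {c : ℂ} (hc : ∀ m : ℕ, c + m ≠ 0) {A B : ℂ → ℂ}
    (hA : DifferentiableOn ℂ A (ball 0 r)) (hB : DifferentiableOn ℂ B (ball 0 r)) :
    ∃ φ : ℂ → ℂ, ∀ w ∈ ball (0 : ℂ) r, ∃ φ', HasDerivAt φ φ' w ∧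
      w * φ' + (c + w * B w) * φ w = A w := by
  obtain ⟨G, hG0, hG⟩ := exists_gauge hB
  obtain ⟨ψ, hψ⟩ := exists_solution_of_constant hc (H := fun w => G w * A w)
    (DifferentiableOn.mul (fun w hw => (hG w hw).differentiableAt.differentiableWithinAt) hA)
  refine ⟨fun w => ψ w / G w, fun w hw => ?_⟩
  obtain ⟨ψ', h1, h2⟩ := hψ w hw
  refine ⟨_, h1.div (hG w hw) (hG0 w), ?_⟩
  have := hG0 w
  field_simp
  linear_combination h2

/-- If the exponent is not an integer, then a solution on a punctured disc is unique. -/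
theorem regular_solution_unique {r : ℝ} {c : ℂ} (hc : ∀ m : ℤ, c ≠ m) {A B f φ : ℂ → ℂ}
    (hB : DifferentiableOn ℂ B (ball 0 r))
    (hf : ∀ w ∈ ball (0 : ℂ) r, w ≠ 0 → ∃ f', HasDerivAt f f' w ∧
      w * f' + (c + w * B w) * f w = A w)
    (hφ : ∀ w ∈ ball (0 : ℂ) r, w ≠ 0 → ∃ φ', HasDerivAt φ φ' w ∧
      w * φ' + (c + w * B w) * φ w = A w) {w : ℂ} (hw : w ∈ ball (0 : ℂ) r) (hw0 : w ≠ 0) :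
    f w = φ w := by
  obtain ⟨G, hG0, hG⟩ := exists_gauge hB
  let D : ℂ → ℂ := fun w => (f w - φ w) * G w
  have hD : ∀ w ∈ ball (0 : ℂ) r, w ≠ 0 → ∃ D', HasDerivAt D D' w ∧ w * D' = -c * D w := by
    intro w hw hw0
    obtain ⟨f', h1, h2⟩ := hf w hw hw0
    obtain ⟨φ', h3, h4⟩ := hφ w hw hw0
    refine ⟨_, (h1.sub h3).mul (hG w hw), ?_⟩
    simp only [D, Pi.sub_apply]
    linear_combination G w * (h2 - h4)
  -- The gauged difference `D` satisfies `w * D' = -c * D`, so `E` is constant along the circle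
  -- through `w`. A full turn multiplies it by `exp (2πi c)`, which is not `1`; hence `D w = 0`.
  let E : ℝ → ℂ := fun θ => D (w * Complex.exp (Complex.I * θ)) * Complex.exp (Complex.I * c * θ)
  have hE : ∀ θ, HasDerivAt E 0 θ := fun θ => by
    have hwθ : w * Complex.exp (Complex.I * θ) ∈ ball (0 : ℂ) r := by
      rw [mem_ball_zero_iff] at hw ⊢
      rwa [norm_mul, mul_comm Complex.I, Complex.norm_exp_ofReal_mul_I, mul_one]
    obtain ⟨D', h1, h2⟩ := hD _ hwθ (mul_ne_zero hw0 (Complex.exp_ne_zero _))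
    have h3 : HasDerivAt (fun θ : ℝ => w * Complex.exp (Complex.I * θ))
        (w * (Complex.exp (Complex.I * θ) * Complex.I)) θ := by
      have := ((hasDerivAt_id θ).ofReal_comp.const_mul Complex.I).cexp.const_mul w
      simpa using this
    have h4 : HasDerivAt (fun θ : ℝ => Complex.exp (Complex.I * c * θ))
        (Complex.exp (Complex.I * c * θ) * (Complex.I * c)) θ := by
      have := ((hasDerivAt_id θ).ofReal_comp.const_mul (Complex.I * c)).cexp
      simpa using this
    have h5 := (h1.comp θ h3).mul h4
    refine h5.congr_deriv ?_
    simp only [Function.comp]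
    linear_combination Complex.I * Complex.exp (Complex.I * c * θ) * h2
  have h1 : E (2 * Real.pi) = E 0 :=
    is_const_of_deriv_eq_zero (fun θ => (hE θ).differentiableAt) (fun θ => (hE θ).deriv) _ _
  have h2 : Complex.exp (Complex.I * ((2 * Real.pi : ℝ) : ℂ)) = 1 := by
    rw [← Complex.exp_two_pi_mul_I]; congr 1; push_cast; ring
  simp only [E, h2, Complex.ofReal_zero, mul_zero, Complex.exp_zero, mul_one] at h1
  have h3 : Complex.exp (Complex.I * c * ((2 * Real.pi : ℝ) : ℂ)) ≠ 1 := fun h => by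
    obtain ⟨m, hm⟩ := Complex.exp_eq_one_iff.1 h
    refine hc m (mul_left_cancel₀ Complex.two_pi_I_ne_zero ?_)
    push_cast at hm
    linear_combination hm
  have h4 : D w = 0 := by
    by_contra h
    exact h3 (mul_left_cancel₀ h (by rw [h1, mul_one]))
  exact sub_eq_zero.1 ((mul_eq_zero.1 h4).resolve_right (hG0 w))

/-! ### The equation of a logarithmic form in coordinates at the punctures and at infinity. -/

variable {n : ℕ} {σ s p : Fin (n + 1) → ℂ}

/-- The part of `logCoeff` that is regular at the puncture `σ k`, in a coordinate centered there. -/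
def regularPart (σ p : Fin (n + 1) → ℂ) (k : Fin (n + 1)) (w : ℂ) : ℂ :=
  ∑ j ∈ Finset.univ.erase k, p j / (σ k + w - σ j)

theorem logCoeff_eq_add_regularPart (k : Fin (n + 1)) (w : ℂ) :
    logCoeff σ p (σ k + w) = p k / w + regularPart σ p k w := by
  rw [logCoeff, regularPart, ← Finset.add_sum_erase _ _ (Finset.mem_univ k), add_sub_cancel_left]

theorem differentiableOn_regularPart {r : ℝ} {k : Fin (n + 1)}
    (hr : ∀ j ≠ k, r ≤ ‖σ j - σ k‖) : DifferentiableOn ℂ (regularPart σ p k) (ball 0 r) := by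
  intro w hw
  refine DifferentiableAt.differentiableWithinAt ?_
  unfold regularPart
  refine DifferentiableAt.fun_sum fun j hj => ?_
  refine (differentiableAt_const _).div (by fun_prop) fun h => ?_
  have h1 := hr j (Finset.ne_of_mem_erase hj)
  rw [mem_ball_zero_iff] at hw
  rw [show σ j - σ k = w by linear_combination -h] at h1
  linarith

/-- The function `f` is a solution of `ν + ∇f = 0` at `z`, where `ν` is the form with
coefficients `p` and the connection has exponents `-s`. -/
def IsSolutionAt (σ s p : Fin (n + 1) → ℂ) (f : ℂ → ℂ) (z : ℂ) : Prop :=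
  HasDerivAt f (f z * logCoeff σ s z - logCoeff σ p z) z

theorem isSolutionAt_add_iff {f : ℂ → ℂ} {k : Fin (n + 1)} {w : ℂ} (hw : w ≠ 0) :
    IsSolutionAt σ s p f (σ k + w) ↔ ∃ f', HasDerivAt (fun w => f (σ k + w)) f' w ∧
      w * f' + (-s k + w * -regularPart σ s k w) * f (σ k + w) =
        -(p k + w * regularPart σ p k w) := by
  unfold IsSolutionAt
  rw [logCoeff_eq_add_regularPart, logCoeff_eq_add_regularPart]
  constructor
  · intro h
    refine ⟨_, h.comp_const_add (σ k) w, ?_⟩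
    field_simp
    ring
  · rintro ⟨f', h1, h2⟩
    have h3 := HasDerivAt.comp_sub_const (σ k + w) (σ k) (f := fun w => f (σ k + w)) (f' := f')
      (by simpa using h1)
    simp only [add_sub_cancel] at h3
    refine h3.congr_deriv (mul_left_cancel₀ hw ?_)
    field_simp
    linear_combination h2

/-- The exponent of the equation at `σ k` is `-s k`. The value of the solution at the puncture is
read off from the equation at `w = 0`; it later supplies the residues. -/
theorem exists_solution_near_puncture {r : ℝ} (hr0 : 0 < r) {k : Fin (n + 1)}
    (hs : ∀ m : ℤ, s k ≠ m) (hr : ∀ j ≠ k, r ≤ ‖σ j - σ k‖) :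
    ∃ φ : ℂ → ℂ, DifferentiableOn ℂ φ (ball (σ k) r) ∧ s k * φ (σ k) = p k ∧
      ∀ z ∈ ball (σ k) r, z ≠ σ k → IsSolutionAt σ s p φ z := by
  obtain ⟨φ, hφ⟩ := exists_regular_solution (c := -s k) (r := r)
    (fun m h => hs m (by linear_combination -h))
    (A := fun w => -(p k + w * regularPart σ p k w)) (B := fun w => -regularPart σ s k w)
    (((differentiableOn_const _).add
      (differentiableOn_id.mul (differentiableOn_regularPart hr))).neg)
    (differentiableOn_regularPart hr).neg
  have hball : ∀ z ∈ ball (σ k) r, z - σ k ∈ ball (0 : ℂ) r := fun z hz => by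
    rwa [mem_ball_zero_iff, ← dist_eq_norm]
  refine ⟨fun z => φ (z - σ k), fun z hz => ?_, ?_, fun z hz hz0 => ?_⟩
  · obtain ⟨φ', h1, -⟩ := hφ _ (hball z hz)
    exact (h1.comp_sub_const z (σ k)).differentiableAt.differentiableWithinAt
  · obtain ⟨φ', -, h2⟩ := hφ 0 (mem_ball_self hr0)
    simp only [sub_self]
    linear_combination -h2
  · obtain ⟨φ', h1, h2⟩ := hφ _ (hball z hz)
    have h3 := (isSolutionAt_add_iff (σ := σ) (s := s) (p := p) (k := k)
      (f := fun z => φ (z - σ k)) (sub_ne_zero.2 hz0)).2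
    simp only [add_sub_cancel_left, add_sub_cancel] at h3
    exact h3 ⟨φ', h1, h2⟩

theorem solution_near_puncture_unique {r : ℝ} {k : Fin (n + 1)}
    (hs : ∀ m : ℤ, s k ≠ m) (hr : ∀ j ≠ k, r ≤ ‖σ j - σ k‖) {f φ : ℂ → ℂ}
    (hf : ∀ z ∈ ball (σ k) r, z ≠ σ k → IsSolutionAt σ s p f z)
    (hφ : ∀ z ∈ ball (σ k) r, z ≠ σ k → IsSolutionAt σ s p φ z)
    {z : ℂ} (hz : z ∈ ball (σ k) r) (hz0 : z ≠ σ k) : f z = φ z := by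
  have hball : ∀ w ∈ ball (0 : ℂ) r, σ k + w ∈ ball (σ k) r := fun w hw => by
    simpa [dist_eq_norm] using hw
  have := regular_solution_unique (c := -s k) (r := r)
    (A := fun w => -(p k + w * regularPart σ p k w)) (B := fun w => -regularPart σ s k w)
    (f := fun w => f (σ k + w)) (φ := fun w => φ (σ k + w)) (w := z - σ k)
    (fun m h => hs (-m) (by push_cast; linear_combination -h))
    (differentiableOn_regularPart hr).neg
    (fun w hw hw0 => (isSolutionAt_add_iff hw0).1 (hf _ (hball w hw) (by simpa using hw0)))
    (fun w hw hw0 => (isSolutionAt_add_iff hw0).1 (hφ _ (hball w hw) (by simpa using hw0)))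
    (by rwa [mem_ball_zero_iff, ← dist_eq_norm]) (sub_ne_zero.2 hz0)
  simpa using this

/-- The function `logCoeff`, divided by the coordinate `w` at infinity. -/
def logCoeffInfty (σ p : Fin (n + 1) → ℂ) (w : ℂ) : ℂ := ∑ k, p k / (1 - σ k * w)

theorem logCoeff_inv {w : ℂ} (hw : w ≠ 0) :
    logCoeff σ p w⁻¹ = w * logCoeffInfty σ p w := by
  rw [logCoeff, logCoeffInfty, Finset.mul_sum]
  refine Finset.sum_congr rfl fun k _ => ?_
  rw [show w⁻¹ - σ k = (1 - σ k * w) / w by field_simp, div_div_eq_mul_div]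
  ring

theorem one_sub_mul_ne_zero {R : ℝ} (hR0 : 0 < R) (hR : ∀ k, ‖σ k‖ ≤ R) {w : ℂ}
    (hw : w ∈ ball (0 : ℂ) R⁻¹) (k : Fin (n + 1)) : 1 - σ k * w ≠ 0 := fun h => by
  rw [mem_ball_zero_iff] at hw
  have h1 : ‖σ k * w‖ < 1 := by
    rw [norm_mul]
    calc ‖σ k‖ * ‖w‖ ≤ R * ‖w‖ := by gcongr; exact hR k
      _ < R * R⁻¹ := by gcongr
      _ = 1 := mul_inv_cancel₀ hR0.ne'
  rw [← sub_eq_zero.1 h, norm_one] at h1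
  exact lt_irrefl _ h1

theorem differentiableOn_logCoeffInfty {R : ℝ} (hR0 : 0 < R) (hR : ∀ k, ‖σ k‖ ≤ R) :
    DifferentiableOn ℂ (logCoeffInfty σ p) (ball 0 R⁻¹) := by
  intro w hw
  refine DifferentiableAt.differentiableWithinAt ?_
  unfold logCoeffInfty
  exact DifferentiableAt.fun_sum fun k _ =>
    (differentiableAt_const _).div (by fun_prop) (one_sub_mul_ne_zero hR0 hR hw k)

theorem logCoeffInfty_eq {R : ℝ} (hR0 : 0 < R) (hR : ∀ k, ‖σ k‖ ≤ R) {w : ℂ}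
    (hw : w ∈ ball (0 : ℂ) R⁻¹) : logCoeffInfty σ s w =
      ∑ k, s k + w * logCoeffInfty σ (fun k => s k * σ k) w := by
  unfold logCoeffInfty
  rw [Finset.mul_sum, ← Finset.sum_add_distrib]
  refine Finset.sum_congr rfl fun k _ => ?_
  have := one_sub_mul_ne_zero hR0 hR hw k
  field_simp
  ring

/-- In the coordinate `w = 1 / z` the equation again has a regular singularity at `0`, now with
exponent `∑ s k`. -/
theorem isSolutionAt_inv_iff {R : ℝ} (hR0 : 0 < R) (hR : ∀ k, ‖σ k‖ ≤ R) {f : ℂ → ℂ} {w : ℂ}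
    (hw : w ∈ ball (0 : ℂ) R⁻¹) (hw0 : w ≠ 0) :
    IsSolutionAt σ s p f w⁻¹ ↔ ∃ f', HasDerivAt (fun w => f w⁻¹) f' w ∧
      w * f' + (∑ k, s k + w * logCoeffInfty σ (fun k => s k * σ k) w) * f w⁻¹ =
        logCoeffInfty σ p w := by
  unfold IsSolutionAt
  rw [logCoeff_inv hw0, logCoeff_inv hw0, ← logCoeffInfty_eq hR0 hR hw]
  constructor
  · intro h
    refine ⟨_, HasDerivAt.comp w h (hasDerivAt_inv hw0), ?_⟩
    field_simp
    ring
  · rintro ⟨f', h1, h2⟩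
    have h3 := HasDerivAt.comp w⁻¹ (h₂ := fun w => f w⁻¹) (h₂' := f') (by rwa [inv_inv])
      (hasDerivAt_inv (inv_ne_zero hw0))
    have h4 : ((fun w => f w⁻¹) ∘ fun w => w⁻¹) = f := by
      funext z
      simp
    rw [h4] at h3
    refine h3.congr_deriv ?_
    rw [inv_pow, inv_inv]
    linear_combination -w * h2

theorem mem_ball_inv_of_lt {R : ℝ} (hR0 : 0 < R) {z : ℂ} (hz : R < ‖z‖) :
    z⁻¹ ∈ ball (0 : ℂ) R⁻¹ ∧ z⁻¹ ≠ 0 := by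
  have : 0 < ‖z‖ := hR0.trans hz
  refine ⟨?_, inv_ne_zero (norm_pos_iff.1 this)⟩
  rw [mem_ball_zero_iff, norm_inv]
  gcongr

theorem exists_solution_near_infty {R : ℝ} (hR0 : 0 < R) (hR : ∀ k, ‖σ k‖ ≤ R)
    (hs : ∀ m : ℤ, ∑ k, s k ≠ m) :
    ∃ ψ : ℂ → ℂ, DifferentiableOn ℂ ψ (ball 0 R⁻¹) ∧ (∑ k, s k) * ψ 0 = ∑ k, p k ∧
      ∀ z, R < ‖z‖ → IsSolutionAt σ s p (fun z => ψ z⁻¹) z := by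
  obtain ⟨ψ, hψ⟩ := exists_regular_solution (c := ∑ k, s k) (r := R⁻¹)
    (fun m h => hs (-m) (by push_cast; linear_combination h))
    (differentiableOn_logCoeffInfty (p := p) hR0 hR)
    (differentiableOn_logCoeffInfty (p := fun k => s k * σ k) hR0 hR)
  refine ⟨ψ, fun w hw => ?_, ?_, fun z hz => ?_⟩
  · obtain ⟨ψ', h1, -⟩ := hψ w hw
    exact h1.differentiableAt.differentiableWithinAt
  · obtain ⟨ψ', -, h2⟩ := hψ 0 (mem_ball_self (inv_pos.2 hR0))
    simpa [logCoeffInfty] using h2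
  · obtain ⟨h1, h2⟩ := mem_ball_inv_of_lt hR0 hz
    have h3 := (isSolutionAt_inv_iff (s := s) (p := p) hR0 hR (f := fun z => ψ z⁻¹) h1 h2).2
    simp only [inv_inv] at h3
    exact h3 (hψ _ h1)

theorem solution_near_infty_unique {R : ℝ} (hR0 : 0 < R) (hR : ∀ k, ‖σ k‖ ≤ R)
    (hs : ∀ m : ℤ, ∑ k, s k ≠ m) {f φ : ℂ → ℂ} (hf : ∀ z, R < ‖z‖ → IsSolutionAt σ s p f z)
    (hφ : ∀ z, R < ‖z‖ → IsSolutionAt σ s p φ z) {z : ℂ} (hz : R < ‖z‖) : f z = φ z := by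
  have hball : ∀ w ∈ ball (0 : ℂ) R⁻¹, w ≠ 0 → R < ‖w⁻¹‖ := fun w hw hw0 => by
    rw [mem_ball_zero_iff] at hw
    rw [norm_inv]
    exact lt_inv_of_lt_inv₀ (norm_pos_iff.2 hw0) hw
  obtain ⟨h1, h2⟩ := mem_ball_inv_of_lt hR0 hz
  have := regular_solution_unique (c := ∑ k, s k) (r := R⁻¹) (f := fun w => f w⁻¹)
    (φ := fun w => φ w⁻¹) hs
    (differentiableOn_logCoeffInfty (p := fun k => s k * σ k) hR0 hR)
    (fun w hw hw0 => (isSolutionAt_inv_iff hR0 hR hw hw0).1 (hf _ (hball w hw hw0)))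
    (fun w hw hw0 => (isSolutionAt_inv_iff hR0 hR hw hw0).1 (hφ _ (hball w hw hw0))) h1 h2
  simpa using this

theorem exists_separation (hσ : Function.Injective σ) :
    ∃ r > 0, ∀ k, ∀ j ≠ k, 2 * r ≤ ‖σ j - σ k‖ := by
  have h : ∀ k j, ∀ᶠ r : ℝ in 𝓝[>] 0, j ≠ k → 2 * r ≤ ‖σ j - σ k‖ := fun k j => by
    by_cases hjk : j = k
    · exact Filter.Eventually.of_forall fun _ h => (h hjk).elim
    have h0 : 0 < ‖σ j - σ k‖ := norm_pos_iff.2 (sub_ne_zero.2 (hσ.ne hjk))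
    filter_upwards [Ioo_mem_nhdsGT (half_pos h0)] with r hr _
    linarith [hr.2]
  obtain ⟨r, hr, hr0⟩ := ((Filter.eventually_all.2 fun k => Filter.eventually_all.2 (h k)).and
    self_mem_nhdsWithin).exists
  exact ⟨r, hr0, hr⟩

theorem exists_norm_bound (σ : Fin (n + 1) → ℂ) : ∃ R > 0, ∀ k, ‖σ k‖ ≤ R := by
  refine ⟨∑ k, ‖σ k‖ + 1, by positivity, fun k => ?_⟩
  have := Finset.single_le_sum (fun i _ => norm_nonneg (σ i)) (Finset.mem_univ k)
  linarith

/-- A form `ν` for which `ν + ∇f = 0` has a global solution is a multiple of the connection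
form. -/
theorem exists_eq_mul_of_isSolution (hσ : Function.Injective σ) (hs : ∀ k, ∀ m : ℤ, s k ≠ m)
    (hsum : ∀ m : ℤ, ∑ k, s k ≠ m) {f : ℂ → ℂ}
    (hf : ∀ z ∉ Set.range σ, IsSolutionAt σ s p f z) : ∃ C, ∀ k, p k = C * s k := by
  classical
  obtain ⟨r, hr0, hr⟩ := exists_separation hσ
  obtain ⟨R, hR0, hR⟩ := exists_norm_bound σ
  have hr' : ∀ k, ∀ j ≠ k, r ≤ ‖σ j - σ k‖ := fun k j hj => by linarith [hr k j hj]
  choose φ hφd hφ0 hφ using fun k =>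
    exists_solution_near_puncture (σ := σ) (s := s) (p := p) hr0 (hs k) (hr' k)
  obtain ⟨ψ, hψd, hψ0, hψ⟩ := exists_solution_near_infty (σ := σ) (s := s) (p := p) hR0 hR hsum
  have hball : ∀ k, ∀ z ∈ ball (σ k) r, z ≠ σ k → z ∉ Set.range σ := by
    rintro k _ hz hzk ⟨j, rfl⟩
    rw [mem_ball, dist_eq_norm] at hz
    exact absurd (hr' k j fun h => hzk (by rw [h])) (not_le.2 hz)
  have hfφ : ∀ k, ∀ z ∈ ball (σ k) r, z ≠ σ k → f z = φ k z := fun k z hz hz0 =>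
    solution_near_puncture_unique (hs k) (hr' k) (fun z hz h => hf z (hball k z hz h)) (hφ k) hz hz0
  have hinf : ∀ z : ℂ, R < ‖z‖ → z ∉ Set.range σ := by
    rintro _ hz ⟨j, rfl⟩
    exact absurd (hR j) (not_le.2 hz)
  have hfψ : ∀ z, R < ‖z‖ → f z = ψ z⁻¹ := fun z hz =>
    solution_near_infty_unique hR0 hR hsum (fun z hz => hf z (hinf z hz)) hψ hz
  -- By uniqueness `f` agrees with `φ k` near `σ k` and with `ψ (1 / z)` near infinity, so `F` is
  -- entire with a limit at infinity, hence constant. Its value at `σ k` turns `s k * φ k (σ k) = p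
  -- k` into the claim with `C = ψ 0`.
  let F : ℂ → ℂ := fun z => if h : ∃ k, σ k = z then φ h.choose z else f z
  have hFf : ∀ z ∉ Set.range σ, F z = f z := fun z hz => dif_neg hz
  have hFσ : ∀ k, F (σ k) = φ k (σ k) := fun k => by
    have h : ∃ j, σ j = σ k := ⟨k, rfl⟩
    have h1 : h.choose = k := hσ h.choose_spec
    simp only [F, dif_pos h, h1]
  have hopen : IsOpen (Set.range σ)ᶜ := (Set.finite_range σ).isClosed.isOpen_compl
  have hFd : Differentiable ℂ F := fun z => by
    by_cases hz : z ∈ Set.range σ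
    · obtain ⟨k, rfl⟩ := hz
      have hd := (hφd k).differentiableAt (isOpen_ball.mem_nhds (mem_ball_self hr0))
      refine hd.congr_of_eventuallyEq ?_
      filter_upwards [isOpen_ball.mem_nhds (mem_ball_self hr0)] with z hz
      rcases eq_or_ne z (σ k) with rfl | hzk
      · exact hFσ k
      · rw [hFf z (hball k z hz hzk), hfφ k z hz hzk]
    · refine (hf z hz).differentiableAt.congr_of_eventuallyEq ?_
      filter_upwards [hopen.mem_nhds hz] with y hy using hFf y hy
  have hlim : Filter.Tendsto F (Filter.cocompact ℂ) (𝓝 (ψ 0)) := by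
    have h1 : Filter.Tendsto (fun z : ℂ => ψ z⁻¹) (Filter.cocompact ℂ) (𝓝 (ψ 0)) := by
      refine Filter.Tendsto.comp (hψd.differentiableAt
        (isOpen_ball.mem_nhds (mem_ball_self (inv_pos.2 hR0)))).continuousAt ?_
      rw [← Metric.cobounded_eq_cocompact]
      exact Filter.tendsto_inv₀_cobounded
    refine h1.congr' ?_
    rw [← Metric.cobounded_eq_cocompact]
    filter_upwards [(tendsto_norm_cobounded_atTop (E := ℂ)).eventually_gt_atTop R] with z hz
    rw [hFf z (hinf z hz), hfψ z hz]
  refine ⟨ψ 0, fun k => ?_⟩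
  have h1 := hFd.apply_eq_of_tendsto_cocompact (σ k) hlim
  rw [← hφ0 k, ← hFσ k, h1, mul_comm]

end LocalSolutions

/-! ## Intersection numbers of logarithmic forms -/

section IntersectionNumbers

open Metric MeasureTheory

/-- In polar coordinates the angular integral is `2π M` on every circle that meets the support of
the integrand. What remains is the integral of `r * g' (r ^ 2)`, the derivative of `g (r ^ 2) / 2`,
which is `1 / 2`. -/
theorem integral_radial {a b : ℝ} (ha : 0 < a) (hab : a < b) {g : ℝ → ℝ} (hg : ContDiff ℝ 1 g)
    (hg0 : ∀ t ≤ a ^ 2, g t = 0) (hg1 : ∀ t, b ^ 2 ≤ t → g t = 1) {F : ℂ → ℂ}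
    (hF : ContinuousOn F {z | a ≤ ‖z‖ ∧ ‖z‖ ≤ b}) {M : ℂ}
    (hM : ∀ r, a ≤ r → r ≤ b → Real.circleAverage F 0 r = M) :
    Integrable (fun z : ℂ => ((deriv g (‖z‖ ^ 2) : ℝ) : ℂ) * F z) ∧
      ∫ z : ℂ, ((deriv g (‖z‖ ^ 2) : ℝ) : ℂ) * F z = Real.pi * M := by
  have hg' : Continuous (deriv g) := hg.continuous_deriv le_rfl
  have hzero : ∀ r : ℝ, 0 ≤ r → ¬ (a ≤ r ∧ r ≤ b) → deriv g (r ^ 2) = 0 := by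
    intro r hr h
    rw [not_and_or, not_le, not_le] at h
    rcases h with h | h
    · have : g =ᶠ[𝓝 (r ^ 2)] fun _ => 0 := by
        filter_upwards [Iio_mem_nhds (show r ^ 2 < a ^ 2 by gcongr)] with t ht
        exact hg0 t (le_of_lt ht)
      rw [this.deriv_eq, deriv_const]
    · have : g =ᶠ[𝓝 (r ^ 2)] fun _ => 1 := by
        filter_upwards [Ioi_mem_nhds (show b ^ 2 < r ^ 2 by gcongr; linarith)] with t ht
        exact hg1 t (le_of_lt ht)
      rw [this.deriv_eq, deriv_const]
  set G : ℂ → ℂ := fun z => ((deriv g (‖z‖ ^ 2) : ℝ) : ℂ) * F z with hG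
  have hGc : ContinuousOn G {z | a ≤ ‖z‖ ∧ ‖z‖ ≤ b} :=
    (Complex.continuous_ofReal.comp (hg'.comp (by fun_prop))).continuousOn.mul hF
  constructor
  · have hcomp : IsCompact {z : ℂ | a ≤ ‖z‖ ∧ ‖z‖ ≤ b} := by
      refine (isCompact_closedBall (0 : ℂ) b).of_isClosed_subset ?_ fun z hz => by
        simpa using hz.2
      exact (isClosed_le continuous_const continuous_norm).inter
        (isClosed_le continuous_norm continuous_const)
    refine (integrableOn_iff_integrable_of_support_subset fun z hz => ?_).1
      (hGc.integrableOn_compact hcomp)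
    by_contra h
    exact hz (by simp only [hG, hzero _ (norm_nonneg z) h, Complex.ofReal_zero, zero_mul])
  · rw [← Complex.integral_comp_polarCoord_symm]
    have hmap : ∀ q : ℝ × ℝ, Complex.polarCoord.symm q = circleMap 0 q.1 q.2 := fun q => by
      rw [Complex.polarCoord_symm_apply, circleMap, zero_add, Complex.exp_mul_I]
      push_cast
      rfl
    have hnorm : ∀ q : ℝ × ℝ, 0 ≤ q.1 → ‖circleMap 0 q.1 q.2‖ = q.1 := fun q hq => by
      rw [norm_circleMap_zero, abs_of_nonneg hq]
    simp only [hmap]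
    have hsub : Set.Icc a b ×ˢ Set.Ioo (-Real.pi) Real.pi ⊆ polarCoord.target := by
      rintro ⟨r, θ⟩ ⟨h1, h2⟩
      exact ⟨ha.trans_le h1.1, h2⟩
    rw [setIntegral_eq_of_subset_of_forall_sdiff_eq_zero polarCoord.open_target.measurableSet hsub]
    swap
    · rintro ⟨r, θ⟩ ⟨h1, h2⟩
      have hr : 0 < r := h1.1
      have : ¬ (a ≤ r ∧ r ≤ b) := fun h => h2 ⟨h, h1.2⟩
      simp only [hnorm (r, θ) hr.le, hzero r hr.le this, Complex.ofReal_zero, zero_mul,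
        smul_zero]
    have hcont : ContinuousOn (fun q : ℝ × ℝ => q.1 • G (circleMap 0 q.1 q.2))
        (Set.Icc a b ×ˢ Set.Icc (-Real.pi) Real.pi) := by
      refine continuous_fst.continuousOn.smul (hGc.comp ?_ ?_)
      · refine Continuous.continuousOn ?_
        unfold circleMap
        fun_prop
      · rintro ⟨r, θ⟩ ⟨h1, -⟩
        change a ≤ ‖circleMap 0 r θ‖ ∧ ‖circleMap 0 r θ‖ ≤ b
        rw [hnorm (r, θ) (ha.le.trans h1.1)]
        exact h1
    have hint : IntegrableOn (fun q : ℝ × ℝ => q.1 • G (circleMap 0 q.1 q.2))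
        (Set.Icc a b ×ˢ Set.Ioo (-Real.pi) Real.pi) :=
      (hcont.integrableOn_compact (isCompact_Icc.prod isCompact_Icc)).mono_set
        (Set.prod_mono_right Set.Ioo_subset_Icc_self)
    rw [Measure.volume_eq_prod] at hint ⊢
    rw [setIntegral_prod _ hint]
    have hinner : ∀ r ∈ Set.Icc a b,
        ∫ θ in Set.Ioo (-Real.pi) Real.pi, r • G (circleMap 0 r θ) =
          ((r * deriv g (r ^ 2) : ℝ) : ℂ) * (2 * Real.pi * M) := by
      intro r hr
      have h1 := hM r hr.1 hr.2
      rw [Real.circleAverage_def, Complex.real_smul] at h1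
      have h2 : ∫ θ in Set.Ioo (-Real.pi) Real.pi, F (circleMap 0 r θ) = 2 * Real.pi * M := by
        rw [← integral_Ioc_eq_integral_Ioo,
          ← intervalIntegral.integral_of_le (by linarith [Real.pi_pos])]
        have h3 := ((periodic_circleMap 0 r).comp F).intervalIntegral_add_eq (-Real.pi) 0
        rw [show -Real.pi + 2 * Real.pi = Real.pi by ring, zero_add] at h3
        simp only [Function.comp] at h3
        rw [h3, ← h1]
        have := Real.pi_ne_zero
        push_cast
        field_simp
      have h4 : ∀ θ, r • G (circleMap 0 r θ) =
          ((r * deriv g (r ^ 2) : ℝ) : ℂ) * F (circleMap 0 r θ) := fun θ => by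
        simp only [hG, hnorm (r, θ) (ha.le.trans hr.1), Complex.real_smul]
        push_cast
        ring
      simp only [h4]
      rw [integral_const_mul, h2]
    rw [setIntegral_congr_fun measurableSet_Icc hinner, integral_mul_const,
      integral_Icc_eq_integral_Ioc, ← intervalIntegral.integral_of_le hab.le,
      intervalIntegral.integral_ofReal]
    have hFTC : ∫ r in a..b, r * deriv g (r ^ 2) = 1 / 2 := by
      have hd : ∀ r ∈ Set.uIcc a b, HasDerivAt (fun r => g (r ^ 2) / 2) (r * deriv g (r ^ 2)) r := by
        intro r _
        have h1 : HasDerivAt g (deriv g (r ^ 2)) (r ^ 2) :=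
          (hg.differentiable one_ne_zero _).hasDerivAt
        have h2 : HasDerivAt (fun r : ℝ => r ^ 2) (2 * r) r := by simpa using hasDerivAt_pow 2 r
        refine ((HasDerivAt.comp (h := fun r : ℝ => r ^ 2) r h1 h2).div_const 2).congr_deriv ?_
        ring
      rw [intervalIntegral.integral_eq_sub_of_hasDerivAt hd
        ((continuous_id.mul (hg'.comp (by fun_prop))).intervalIntegrable _ _),
        hg0 _ le_rfl, hg1 _ le_rfl]
      norm_num
    rw [hFTC]
    push_cast
    ring

/-- The Wirtinger derivative with respect to the conjugate variable, up to a factor. -/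
def dbar (f : ℂ → ℂ) (z : ℂ) : ℂ := Complex.I * fderiv ℝ f z 1 - fderiv ℝ f z Complex.I

theorem fderiv_real_of_hasDerivAt {f : ℂ → ℂ} {f' z : ℂ} (h : HasDerivAt f f' z) (v : ℂ) :
    fderiv ℝ f z v = v * f' := by
  have h1 : HasFDerivAt f ((ContinuousLinearMap.toSpanSingleton ℂ f').restrictScalars ℝ) z :=
    h.hasFDerivAt.restrictScalars ℝ
  rw [h1.fderiv]
  simp

theorem dbar_of_hasDerivAt {f : ℂ → ℂ} {f' z : ℂ} (h : HasDerivAt f f' z) : dbar f z = 0 := by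
  rw [dbar, fderiv_real_of_hasDerivAt h, fderiv_real_of_hasDerivAt h]
  ring

theorem dbar_congr {f g : ℂ → ℂ} {z : ℂ} (h : f =ᶠ[𝓝 z] g) : dbar f z = dbar g z := by
  rw [dbar, dbar, h.fderiv_eq]

theorem dbar_mul {f g : ℂ → ℂ} {z : ℂ} (hf : DifferentiableAt ℝ f z)
    (hg : DifferentiableAt ℝ g z) :
    dbar (fun z => f z * g z) z = f z * dbar g z + g z * dbar f z := by
  simp only [dbar]
  rw [fderiv_fun_mul hf hg]
  simp
  ring

theorem dbar_add {f g : ℂ → ℂ} {z : ℂ} (hf : DifferentiableAt ℝ f z)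
    (hg : DifferentiableAt ℝ g z) : dbar (fun z => f z + g z) z = dbar f z + dbar g z := by
  simp only [dbar]
  rw [fderiv_fun_add hf hg]
  simp
  ring

theorem dbar_sum {ι : Type*} (t : Finset ι) {f : ι → ℂ → ℂ} {z : ℂ}
    (hf : ∀ i ∈ t, DifferentiableAt ℝ (f i) z) :
    dbar (fun z => ∑ i ∈ t, f i z) z = ∑ i ∈ t, dbar (f i) z := by
  simp only [dbar]
  rw [fderiv_fun_sum hf]
  simp [Finset.mul_sum]

/-- The product of a cutoff function and a function that is holomorphic where the cutoff function
does not vanish. -/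
theorem contDiff_cutoff_mul {χ f : ℂ → ℂ} {W : Set ℂ} (hW : IsOpen W)
    (hf : DifferentiableOn ℂ f W) (hχ : ContDiff ℝ (⊤ : ℕ∞) χ) (h0 : ∀ z ∉ W, χ =ᶠ[𝓝 z] 0) :
    ContDiff ℝ (⊤ : ℕ∞) (fun z => χ z * f z) ∧
      ∀ z, dbar (fun z => χ z * f z) z = f z * dbar χ z := by
  constructor
  · refine contDiff_iff_contDiffAt.2 fun z => ?_
    by_cases hz : z ∈ W
    · have h1 : ContDiffAt ℂ (⊤ : ℕ∞) f z := (hf.analyticAt (hW.mem_nhds hz)).contDiffAt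
      exact hχ.contDiffAt.mul (h1.restrict_scalars ℝ)
    · refine (contDiffAt_const (c := 0)).congr_of_eventuallyEq ?_
      filter_upwards [h0 z hz] with y hy
      rw [hy, Pi.zero_apply, zero_mul]
  · intro z
    by_cases hz : z ∈ W
    · have h1 := (hf.differentiableAt (hW.mem_nhds hz))
      rw [dbar_mul (hχ.differentiable (by simp) z) (h1.restrictScalars ℝ),
        dbar_of_hasDerivAt h1.hasDerivAt, mul_zero, zero_add]
    · have h1 : (fun z => χ z * f z) =ᶠ[𝓝 z] fun _ => 0 := by
        filter_upwards [h0 z hz] with y hy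
        rw [hy, Pi.zero_apply, zero_mul]
      have h2 : χ =ᶠ[𝓝 z] fun _ => 0 := h0 z hz
      rw [dbar_congr h1, dbar_congr h2]
      simp [dbar]

/-- A smooth radial function that is `0` for `‖z‖ ≤ a` and `1` for `b ≤ ‖z‖`. -/
def radialStep (a b : ℝ) (t : ℝ) : ℝ := Real.smoothTransition ((t - a ^ 2) / (b ^ 2 - a ^ 2))

theorem contDiff_radialStep (a b : ℝ) {m : ℕ∞} : ContDiff ℝ m (radialStep a b) :=
  Real.smoothTransition.contDiff.comp (by fun_prop)

theorem radialStep_eq_zero {a b : ℝ} (ha : 0 < a) (hab : a < b) {t : ℝ} (ht : t ≤ a ^ 2) :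
    radialStep a b t = 0 := by
  have : a ^ 2 < b ^ 2 := by gcongr
  exact Real.smoothTransition.zero_of_nonpos
    (div_nonpos_of_nonpos_of_nonneg (by linarith) (by linarith))

theorem radialStep_eq_one {a b : ℝ} (ha : 0 < a) (hab : a < b) {t : ℝ} (ht : b ^ 2 ≤ t) :
    radialStep a b t = 1 := by
  have : a ^ 2 < b ^ 2 := by gcongr
  exact Real.smoothTransition.one_of_one_le ((one_le_div (by linarith)).2 (by linarith))

theorem hasFDerivAt_radialStep (a b : ℝ) (c z : ℂ) :
    HasFDerivAt (fun z : ℂ => ((radialStep a b (‖z - c‖ ^ 2) : ℝ) : ℂ))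
      (Complex.ofRealCLM ∘L (deriv (radialStep a b) (‖z - c‖ ^ 2) •
        (2 • innerSL ℝ (z - c)))) z := by
  have h1 : HasDerivAt (radialStep a b) (deriv (radialStep a b) (‖z - c‖ ^ 2)) (‖z - c‖ ^ 2) :=
    ((contDiff_radialStep a b (m := 1)).differentiable one_ne_zero _).hasDerivAt
  have h2 : HasFDerivAt (fun z : ℂ => ‖z - c‖ ^ 2) (2 • innerSL ℝ (z - c)) z := by
    have := ((hasFDerivAt_id z).sub_const c).norm_sq
    simpa using this
  have h3 := h1.comp_hasFDerivAt z h2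
  exact Complex.ofRealCLM.hasFDerivAt.comp z h3

/-- With this normalization `dbar` is `2i` times the derivative in the conjugate variable, and that
derivative of `‖z - c‖ ^ 2` is `z - c`. -/
theorem dbar_radialStep (a b : ℝ) (c z : ℂ) :
    dbar (fun z : ℂ => ((radialStep a b (‖z - c‖ ^ 2) : ℝ) : ℂ)) z =
      2 * Complex.I * (((deriv (radialStep a b) (‖z - c‖ ^ 2) : ℝ) : ℂ) * (z - c)) := by
  rw [dbar, (hasFDerivAt_radialStep a b c z).fderiv]
  have h : z - c = ((z - c).re : ℂ) + (z - c).im * Complex.I := (Complex.re_add_im _).symm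
  simp only [ContinuousLinearMap.comp_apply, smul_apply, innerSL_apply_apply,
    Complex.inner, Complex.ofRealCLM_apply]
  nth_rewrite 6 [h]
  simp
  ring_nf
  simp
  ring

end IntersectionNumbers

/-! ### The intersection number as a sum of residues. -/

section IntersectionFormula

open Metric MeasureTheory

variable {n : ℕ} {σ s p : Fin (n + 1) → ℂ}

theorem twistedForm_eq_zero {φ f : ℂ → ℂ} {z : ℂ} (hφ : φ =ᶠ[𝓝 z] f)
    (hf : IsSolutionAt σ s p f z) : twistedForm σ s p φ z = 0 := by
  ext v
  rw [twistedForm, hφ.fderiv_eq, hφ.self_of_nhds, add_apply, fderiv_real_of_hasDerivAt hf]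
  simp
  ring

/-- The wedge product with a multiple of `dz` annihilates every component of type `dz`, so only the
antiholomorphic derivative of `φ` survives. -/
theorem integrand_eq_dbar (p q : Fin (n + 1) → ℂ) (φ : ℂ → ℂ) (z : ℂ) :
    twistedForm σ s p φ z 1 * (logCoeff σ q z * Complex.I) -
      twistedForm σ s p φ z Complex.I * (logCoeff σ q z * 1) = logCoeff σ q z * dbar φ z := by
  simp only [twistedForm, dbar, add_apply, smul_apply,
    ContinuousLinearMap.id_apply, smul_eq_mul]
  ring

/-- The contribution of a puncture to an intersection number. -/
theorem integral_near_puncture {r a b : ℝ} (ha : 0 < a) (hab : a < b) (hbr : b < r)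
    {k : Fin (n + 1)} (hr : ∀ j ≠ k, r ≤ ‖σ j - σ k‖) {φ : ℂ → ℂ}
    (hφ : DifferentiableOn ℂ φ (ball (σ k) r)) (q : Fin (n + 1) → ℂ) :
    Integrable (fun z => logCoeff σ q z * (φ z *
      dbar (fun z : ℂ => ((radialStep a b (‖z - σ k‖ ^ 2) : ℝ) : ℂ)) z)) ∧
    ∫ z, logCoeff σ q z * (φ z *
      dbar (fun z : ℂ => ((radialStep a b (‖z - σ k‖ ^ 2) : ℝ) : ℂ)) z) =
      2 * Real.pi * Complex.I * (q k * φ (σ k)) := by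
  -- The factor `w = z - σ k` from `dbar_radialStep` cancels the simple pole. The product extends
  -- holomorphically by `H`, and the mean value property gives the circle averages `H 0 = q k * φ (σ
  -- k)`.
  let H : ℂ → ℂ := fun w => (q k + w * regularPart σ q k w) * φ (σ k + w)
  let F : ℂ → ℂ := fun w => w * logCoeff σ q (σ k + w) * φ (σ k + w)
  have hFH : ∀ w ≠ 0, F w = H w := fun w hw => by
    simp only [F, H, logCoeff_eq_add_regularPart]
    field_simp
  have hH : DifferentiableOn ℂ H (ball 0 r) := by
    refine ((differentiableOn_const _).add
      (differentiableOn_id.mul (differentiableOn_regularPart hr))).mul ?_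
    refine hφ.comp (by fun_prop) fun w hw => ?_
    simpa [dist_eq_norm] using hw
  have hne : ∀ w : ℂ, a ≤ ‖w‖ → w ≠ 0 := fun w hw h => by
    rw [h, norm_zero] at hw
    linarith
  have h := integral_radial ha hab (contDiff_radialStep a b (m := 1))
    (fun t => radialStep_eq_zero ha hab) (fun t => radialStep_eq_one ha hab)
    (F := F) (M := q k * φ (σ k))
    ((hH.continuousOn.mono fun w hw => by
      rw [mem_ball_zero_iff]; exact hw.2.trans_lt hbr).congr fun w hw => hFH w (hne w hw.1))
    (fun ρ h1 h2 => by
      rw [Real.circleAverage_congr_sphere (f₂ := H) fun w hw => hFH w (hne w ?_),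
        DiffContOnCl.circleAverage]
      · simp [H]
      · refine hH.diffContOnCl_ball (closedBall_subset_ball ?_)
        rw [abs_of_nonneg (ha.le.trans h1)]
        exact h2.trans_lt hbr
      · rw [mem_sphere_zero_iff_norm, abs_of_nonneg (ha.le.trans h1)] at hw
        rwa [hw])
  have heq : (fun z => logCoeff σ q z * (φ z *
      dbar (fun z : ℂ => ((radialStep a b (‖z - σ k‖ ^ 2) : ℝ) : ℂ)) z)) =
      fun z => 2 * Complex.I * (((deriv (radialStep a b) (‖z - σ k‖ ^ 2) : ℝ) : ℂ) *
        F (z - σ k)) := by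
    funext z
    rw [dbar_radialStep]
    simp only [F, add_sub_cancel]
    ring
  rw [heq]
  refine ⟨(h.1.comp_sub_right (σ k)).const_mul _, ?_⟩
  rw [integral_const_mul, integral_sub_right_eq_self
    (fun w : ℂ => ((deriv (radialStep a b) (‖w‖ ^ 2) : ℝ) : ℂ) * F w) (σ k), h.2]
  ring

/-- The contribution of the point at infinity to an intersection number. -/
theorem integral_near_infty {R a b : ℝ} (hR0 : 0 < R) (hR : ∀ k, ‖σ k‖ ≤ R) (hRa : R < a)
    (hab : a < b) {ψ : ℂ → ℂ} (hψ : DifferentiableOn ℂ ψ (ball 0 R⁻¹)) (q : Fin (n + 1) → ℂ) :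
    Integrable (fun z => logCoeff σ q z * (ψ z⁻¹ *
      dbar (fun z : ℂ => ((radialStep a b (‖z - 0‖ ^ 2) : ℝ) : ℂ)) z)) ∧
    ∫ z, logCoeff σ q z * (ψ z⁻¹ *
      dbar (fun z : ℂ => ((radialStep a b (‖z - 0‖ ^ 2) : ℝ) : ℂ)) z) =
      2 * Real.pi * Complex.I * ((∑ k, q k) * ψ 0) := by
  have ha : 0 < a := hR0.trans hRa
  let H : ℂ → ℂ := fun w => logCoeffInfty σ q w * ψ w
  let F : ℂ → ℂ := fun z => z * logCoeff σ q z * ψ z⁻¹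
  have hFH : ∀ z ≠ 0, F z = H z⁻¹ := fun z hz => by
    have := logCoeff_inv (σ := σ) (p := q) (inv_ne_zero hz)
    rw [inv_inv] at this
    simp only [F, H, this]
    field_simp
  have hH : DifferentiableOn ℂ H (ball 0 R⁻¹) := (differentiableOn_logCoeffInfty hR0 hR).mul hψ
  have hne : ∀ w : ℂ, a ≤ ‖w‖ → w ≠ 0 := fun w hw h => by
    rw [h, norm_zero] at hw
    linarith
  have h := integral_radial ha hab (contDiff_radialStep a b (m := 1))
    (fun t => radialStep_eq_zero ha hab) (fun t => radialStep_eq_one ha hab)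
    (F := F) (M := (∑ k, q k) * ψ 0)
    (ContinuousOn.congr (f := fun z => H z⁻¹) (hH.continuousOn.comp
      (continuousOn_inv₀.mono fun w hw => hne w hw.1)
      fun w hw => (mem_ball_inv_of_lt hR0 (hRa.trans_le hw.1)).1) fun w hw => hFH w (hne w hw.1))
    (fun ρ h1 h2 => by
      have hρ : 0 < ρ := ha.trans_le h1
      rw [Real.circleAverage_congr_sphere (f₂ := fun z => H z⁻¹) fun w hw => hFH w (hne w ?_)]
      · have h3 : Real.circleAverage H 0 ρ⁻¹ = (∑ k, q k) * ψ 0 := by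
          rw [DiffContOnCl.circleAverage]
          · simp [H, logCoeffInfty]
          · refine hH.diffContOnCl_ball (closedBall_subset_ball ?_)
            rw [abs_of_pos (inv_pos.2 hρ)]
            gcongr
            exact hRa.trans_le h1
        rw [← h3, Real.circleAverage_def, Real.circleAverage_def]
        congr 1
        have h4 : ∀ θ, (circleMap 0 ρ θ)⁻¹ = circleMap 0 ρ⁻¹ (-θ) := fun θ => by
          simp only [circleMap, zero_add, mul_inv, Complex.ofReal_inv, Complex.ofReal_neg,
            neg_mul, Complex.exp_neg]
        simp only [h4]
        rw [intervalIntegral.integral_comp_neg (fun θ => H (circleMap 0 ρ⁻¹ θ)), neg_zero]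
        have h5 := ((periodic_circleMap 0 ρ⁻¹).comp H).intervalIntegral_add_eq
          (-(2 * Real.pi)) 0
        simpa using h5
      · rw [mem_sphere_zero_iff_norm, abs_of_pos hρ] at hw
        rwa [hw])
  have heq : (fun z => logCoeff σ q z * (ψ z⁻¹ *
      dbar (fun z : ℂ => ((radialStep a b (‖z - 0‖ ^ 2) : ℝ) : ℂ)) z)) =
      fun z => 2 * Complex.I * (((deriv (radialStep a b) (‖z‖ ^ 2) : ℝ) : ℂ) * F z) := by
    funext z
    rw [dbar_radialStep]
    simp only [F, sub_zero]
    ring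
  rw [heq]
  refine ⟨h.1.const_mul _, ?_⟩
  rw [integral_const_mul, h.2]
  ring

theorem radialStep_eventuallyEq_zero {a b : ℝ} (ha : 0 < a) (hab : a < b) {c z : ℂ}
    (hz : ‖z - c‖ < a) :
    ∀ᶠ y in 𝓝 z, ((radialStep a b (‖y - c‖ ^ 2) : ℝ) : ℂ) = 0 := by
  have hc : ContinuousAt (fun y : ℂ => ‖y - c‖) z := by fun_prop
  filter_upwards [hc.eventually (Iio_mem_nhds hz)] with y hy
  have : ‖y - c‖ ^ 2 ≤ a ^ 2 := by gcongr
  rw [radialStep_eq_zero ha hab this, Complex.ofReal_zero]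

theorem radialStep_eventuallyEq_one {a b : ℝ} (ha : 0 < a) (hab : a < b) {c z : ℂ}
    (hz : b < ‖z - c‖) :
    ∀ᶠ y in 𝓝 z, ((radialStep a b (‖y - c‖ ^ 2) : ℝ) : ℂ) = 1 := by
  have hc : ContinuousAt (fun y : ℂ => ‖y - c‖) z := by fun_prop
  filter_upwards [hc.eventually (Ioi_mem_nhds hz)] with y hy
  have hb : 0 < b := ha.trans hab
  have : b ^ 2 ≤ ‖y - c‖ ^ 2 := by gcongr
  rw [radialStep_eq_one ha hab this, Complex.ofReal_one]

theorem contDiff_radialStep_norm (a b : ℝ) (c : ℂ) :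
    ContDiff ℝ (⊤ : ℕ∞) fun z : ℂ => ((radialStep a b (‖z - c‖ ^ 2) : ℝ) : ℂ) := by
  have h1 : ContDiff ℝ (⊤ : ℕ∞) fun z : ℂ => ‖z - c‖ ^ 2 :=
    (contDiff_id.sub contDiff_const).norm_sq ℝ
  exact Complex.ofRealCLM.contDiff.comp ((contDiff_radialStep a b).comp h1)

/-- The intersection number of two logarithmic forms. -/
theorem isIntersectionNumber (hσ : Function.Injective σ) (hs : ∀ k, ∀ m : ℤ, s k ≠ m)
    (hsum : ∀ m : ℤ, ∑ k, s k ≠ m) (p q : Fin (n + 1) → ℂ) :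
    IsIntersectionNumber σ s p q
      ((∑ k, p k) * (∑ k, q k) / (∑ k, s k) - ∑ k, p k * q k / s k) := by
  obtain ⟨r, hr0, hr⟩ := exists_separation hσ
  obtain ⟨R, hR0, hR⟩ := exists_norm_bound σ
  have hr' : ∀ k, ∀ j ≠ k, r ≤ ‖σ j - σ k‖ := fun k j hj => by linarith [hr k j hj]
  choose φ hφd hφ0 hφ using fun k =>
    exists_solution_near_puncture (σ := σ) (s := s) (p := p) hr0 (hs k) (hr' k)
  obtain ⟨ψ, hψd, hψ0, hψ⟩ := exists_solution_near_infty (σ := σ) (s := s) (p := p) hR0 hR hsum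
  have e1 : 0 < r / 3 := by linarith
  have e2 : r / 3 < r / 2 := by linarith
  have e3 : r / 2 < r := by linarith
  have e4 : R < R + r := by linarith
  have e5 : R + r < R + 2 * r := by linarith
  have e6 : 0 < R + r := by linarith
  -- The cutoff `χ k = 1 - g k` is `1` within `r / 3` of `σ k` and `0` beyond `r / 2`; `χi` is `0`
  -- up to radius `R + r` and `1` beyond `R + 2 * r`. As punctures are at least `2 * r` apart and
  -- lie within radius `R`, the supports are disjoint.
  let g : Fin (n + 1) → ℂ → ℂ := fun k z => ((radialStep (r / 3) (r / 2) (‖z - σ k‖ ^ 2) : ℝ) : ℂ)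
  let χ : Fin (n + 1) → ℂ → ℂ := fun k z => 1 - g k z
  let χi : ℂ → ℂ := fun z => ((radialStep (R + r) (R + 2 * r) (‖z - 0‖ ^ 2) : ℝ) : ℂ)
  have hg : ∀ k, ContDiff ℝ (⊤ : ℕ∞) (g k) := fun k => contDiff_radialStep_norm _ _ _
  have hχ0 : ∀ k z, r / 2 < ‖z - σ k‖ → ∀ᶠ y in 𝓝 z, χ k y = 0 := fun k z hz => by
    filter_upwards [radialStep_eventuallyEq_one e1 e2 hz] with y hy
    simp only [χ, g, hy, sub_self]
  have hχ1 : ∀ k z, ‖z - σ k‖ < r / 3 → ∀ᶠ y in 𝓝 z, χ k y = 1 := fun k z hz => by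
    filter_upwards [radialStep_eventuallyEq_zero e1 e2 hz] with y hy
    simp only [χ, g, hy, sub_zero]
  have hi0 : ∀ z : ℂ, ‖z‖ < R + r → ∀ᶠ y in 𝓝 z, χi y = 0 := fun z hz =>
    radialStep_eventuallyEq_zero e6 e5 (by rwa [sub_zero])
  have hi1 : ∀ z : ℂ, R + 2 * r < ‖z‖ → ∀ᶠ y in 𝓝 z, χi y = 1 := fun z hz =>
    radialStep_eventuallyEq_one e6 e5 (by rwa [sub_zero])
  have hcut : ∀ k, ContDiff ℝ (⊤ : ℕ∞) (fun z => χ k z * φ k z) ∧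
      ∀ z, dbar (fun z => χ k z * φ k z) z = φ k z * dbar (χ k) z := fun k =>
    contDiff_cutoff_mul isOpen_ball (hφd k) (contDiff_const.sub (hg k)) fun z hz => by
      rw [mem_ball, dist_eq_norm, not_lt] at hz
      exact hχ0 k z (e3.trans_le hz)
  have hcuti : ContDiff ℝ (⊤ : ℕ∞) (fun z => χi z * ψ z⁻¹) ∧
      ∀ z, dbar (fun z => χi z * ψ z⁻¹) z = ψ z⁻¹ * dbar χi z :=
    contDiff_cutoff_mul (W := {z | R < ‖z‖}) (f := fun z => ψ z⁻¹)
      (isOpen_lt continuous_const continuous_norm)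
      (fun z hz => (hψ z hz).differentiableAt.differentiableWithinAt)
      (contDiff_radialStep_norm _ _ _) fun z hz => hi0 z (lt_of_le_of_lt (not_lt.1 hz) e4)
  -- Near every puncture and near infinity the glued function is an exact local solution, so the
  -- twisted form vanishes there and its support is compact.
  refine ⟨fun z => ∑ k, χ k z * φ k z + χi z * ψ z⁻¹,
    ((ContDiff.sum fun k _ => (hcut k).1).add hcuti.1).contDiffOn,
    ⟨closedBall 0 (R + 2 * r) ∩ ⋂ k, (ball (σ k) (r / 3))ᶜ, ?_, ?_, ?_⟩, ?_⟩
  · exact (isCompact_closedBall _ _).inter_right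
      (isClosed_iInter fun k => isOpen_ball.isClosed_compl)
  · rw [Set.disjoint_right]
    rintro _ ⟨k, rfl⟩ h
    exact Set.mem_iInter.1 h.2 k (mem_ball_self e1)
  · intro z hz hzS
    by_cases h : R + 2 * r < ‖z‖
    · refine twistedForm_eq_zero (f := fun z => ψ z⁻¹) ?_ (hψ z (by linarith))
      have h1 : ∀ k, ∀ᶠ y in 𝓝 z, χ k y = 0 := fun k => hχ0 k z (by
        have := norm_sub_norm_le z (σ k)
        have := hR k
        linarith)
      filter_upwards [Filter.eventually_all.2 h1, hi1 z h] with y hy hyi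
      simp [hy, hyi]
    · have hk : ∃ k, ‖z - σ k‖ < r / 3 := by
        by_contra! hk
        refine hzS ⟨by simpa using h, Set.mem_iInter.2 fun k => ?_⟩
        simpa [dist_eq_norm] using hk k
      obtain ⟨k, hk⟩ := hk
      refine twistedForm_eq_zero (f := φ k) ?_ (hφ k z ?_ fun h => hz ⟨k, h.symm⟩)
      · have h1 : ∀ j, ∀ᶠ y in 𝓝 z, j ≠ k → χ j y = 0 := fun j => by
          by_cases hj : j = k
          · exact Filter.Eventually.of_forall fun _ h => (h hj).elim
          refine (hχ0 j z ?_).mono fun _ h _ => h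
          have h2 := hr k j hj
          have h3 := norm_sub_le_norm_sub_add_norm_sub (σ j) z (σ k)
          rw [norm_sub_rev (σ j) z] at h3
          linarith
        have h2 : ‖z‖ < R + r := by
          have := norm_sub_norm_le z (σ k)
          have := hR k
          linarith
        filter_upwards [Filter.eventually_all.2 h1, hχ1 k z hk, hi0 z h2] with y hy hyk hyi
        rw [Finset.sum_eq_single k (fun j _ hj => by rw [hy j hj, zero_mul])
          (fun h => (h (Finset.mem_univ k)).elim), hyk, hyi]
        simp
      · rw [mem_ball, dist_eq_norm]
        linarith
  · simp only [integrand_eq_dbar]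
    -- Since `χ k` decreases outwards whereas `χi` increases, punctures and infinity contribute with
    -- opposite signs.
    have hdb : ∀ z, logCoeff σ q z * dbar (fun z => ∑ k, χ k z * φ k z + χi z * ψ z⁻¹) z =
        ∑ k, -(logCoeff σ q z * (φ k z * dbar (g k) z)) +
          logCoeff σ q z * (ψ z⁻¹ * dbar χi z) := fun z => by
      have htop : ((⊤ : ℕ∞) : WithTop ℕ∞) ≠ 0 := by simp
      have h1 : ∀ k, dbar (χ k) z = -dbar (g k) z := fun k => by
        simp only [dbar, χ]
        rw [fderiv_const_sub]
        simp
        ring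
      rw [dbar_add ((ContDiff.sum fun k _ => (hcut k).1).differentiable htop z)
        (hcuti.1.differentiable htop z),
        dbar_sum _ fun k _ => (hcut k).1.differentiable htop z, hcuti.2 z, mul_add, Finset.mul_sum]
      congr 1
      refine Finset.sum_congr rfl fun k _ => ?_
      rw [(hcut k).2 z, h1]
      ring
    simp only [hdb]
    have hk := fun k => integral_near_puncture e1 e2 e3 (hr' k) (hφd k) q
    have hi := integral_near_infty hR0 hR e4 e5 hψd q
    have hkn : ∀ k, Integrable fun z => -(logCoeff σ q z * (φ k z * dbar (g k) z)) :=
      fun k => (hk k).1.neg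
    have hi1' : Integrable fun z => logCoeff σ q z * (ψ z⁻¹ * dbar χi z) := hi.1
    have hi2 : ∫ z, logCoeff σ q z * (ψ z⁻¹ * dbar χi z) = _ := hi.2
    rw [integral_add (integrable_finsetSum _ fun k _ => hkn k) hi1',
      integral_finsetSum _ fun k _ => hkn k, hi2]
    have hk2 : ∀ k, ∫ z, -(logCoeff σ q z * (φ k z * dbar (g k) z)) =
        -(2 * Real.pi * Complex.I * (q k * φ k (σ k))) := fun k => by
      rw [integral_neg, (hk k).2]
    simp only [hk2]
    have hs0 : ∀ k, s k ≠ 0 := fun k => by simpa using hs k 0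
    have hsum0 : ∑ k, s k ≠ 0 := by simpa using hsum 0
    have h1 : ψ 0 = (∑ k, p k) / ∑ k, s k := by
      rw [eq_div_iff hsum0, ← hψ0, mul_comm]
    have h2 : ∀ k, φ k (σ k) = p k / s k := fun k => by
      rw [eq_div_iff (hs0 k), ← hφ0 k, mul_comm]
    simp only [h1, h2, ← Finset.mul_sum, ← mul_neg]
    rw [← mul_add, inv_mul_cancel_left₀ Complex.two_pi_I_ne_zero]
    have h3 : ∑ k, q k * -(p k / s k) = -∑ k, p k * q k / s k := by
      rw [← Finset.sum_neg_distrib]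
      exact Finset.sum_congr rfl fun k _ => by ring
    rw [h3]
    ring

end IntersectionFormula

/-! ## Classes of logarithmic forms -/

section LogForms

variable {n : ℕ} {F : Type} [Field F] {σ a : Fin (n + 1) → F}

theorem isUnit_X_sub_C (i : Fin (n + 1)) : IsUnit (algebraMap (Polynomial F) (CoordRing F σ)
    (Polynomial.X - Polynomial.C (σ i))) :=
  isUnit_of_dvd_unit (map_dvd _ (Finset.dvd_prod_of_mem
    (fun i => Polynomial.X - Polynomial.C (σ i)) (Finset.mem_univ i)))
    (IsLocalization.Away.algebraMap_isUnit (∏ i, (Polynomial.X - Polynomial.C (σ i))))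

/-- The connection form is the image of the constant function `1`. -/
theorem sum_smul_omega_mem_range_nabla :
    ∑ i, a i • omega F σ i ∈ LinearMap.range (nabla F σ a) := by
  refine ⟨1, ?_⟩
  have h : nabla F σ a 1 = KaehlerDifferential.D F (CoordRing F σ) 1 +
    (1 : CoordRing F σ) • ∑ i, a i • omega F σ i := rfl
  rw [h, one_smul, Derivation.map_one_eq_zero, zero_add]

variable {Q : Type} [Field Q] [Algebra Q F]

theorem sum_smul_omegaClass_eq_zero_iff (q : Fin (n + 1) → Q) :
    ∑ i, q i • omegaClass Q F σ a i = 0 ↔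
      ∑ i, algebraMap Q F (q i) • omega F σ i ∈ LinearMap.range (nabla F σ a) := by
  have h1 : (LinearMap.range (nabla F σ a)).mkQ (∑ i, algebraMap Q F (q i) • omega F σ i) =
      (logSpan Q F σ a).subtype (∑ i, q i • omegaClass Q F σ a i) := by
    rw [map_sum]
    refine Eq.trans ?_ (map_sum (logSpan Q F σ a).subtype _ _).symm
    refine Finset.sum_congr rfl fun i _ => ?_
    rw [map_smul, algebraMap_smul]
    rfl
  rw [← Submodule.ker_mkQ (LinearMap.range (nabla F σ a)), LinearMap.mem_ker, h1]
  exact ((logSpan Q F σ a).subtype.map_eq_zero_iff (logSpan Q F σ a).subtype_injective).symm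

theorem span_omegaClass : Submodule.span Q (Set.range (omegaClass Q F σ a)) = ⊤ := by
  refine eq_top_iff.2 fun x _ => ?_
  have key : ∀ y (hy : y ∈ logSpan Q F σ a),
      (⟨y, hy⟩ : Hvarpi Q F σ a) ∈ Submodule.span Q (Set.range (omegaClass Q F σ a)) := by
    intro y hy
    induction hy using Submodule.span_induction with
    | mem y hy =>
      obtain ⟨i, rfl⟩ := hy
      exact Submodule.subset_span ⟨i, rfl⟩
    | zero => exact Submodule.zero_mem _
    | add y z hy hz h1 h2 => exact Submodule.add_mem _ h1 h2
    | smul c y hy h1 => exact Submodule.smul_mem _ c h1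
  exact key x.1 x.2

end LogForms

/-! ## Evaluation of algebraic forms on the punctured plane -/

section Evaluation

variable {n : ℕ} {F : Type} [Field F] [Algebra F ℂ] {σ a : Fin (n + 1) → F}

theorem aeval_prod_ne_zero {z : ℂ} (hz : z ∉ Set.range fun i => algebraMap F ℂ (σ i)) :
    Polynomial.aeval z (∏ i, (Polynomial.X - Polynomial.C (σ i))) ≠ 0 := by
  rw [map_prod]
  refine Finset.prod_ne_zero_iff.2 fun i _ h => hz ⟨i, ?_⟩
  simp only [map_sub, Polynomial.aeval_X, Polynomial.aeval_C] at h
  exact (sub_eq_zero.1 h).symm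

/-- Evaluation of regular functions at a point of the punctured plane. -/
def evalAt {z : ℂ} (hz : z ∉ Set.range fun i => algebraMap F ℂ (σ i)) :
    CoordRing F σ →ₐ[F] ℂ :=
  IsLocalization.liftAlgHom (M := Submonoid.powers (∏ i, (Polynomial.X - Polynomial.C (σ i))))
    (f := Polynomial.aeval z) (by
      rintro ⟨_, m, rfl⟩
      simpa using (aeval_prod_ne_zero hz).isUnit.pow m)

theorem evalAt_algebraMap {z : ℂ} (hz : z ∉ Set.range fun i => algebraMap F ℂ (σ i))
    (P : Polynomial F) :
    evalAt hz (algebraMap (Polynomial F) (CoordRing F σ) P) = Polynomial.aeval z P := by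
  rw [evalAt, IsLocalization.coe_liftAlgHom, IsLocalization.lift_eq]
  rfl

open scoped Classical in
/-- A regular function, as a function on the punctured plane. -/
def evalFun (g : CoordRing F σ) (z : ℂ) : ℂ :=
  if hz : z ∉ Set.range fun i => algebraMap F ℂ (σ i) then evalAt hz g else 0

theorem evalFun_eq {z : ℂ} (hz : z ∉ Set.range fun i => algebraMap F ℂ (σ i))
    (g : CoordRing F σ) : evalFun g z = evalAt hz g := dif_pos hz

theorem isOpen_compl_range (σ : Fin (n + 1) → ℂ) : IsOpen (Set.range σ)ᶜ :=
  (Set.finite_range σ).isClosed.isOpen_compl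

theorem differentiableAt_evalFun {z : ℂ} (hz : z ∉ Set.range fun i => algebraMap F ℂ (σ i))
    (g : CoordRing F σ) : DifferentiableAt ℂ (evalFun g) z := by
  obtain ⟨m, P, hP⟩ := IsLocalization.Away.surj
    (∏ i, (Polynomial.X - Polynomial.C (σ i))) g
  have h1 : ∀ᶠ y in 𝓝 z, evalFun g y = Polynomial.aeval y P /
      Polynomial.aeval y (∏ i, (Polynomial.X - Polynomial.C (σ i))) ^ m := by
    filter_upwards [(isOpen_compl_range _).mem_nhds hz] with y hy
    have hy' : y ∉ Set.range fun i => algebraMap F ℂ (σ i) := hy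
    have h2 := congrArg (evalAt hy') hP
    rw [map_mul, map_pow, evalAt_algebraMap, evalAt_algebraMap] at h2
    rw [evalFun_eq hy', eq_div_iff (pow_ne_zero _ (aeval_prod_ne_zero hy')), h2]
  refine DifferentiableAt.congr_of_eventuallyEq ?_ h1
  exact (Polynomial.differentiable_aeval _).differentiableAt.div
    ((Polynomial.differentiable_aeval _).differentiableAt.pow _)
    (pow_ne_zero _ (aeval_prod_ne_zero hz))

theorem deriv_evalFun_mul {z : ℂ} (hz : z ∉ Set.range fun i => algebraMap F ℂ (σ i))
    (g h : CoordRing F σ) : deriv (evalFun (g * h)) z =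
      evalAt hz g * deriv (evalFun h) z + evalAt hz h * deriv (evalFun g) z := by
  have h1 : evalFun (g * h) =ᶠ[𝓝 z] fun y => evalFun g y * evalFun h y := by
    filter_upwards [(isOpen_compl_range _).mem_nhds hz] with y hy
    have hy' : y ∉ Set.range fun i => algebraMap F ℂ (σ i) := hy
    simp only [evalFun_eq hy', map_mul]
  rw [h1.deriv_eq, deriv_fun_mul (differentiableAt_evalFun hz g) (differentiableAt_evalFun hz h),
    evalFun_eq hz, evalFun_eq hz]
  ring

theorem deriv_evalFun_add {z : ℂ} (hz : z ∉ Set.range fun i => algebraMap F ℂ (σ i))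
    (g h : CoordRing F σ) : deriv (evalFun (g + h)) z =
      deriv (evalFun g) z + deriv (evalFun h) z := by
  have h1 : evalFun (g + h) =ᶠ[𝓝 z] fun y => evalFun g y + evalFun h y := by
    filter_upwards [(isOpen_compl_range _).mem_nhds hz] with y hy
    have hy' : y ∉ Set.range fun i => algebraMap F ℂ (σ i) := hy
    simp only [evalFun_eq hy', map_add]
  rw [h1.deriv_eq, deriv_fun_add (differentiableAt_evalFun hz g) (differentiableAt_evalFun hz h)]

theorem deriv_evalFun_algebraMap {z : ℂ} (hz : z ∉ Set.range fun i => algebraMap F ℂ (σ i))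
    (P : Polynomial F) : deriv (evalFun (algebraMap (Polynomial F) (CoordRing F σ) P)) z =
      Polynomial.aeval z P.derivative := by
  have h1 : evalFun (algebraMap (Polynomial F) (CoordRing F σ) P) =ᶠ[𝓝 z]
      fun y => Polynomial.aeval y P := by
    filter_upwards [(isOpen_compl_range _).mem_nhds hz] with y hy
    have hy' : y ∉ Set.range fun i => algebraMap F ℂ (σ i) := hy
    rw [evalFun_eq hy', evalAt_algebraMap]
  rw [h1.deriv_eq, Polynomial.deriv_aeval]

/-- Evaluation of the coefficient of `dz` of an algebraic form at a point. -/
theorem exists_evalForm {z : ℂ} (hz : z ∉ Set.range fun i => algebraMap F ℂ (σ i)) :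
    ∃ E : Ω[CoordRing F σ⁄F] →+ ℂ,
      (∀ (g : CoordRing F σ) (ω : Ω[CoordRing F σ⁄F]), E (g • ω) = evalAt hz g * E ω) ∧
      ∀ g, E (KaehlerDifferential.D F (CoordRing F σ) g) = deriv (evalFun g) z := by
  let _ : Algebra (CoordRing F σ) ℂ := (evalAt hz).toRingHom.toAlgebra
  have hsmul : ∀ (g : CoordRing F σ) (w : ℂ), g • w = evalAt hz g * w := fun _ _ => rfl
  have : IsScalarTower F (CoordRing F σ) ℂ := IsScalarTower.of_algebraMap_eq fun x =>
    ((evalAt hz).commutes x).symm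
  -- Differentiating the associated function at `z` is a derivation into `ℂ`, a module through
  -- evaluation at `z`. The universal property of Kähler differentials extends it to forms.
  let D : Derivation F (CoordRing F σ) ℂ :=
    Derivation.mk'
      { toFun := fun g => deriv (evalFun g) z
        map_add' := deriv_evalFun_add hz
        map_smul' := fun r g => by
          rw [Algebra.smul_def, deriv_evalFun_mul hz,
            IsScalarTower.algebraMap_apply F (Polynomial F), deriv_evalFun_algebraMap hz,
            evalAt_algebraMap]
          simp [Algebra.smul_def] }
      fun g h => deriv_evalFun_mul hz g h
  refine ⟨D.liftKaehlerDifferential.toAddMonoidHom, fun g ω => ?_, fun g => ?_⟩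
  · exact (map_smul D.liftKaehlerDifferential g ω).trans (hsmul _ _)
  · exact D.liftKaehlerDifferential_comp_D g

/-- A combination of logarithmic forms that is exact for the connection is a multiple of the
connection form. -/
theorem exists_eq_mul_of_mem_range_nabla (hσ : Function.Injective σ)
    (ha : ∀ k, ∀ m : ℤ, algebraMap F ℂ (a k) ≠ m)
    (hsum : ∀ m : ℤ, ∑ k, algebraMap F ℂ (a k) ≠ m) {q : Fin (n + 1) → F}
    (hq : ∑ i, q i • omega F σ i ∈ LinearMap.range (nabla F σ a)) :
    ∃ C : ℂ, ∀ i, algebraMap F ℂ (q i) = C * algebraMap F ℂ (a i) := by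
  obtain ⟨g, hg⟩ := hq
  -- An algebraic primitive `g` of `∑ q i ω_i` satisfies `g' + g ∑ a i / (z - σ i) = ∑ q i / (z - σ
  -- i)`. In the convention of `IsSolutionAt` this means exponents `-a` and form `-q`.
  obtain ⟨C, hC⟩ := exists_eq_mul_of_isSolution (σ := fun i => algebraMap F ℂ (σ i))
    (s := fun i => -algebraMap F ℂ (a i)) (p := fun i => -algebraMap F ℂ (q i))
    (f := evalFun g) ((algebraMap F ℂ).injective.comp hσ)
    (fun k m h => ha k (-m) (by push_cast; linear_combination -h))
    (fun m h => hsum (-m) (by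
      rw [Finset.sum_neg_distrib] at h
      push_cast
      linear_combination -h))
    fun z hz => by
      obtain ⟨E, hE1, hE2⟩ := exists_evalForm hz
      have homega : ∀ i, E (omega F σ i) = 1 / (z - algebraMap F ℂ (σ i)) := fun i => by
        rw [omega, hE1, hE2, deriv_evalFun_algebraMap hz]
        have h1 := congrArg (evalAt hz) (Ring.inverse_mul_cancel _ (isUnit_X_sub_C (σ := σ) i))
        have hX : Polynomial.aeval z (Polynomial.X - Polynomial.C (σ i)) =
          z - algebraMap F ℂ (σ i) := by simp
        rw [map_mul, evalAt_algebraMap, map_one, hX] at h1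
        rw [Polynomial.derivative_X, map_one, mul_one]
        exact eq_one_div_of_mul_eq_one_left h1
      have hconst : ∀ (r : F) (ω : Ω[CoordRing F σ⁄F]), E (r • ω) = algebraMap F ℂ r * E ω := by
        intro r ω
        rw [← algebraMap_smul (CoordRing F σ) r ω, hE1, AlgHom.commutes]
      have h2 : E (nabla F σ a g) = E (∑ i, q i • omega F σ i) := congrArg E hg
      have h3 : nabla F σ a g = KaehlerDifferential.D F (CoordRing F σ) g +
        g • ∑ i, a i • omega F σ i := rfl
      rw [h3, map_add, hE1, hE2, map_sum, map_sum] at h2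
      simp only [hconst, homega] at h2
      refine (differentiableAt_evalFun hz g).hasDerivAt.congr_deriv ?_
      rw [evalFun_eq hz]
      simp only [logCoeff, neg_div, Finset.sum_neg_distrib]
      simp only [mul_one_div] at h2
      linear_combination h2
  exact ⟨C, fun i => by linear_combination -hC i⟩

end Evaluation

/-! ## Local solutions of the connection -/

section Solutions

variable {n : ℕ} {σ a : Fin (n + 1) → ℂ}

/-- The logarithms are assumed only continuous. They are local inverses of `exp`, or of `w ↦ σ k *
(1 - exp w)` when `k ≠ 0`, hence holomorphic with derivative `1 / (y - σ k)`. -/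
theorem IsBranchAt.hasDerivAt (hσ0 : σ 0 = 0) (hσ : ∀ k ≠ 0, σ k ≠ 0) {x : ℂ} {b : ℂ → ℂ}
    (hx : x ∉ Set.range σ) (hb : IsBranchAt σ a x b) :
    ∀ᶠ y in 𝓝 x, HasDerivAt b (b y * logCoeff σ a y) y := by
  obtain ⟨l, hl⟩ := hb
  filter_upwards [hl.eventually_nhds, (isOpen_compl_range σ).mem_nhds hx] with y hy hyσ
  have hne : ∀ k, y - σ k ≠ 0 := fun k h => hyσ ⟨k, (sub_eq_zero.1 h).symm⟩
  have hlog : ∀ k, HasDerivAt (l k) (y - σ k)⁻¹ y := fun k => by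
    have hc := (hy.self_of_nhds.1 k).1
    have he := (hy.self_of_nhds.1 k).2
    by_cases hk : k = 0
    · subst hk
      have h1 := Complex.hasDerivAt_exp (l 0 y)
      rw [he, factor, if_pos rfl] at h1
      have h2 := HasDerivAt.of_local_left_inverse hc h1 (by simpa [hσ0] using hne 0)
        (hy.mono fun z hz => by rw [(hz.1 0).2, factor, if_pos rfl])
      rwa [hσ0, sub_zero]
    · have h1 : HasDerivAt (fun w => σ k * (1 - Complex.exp w)) (y - σ k) (l k y) := by
        refine (((Complex.hasDerivAt_exp (l k y)).const_sub 1).const_mul (σ k)).congr_deriv ?_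
        have := hσ k hk
        rw [he, factor, if_neg hk]
        field_simp
        ring
      refine HasDerivAt.of_local_left_inverse hc h1 (hne k) (hy.mono fun z hz => ?_)
      have := hσ k hk
      rw [(hz.1 k).2, factor, if_neg hk]
      field_simp
      ring
  have h3 : HasDerivAt (fun z => Complex.exp (∑ k, a k * l k z))
      (Complex.exp (∑ k, a k * l k y) * ∑ k, a k * (y - σ k)⁻¹) y :=
    (HasDerivAt.fun_sum fun k _ => (hlog k).const_mul (a k)).cexp
  refine (h3.congr_of_eventuallyEq (hy.mono fun z hz => hz.2)).congr_deriv ?_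
  rw [hy.self_of_nhds.2]
  simp only [logCoeff, div_eq_mul_inv]

theorem hasDerivAt_of_mem_stalk (hσ0 : σ 0 = 0) (hσ : ∀ k ≠ 0, σ k ≠ 0) {x : ℂ} {f : ℂ → ℂ}
    (hx : x ∉ Set.range σ) (hf : f ∈ stalk ℂ σ a x) :
    ∀ᶠ y in 𝓝 x, HasDerivAt f (f y * logCoeff σ a y) y := by
  induction hf using Submodule.span_induction with
  | mem f hf => exact hf.hasDerivAt hσ0 hσ hx
  | zero => exact Filter.Eventually.of_forall fun y => by simp
  | add f g _ _ hf hg =>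
    filter_upwards [hf, hg] with y h1 h2
    exact (h1.add h2).congr_deriv (by simp only [Pi.add_apply]; ring)
  | smul c f _ hf =>
    filter_upwards [hf] with y h1
    exact (h1.const_mul c).congr_deriv (by simp only [Pi.smul_apply, smul_eq_mul]; ring)

/-- The quotient by a branch has derivative zero on a small disc. With `hasDerivAt_of_mem_stalk`,
this identifies the complex local system with the solutions of the homogeneous equation. -/
theorem mem_stalk_of_hasDerivAt (hσ0 : σ 0 = 0) (hσ : ∀ k ≠ 0, σ k ≠ 0) {x : ℂ} {f : ℂ → ℂ}
    (hx : x ∉ Set.range σ) (hf : ∀ᶠ y in 𝓝 x, HasDerivAt f (f y * logCoeff σ a y) y) :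
    f ∈ stalk ℂ σ a x := by
  obtain ⟨b, hb⟩ := exists_isBranchAt (a := a) hσ0 hσ hx
  obtain ⟨r, hr, h⟩ := Metric.eventually_nhds_iff_ball.1
    (hf.and ((hb.hasDerivAt hσ0 hσ hx).and hb.eventually_ne_zero))
  have hd : ∀ y ∈ Metric.ball x r, HasDerivAt (fun z => f z / b z) 0 y := fun y hy => by
    obtain ⟨h1, h2, h3⟩ := h y hy
    refine (h1.div h2 h3).congr_deriv ?_
    rw [div_eq_zero_iff]
    left
    ring
  refine mem_stalk_of_eventuallyEq (hasMonodromy_complex a) hb (f x / b x) ?_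
  filter_upwards [Metric.ball_mem_nhds x hr] with y hy
  have h1 := (convex_ball x r).is_const_of_fderivWithin_eq_zero (𝕜 := ℂ)
    (f := fun z => f z / b z) (fun y hy => (hd y hy).differentiableAt.differentiableWithinAt)
    (fun y hy => by
      rw [fderivWithin_of_isOpen Metric.isOpen_ball hy]
      have := (hd y hy).hasFDerivAt.fderiv
      rw [this]
      simp) hy (Metric.mem_ball_self hr)
  rw [Algebra.algebraMap_self_apply, ← h1, div_mul_cancel₀ _ (h y hy).2.2]

/-- Variation of constants: the solution is `b * M`, where `M` is a primitive of `g / b` on a disc.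
-/
theorem exists_local_solution (hσ0 : σ 0 = 0) (hσ : ∀ k ≠ 0, σ k ≠ 0) {x : ℂ} {g : ℂ → ℂ}
    (hg : DifferentiableOn ℂ g (Set.range σ)ᶜ) (hx : x ∉ Set.range σ) :
    ∃ u : ℂ → ℂ, ∀ᶠ y in 𝓝 x, HasDerivAt u (g y + u y * logCoeff σ a y) y := by
  obtain ⟨b, hb⟩ := exists_isBranchAt (a := a) hσ0 hσ hx
  obtain ⟨r, hr, h⟩ := Metric.eventually_nhds_iff_ball.1
    (((isOpen_compl_range σ).eventually_mem hx).and
      ((hb.hasDerivAt hσ0 hσ hx).and hb.eventually_ne_zero))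
  have hd : DifferentiableOn ℂ (fun y => g y / b y) (Metric.ball x r) := fun y hy => by
    obtain ⟨h1, h2, h3⟩ := h y hy
    exact (((hg y h1).differentiableAt ((isOpen_compl_range σ).mem_nhds h1)).div
      h2.differentiableAt h3).differentiableWithinAt
  obtain ⟨M, hM⟩ := hd.isExactOn_ball
  refine ⟨fun y => b y * M y, ?_⟩
  filter_upwards [Metric.ball_mem_nhds x hr] with y hy
  obtain ⟨h1, h2, h3⟩ := h y hy
  refine (h2.mul (hM y hy)).congr_deriv ?_
  field_simp
  ring

theorem exists_solution_cocycle (hσ0 : σ 0 = 0) (hσ : ∀ k ≠ 0, σ k ≠ 0) {g : ℂ → ℂ}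
    (hg : DifferentiableOn ℂ g (Set.range σ)ᶜ) :
    ∃ u : cocycles ℂ σ a, ∀ x ∉ Set.range σ, ∀ᶠ y in 𝓝 x,
      HasDerivAt (u.1 x) (g y + u.1 x y * logCoeff σ a y) y := by
  choose! u hu using fun x (hx : x ∉ Set.range σ) => exists_local_solution (a := a) hσ0 hσ hg hx
  refine ⟨⟨u, fun x hx => ?_⟩, hu⟩
  filter_upwards [(hu x hx).eventually_nhds, (isOpen_compl_range σ).mem_nhds hx] with y hy hyσ
  refine mem_stalk_of_hasDerivAt hσ0 hσ hyσ ?_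
  filter_upwards [hy, hu y hyσ] with z h1 h2
  exact (h1.sub h2).congr_deriv (by simp only [Pi.sub_apply]; ring)

/-- A combination of the classes of `dz / (z - σ i)` is zero if and only if the corresponding form
has a global solution. -/
theorem sum_smul_mk_eq_zero_iff (hσ0 : σ 0 = 0) (hσ : ∀ k ≠ 0, σ k ≠ 0)
    {u : Fin (n + 1) → cocycles ℂ σ a}
    (hu : ∀ i, ∀ x ∉ Set.range σ, ∀ᶠ y in 𝓝 x,
      HasDerivAt ((u i).1 x) (1 / (y - σ i) + (u i).1 x y * logCoeff σ a y) y)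
    (q : Fin (n + 1) → ℂ) : ∑ i, q i • H1.mk ℂ σ a (u i) = 0 ↔
      ∃ f : ℂ → ℂ, ∀ z ∉ Set.range σ, IsSolutionAt σ a (-q) f z := by
  have hsum : ∑ i, q i • H1.mk ℂ σ a (u i) = H1.mk ℂ σ a (∑ i, q i • u i) := by
    simp only [map_sum, map_smul]
  have hval : ∀ x y, (∑ i, q i • u i).1 x y = ∑ i, q i * (u i).1 x y := fun x y => by
    rw [AddSubmonoidClass.coe_finsetSum, Finset.sum_apply, Finset.sum_apply]
    rfl
  have hder : ∀ x ∉ Set.range σ, ∀ᶠ y in 𝓝 x, HasDerivAt ((∑ i, q i • u i).1 x)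
      (logCoeff σ q y + (∑ i, q i • u i).1 x y * logCoeff σ a y) y := fun x hx => by
    filter_upwards [Filter.eventually_all.2 fun i => hu i x hx] with y hy
    have h1 : HasDerivAt (fun y => ∑ i, q i * (u i).1 x y)
      (∑ i, q i * (1 / (y - σ i) + (u i).1 x y * logCoeff σ a y)) y :=
      HasDerivAt.fun_sum fun i _ => (hy i).const_mul (q i)
    have h2 : (∑ i, q i • u i).1 x = fun y => ∑ i, q i * (u i).1 x y := funext (hval x)
    rw [h2]
    refine h1.congr_deriv ?_
    simp only [mul_add, Finset.sum_add_distrib, mul_one_div, ← mul_assoc, ← Finset.sum_mul]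
    rfl
  have hneg : ∀ z, logCoeff σ (-q) z = -logCoeff σ q z := fun z => by
    simp only [logCoeff, Pi.neg_apply, neg_div, Finset.sum_neg_distrib]
  rw [hsum, H1.mk_eq_zero_iff]
  -- The cocycle is made of local solutions, so `f` differs from it by homogeneous solutions exactly
  -- when `f` is itself a global solution.
  refine exists_congr fun f => ⟨fun h x hx => ?_, fun h x hx => ?_⟩
  · have h1 := ((hasDerivAt_of_mem_stalk hσ0 hσ hx (h x hx)).and (hder x hx)).self_of_nhds
    have h2 := h1.2.sub h1.1
    rw [sub_sub_cancel] at h2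
    refine h2.congr_deriv ?_
    rw [hneg]
    simp only [Pi.sub_apply]
    ring
  · refine mem_stalk_of_hasDerivAt hσ0 hσ hx ?_
    filter_upwards [hder x hx, (isOpen_compl_range σ).mem_nhds hx] with y h1 hy
    refine (h1.sub (h y hy)).congr_deriv ?_
    rw [hneg]
    simp only [Pi.sub_apply]
    ring

end Solutions

/-! ## Bases from a single linear relation -/

section Relation

variable {n : ℕ} {K V : Type*} [Field K] [AddCommGroup V] [Module K V] {x : Fin (n + 1) → V}
  {s : Fin (n + 1) → K}

/-- A relation that omits `x 0` has `0 = C * s 0`, so it is trivial. -/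
theorem linearIndependent_of_relation (hs : ∀ i, s i ≠ 0)
    (h : ∀ q : Fin (n + 1) → K, ∑ i, q i • x i = 0 → ∃ C, ∀ i, q i = C * s i) :
    LinearIndependent K fun j : Fin n => (-s j.succ) • x j.succ := by
  refine Fintype.linearIndependent_iff.2 fun g hg j => ?_
  obtain ⟨C, hC⟩ := h (Fin.cons 0 fun j => g j * -s j.succ) (by
    rw [Fin.sum_univ_succ]
    simpa [mul_smul] using hg)
  have hC0 : C = 0 := by
    have := hC 0
    rw [Fin.cons_zero] at this
    exact (mul_eq_zero.1 this.symm).resolve_right (hs 0)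
  have := hC j.succ
  rw [Fin.cons_succ, hC0, zero_mul] at this
  exact (mul_eq_zero.1 this).resolve_right (neg_ne_zero.2 (hs _))

theorem eq_sum_of_relation (hs : s 0 ≠ 0) (h : ∑ i, s i • x i = 0) :
    x 0 = (s 0)⁻¹ • ∑ j : Fin n, (-s j.succ) • x j.succ := by
  rw [Fin.sum_univ_succ] at h
  simp only [neg_smul, Finset.sum_neg_distrib]
  rw [← eq_neg_of_add_eq_zero_left h, inv_smul_smul₀ hs]

theorem span_of_relation (hs : ∀ i, s i ≠ 0) (h : ∑ i, s i • x i = 0)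
    (hx : Submodule.span K (Set.range x) = ⊤) :
    Submodule.span K (Set.range fun j : Fin n => (-s j.succ) • x j.succ) = ⊤ := by
  rw [eq_top_iff, ← hx, Submodule.span_le]
  rintro _ ⟨i, rfl⟩
  refine Fin.cases ?_ (fun j => ?_) i
  · rw [eq_sum_of_relation (hs 0) h]
    exact Submodule.smul_mem _ _ (Submodule.sum_mem _ fun j _ => Submodule.subset_span ⟨j, rfl⟩)
  · have : x j.succ = (-s j.succ)⁻¹ • (-s j.succ) • x j.succ := by
      rw [inv_smul_smul₀ (neg_ne_zero.2 (hs _))]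
    rw [this]
    exact Submodule.smul_mem _ _ (Submodule.subset_span ⟨j, rfl⟩)

/-- The bilinear form `∑ p * ∑ q / ∑ s - ∑ p i * q i / s i` descends to quotients by `s`. -/
theorem exists_pairing_of_relation {W : Type*} [AddCommGroup W] [Module K W]
    {y : Fin (n + 1) → W} (hs : ∀ i, s i ≠ 0) (hsum : ∑ i, s i ≠ 0)
    (hx : Submodule.span K (Set.range x) = ⊤) (hy : Submodule.span K (Set.range y) = ⊤)
    (hx0 : ∀ q : Fin (n + 1) → K, ∑ i, q i • x i = 0 → ∃ C, ∀ i, q i = C * s i)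
    (hy0 : ∀ q : Fin (n + 1) → K, ∑ i, q i • y i = 0 → ∃ C, ∀ i, q i = C * s i) :
    ∃ P : V →ₗ[K] W →ₗ[K] K, ∀ p q : Fin (n + 1) → K,
      P (∑ i, p i • x i) (∑ i, q i • y i) =
        (∑ i, p i) * (∑ i, q i) / (∑ i, s i) - ∑ i, p i * q i / s i := by
  let β : (Fin (n + 1) → K) →ₗ[K] (Fin (n + 1) → K) →ₗ[K] K := LinearMap.mk₂ K
    (fun p q => (∑ i, p i) * (∑ i, q i) / (∑ i, s i) - ∑ i, p i * q i / s i)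
    (fun p p' q => by
      simp only [Pi.add_apply, Finset.sum_add_distrib, add_mul, add_div]; ring)
    (fun c p q => by
      simp only [Pi.smul_apply, smul_eq_mul, mul_sub, Finset.mul_sum, ← mul_div_assoc, mul_assoc,
        Finset.sum_mul])
    (fun p q q' => by
      simp only [Pi.add_apply, Finset.sum_add_distrib, mul_add, add_div]; ring)
    (fun c p q => by
      simp only [Pi.smul_apply, smul_eq_mul, mul_left_comm _ c, mul_sub, mul_div_assoc,
        ← Finset.mul_sum])
  -- For `p = s` both terms of the formula equal `∑ q`; symmetrically on the right.
  have hβl : ∀ (C : K) q, β (C • s) q = 0 := fun C q => by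
    have h1 : ∀ i, s i * q i / s i = q i := fun i => by rw [mul_div_cancel_left₀ _ (hs i)]
    rw [map_smul, LinearMap.smul_apply, LinearMap.mk₂_apply]
    simp only [h1]
    rw [mul_div_cancel_left₀ _ hsum, sub_self, smul_zero]
  have hβr : ∀ p (C : K), β p (C • s) = 0 := fun p C => by
    have h1 : ∀ i, p i * s i / s i = p i := fun i => by rw [mul_div_cancel_right₀ _ (hs i)]
    rw [map_smul, LinearMap.mk₂_apply]
    simp only [h1]
    rw [mul_div_cancel_right₀ _ hsum, sub_self, smul_zero]
  -- A linear choice of coordinates on each space. Another choice differs by multiples of `s`, which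
  -- the form does not see.
  obtain ⟨f, hf⟩ := (Fintype.linearCombination K x).exists_rightInverse_of_surjective
    (by rw [Fintype.range_linearCombination, hx])
  obtain ⟨g, hg⟩ := (Fintype.linearCombination K y).exists_rightInverse_of_surjective
    (by rw [Fintype.range_linearCombination, hy])
  refine ⟨β.compl₁₂ f g, fun p q => ?_⟩
  rw [LinearMap.compl₁₂_apply]
  obtain ⟨C, hC⟩ := hx0 (f (∑ i, p i • x i) - p) (by
    have h1 := LinearMap.congr_fun hf (∑ i, p i • x i)
    simp only [LinearMap.comp_apply, LinearMap.id_apply, Fintype.linearCombination_apply] at h1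
    simp only [Pi.sub_apply, sub_smul, Finset.sum_sub_distrib, h1, sub_self])
  obtain ⟨D, hD⟩ := hy0 (g (∑ i, q i • y i) - q) (by
    have h1 := LinearMap.congr_fun hg (∑ i, q i • y i)
    simp only [LinearMap.comp_apply, LinearMap.id_apply, Fintype.linearCombination_apply] at h1
    simp only [Pi.sub_apply, sub_smul, Finset.sum_sub_distrib, h1, sub_self])
  have hC' : f (∑ i, p i • x i) = p + C • s := by
    rw [← sub_eq_iff_eq_add']
    exact funext hC
  have hD' : g (∑ i, q i • y i) = q + D • s := by
    rw [← sub_eq_iff_eq_add']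
    exact funext hD
  rw [hC', hD', map_add, hβr, add_zero, map_add, LinearMap.add_apply, hβl, add_zero,
    LinearMap.mk₂_apply]

end Relation

/-! ## The comparison isomorphism, the intersection pairing and the coaction -/

section Object

variable {n : ℕ} {k : IntermediateField ℚ ℂ} {σ : Fin (n + 1) → k} {s : Fin (n + 1) → ℂ}

theorem punct_injective (hσ : Function.Injective σ) : Function.Injective (punct k σ) :=
  Subtype.val_injective.comp hσ

theorem hasMonodromy_QB : HasMonodromy (QB s) (-s) := fun i =>
  ⟨(⟨Complex.exp (2 * Real.pi * Complex.I * s i),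
    IntermediateField.subset_adjoin _ _ ⟨i, rfl⟩⟩ : QB s)⁻¹, by
    rw [map_inv₀, Pi.neg_apply, mul_neg, Complex.exp_neg]
    rfl⟩

/-- The analytic argument gives a complex factor; being the ratio `q 0 / s 0`, it already lies in
the field of exponents. -/
theorem exists_eq_mul_expo {q : Fin (n + 1) → QdR s} (hs : s 0 ≠ 0) {C : ℂ}
    (h : ∀ i, (q i : ℂ) = C * s i) : ∃ D : QdR s, ∀ i, q i = D * expo s i := by
  refine ⟨q 0 / expo s 0, fun i => Subtype.ext ?_⟩
  change (q i : ℂ) = (q 0 : ℂ) / s 0 * s i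
  rw [h i, h 0, mul_div_cancel_right₀ _ hs]

theorem exists_eq_mul_of_sum_smul_om_eq_zero (hσ : Function.Injective σ)
    (hs : ∀ (i : Fin (n + 1)) (m : ℤ), s i ≠ m) (hsum : ∀ m : ℤ, ∑ i, s i ≠ m)
    (q : Fin (n + 1) → QdR s) (hq : ∑ i, q i • om k σ s i = 0) :
    ∃ C, ∀ i, q i = C * expo s i := by
  obtain ⟨C, hC⟩ := exists_eq_mul_of_mem_range_nabla (F := kdR k s) (a := expoK k s)
    (fun i j h => hσ (Subtype.ext (congrArg (fun x : kdR k s => (x : ℂ)) h))) hs hsum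
    ((sum_smul_omegaClass_eq_zero_iff q).1 hq)
  exact exists_eq_mul_expo (by simpa using hs 0 0) hC

theorem exists_eq_mul_of_sum_smul_omNeg_eq_zero (hσ : Function.Injective σ)
    (hs : ∀ (i : Fin (n + 1)) (m : ℤ), s i ≠ m) (hsum : ∀ m : ℤ, ∑ i, s i ≠ m)
    (q : Fin (n + 1) → QdR s) (hq : ∑ i, q i • omNeg k σ s i = 0) :
    ∃ C, ∀ i, q i = C * expo s i := by
  obtain ⟨C, hC⟩ := exists_eq_mul_of_mem_range_nabla (F := kdR k s) (a := -expoK k s)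
    (fun i j h => hσ (Subtype.ext (congrArg (fun x : kdR k s => (x : ℂ)) h)))
    (fun i m h => hs i (-m) (by
      rw [Pi.neg_apply, map_neg] at h
      push_cast
      rw [← h, neg_neg]
      rfl))
    (fun m h => hsum (-m) (by
      simp only [Pi.neg_apply, map_neg, Finset.sum_neg_distrib] at h
      push_cast
      rw [← h, neg_neg]
      rfl))
    ((sum_smul_omegaClass_eq_zero_iff q).1 hq)
  refine exists_eq_mul_expo (C := -C) (by simpa using hs 0 0) fun i => (hC i).trans ?_
  rw [Pi.neg_apply, map_neg, mul_neg, neg_mul]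
  rfl

theorem sum_expo_smul_om : ∑ i, expo s i • om k σ s i = 0 :=
  (sum_smul_omegaClass_eq_zero_iff (expo s)).2 sum_smul_omega_mem_range_nabla

theorem expo_ne_zero (hs : ∀ (i : Fin (n + 1)) (m : ℤ), s i ≠ m) (i : Fin (n + 1)) :
    expo s i ≠ 0 := fun h => hs i 0 (by
  have := congrArg (fun x : QdR s => (x : ℂ)) h
  simpa [expo] using this)

/-- The classes of `-s_j ω_j` form a basis. -/
theorem exists_basis_dRvec (hσ : Function.Injective σ)
    (hs : ∀ (i : Fin (n + 1)) (m : ℤ), s i ≠ m) (hsum : ∀ m : ℤ, ∑ i, s i ≠ m) :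
    ∃ e : Module.Basis (Fin n) (QdR s) (MdR k σ s), ∀ j, e j = dRvec k σ s j :=
  ⟨Module.Basis.mk
    (linearIndependent_of_relation (expo_ne_zero hs)
      (exists_eq_mul_of_sum_smul_om_eq_zero hσ hs hsum))
    (span_of_relation (expo_ne_zero hs) sum_expo_smul_om span_omegaClass).ge,
    fun j => Module.Basis.mk_apply _ _ j⟩

/-- The classes of local solutions obey the same relation as the forms and no others, and the
complex `H¹` has dimension `n`. So the classes of `-s_j ω_j` correspond to a basis there, and
inverting `H1.complexify` returns to the Betti structure. -/
theorem exists_isComparison (hσ0 : σ 0 = 0) (hσ : Function.Injective σ)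
    (hs : ∀ (i : Fin (n + 1)) (m : ℤ), s i ≠ m) (hsum : ∀ m : ℤ, ∑ i, s i ≠ m)
    (e : Module.Basis (Fin n) (QdR s) (MdR k σ s)) (he : ∀ j, e j = dRvec k σ s j) :
    ∃ c : (ℂ ⊗[QdR s] MdR k σ s) ≃ₗ[ℂ] (ℂ ⊗[QB s] MB k σ s), IsComparison c := by
  have hτ0 : punct k σ 0 = 0 := by simp [punct, hσ0]
  have hτ := punct_injective hσ
  have hτ' : ∀ i ≠ 0, punct k σ i ≠ 0 := fun i hi h => hi (hτ (h.trans hτ0.symm))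
  have hs0 : ∀ i, s i ≠ 0 := fun i => by simpa using hs i 0
  have hneg : ∀ (i : Fin (n + 1)) (m : ℤ), (-s) i ≠ m := fun i m h => hs i (-m) (by
    rw [Pi.neg_apply] at h
    push_cast
    rw [← h, neg_neg])
  have hnegsum : ∀ m : ℤ, ∑ i, (-s) i ≠ m := fun m h => hsum (-m) (by
    simp only [Pi.neg_apply, Finset.sum_neg_distrib] at h
    push_cast
    rw [← h, neg_neg])
  choose u hu using fun i => exists_solution_cocycle (a := -s) hτ0 hτ'
    (g := fun z => 1 / (z - punct k σ i)) (fun z hz => by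
      refine DifferentiableAt.differentiableWithinAt ?_
      refine (differentiableAt_const _).div (by fun_prop) ?_
      exact fun h => hz ⟨i, (sub_eq_zero.1 h).symm⟩)
  have hiff := sum_smul_mk_eq_zero_iff hτ0 hτ' hu
  have hrel : ∑ i, s i • H1.mk ℂ _ _ (u i) = 0 := (hiff s).2 ⟨fun _ => 1, fun z _ => by
    refine (hasDerivAt_const z (1 : ℂ)).congr_deriv ?_
    ring⟩
  have hker : ∀ q : Fin (n + 1) → ℂ, ∑ i, q i • H1.mk ℂ _ _ (u i) = 0 →
      ∃ C, ∀ i, q i = C * s i := fun q hq => by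
    obtain ⟨f, hf⟩ := (hiff q).1 hq
    obtain ⟨C, hC⟩ := exists_eq_mul_of_isSolution hτ hneg hnegsum hf
    exact ⟨C, fun i => by simpa using hC i⟩
  have hfin : FiniteDimensional ℂ (H1 ℂ (punct k σ) (-s)) :=
    finiteDimensional_H1 (hasMonodromy_complex _) hτ0 hτ
  have hli := linearIndependent_of_relation hs0 hker
  let w : Module.Basis (Fin n) ℂ (H1 ℂ (punct k σ) (-s)) :=
    basisOfLinearIndependentOfCardEqFinrank' _ hli (by
      rw [Fintype.card_fin, finrank_H1 (hasMonodromy_complex _) hτ0 hτ (hneg 0)])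
  have hw : ∀ j, w j = (-s j.succ) • H1.mk ℂ _ _ (u j.succ) := fun j => by
    simp only [w, coe_basisOfLinearIndependentOfCardEqFinrank']
  let c : (ℂ ⊗[QdR s] MdR k σ s) ≃ₗ[ℂ] (ℂ ⊗[QB s] MB k σ s) :=
    ((e.baseChange ℂ).equiv w (Equiv.refl _)).trans (LinearEquiv.ofBijective _
      (complexify_bijective (K := QB s) hasMonodromy_QB hτ0 hτ (hneg 0))).symm
  have hc : ∀ x, H1.complexify (QB s) (punct k σ) (-s) (c x) =
      (e.baseChange ℂ).equiv w (Equiv.refl _) x := fun x =>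
    LinearEquiv.apply_symm_apply (LinearEquiv.ofBijective _
      (complexify_bijective (K := QB s) hasMonodromy_QB hτ0 hτ (hneg 0))) _
  have hsmul : ∀ (q : QdR s) (m : MdR k σ s),
      (1 ⊗ₜ (q • m) : ℂ ⊗[QdR s] MdR k σ s) = (q : ℂ) • (1 ⊗ₜ m) := fun q m => by
    rw [← TensorProduct.smul_tmul, TensorProduct.smul_tmul', Algebra.smul_def, smul_eq_mul]
    rfl
  have hvec : ∀ j, (e.baseChange ℂ).equiv w (Equiv.refl _) (1 ⊗ₜ dRvec k σ s j) =
      (-s j.succ) • H1.mk ℂ _ _ (u j.succ) := fun j => by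
    rw [← he, ← Module.Basis.baseChange_apply, Module.Basis.equiv_apply, Equiv.refl_apply, hw]
  refine ⟨c, fun i => ⟨u i, fun x hx => (hu i x hx).mono fun y hy => ?_, ?_⟩⟩
  · refine hy.congr_deriv ?_
    simp only [logCoeff, Pi.neg_apply, neg_div, Finset.sum_neg_distrib]
    ring
  rw [hc]
  refine Fin.cases ?_ (fun j => ?_) i
  -- The form `ω_0` is outside the basis; it is expressed through the others by the same relation on
  -- both sides.
  · rw [eq_sum_of_relation (expo_ne_zero hs 0) (sum_expo_smul_om (k := k) (σ := σ)), hsmul,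
      map_smul, TensorProduct.tmul_sum, map_sum, eq_sum_of_relation (hs0 0) hrel]
    congr 1
    exact Finset.sum_congr rfl fun j _ => hvec j
  · have h1 := hvec j
    rw [dRvec, hsmul, map_smul] at h1
    exact smul_right_injective _ (neg_ne_zero.2 (hs0 _)) h1

theorem exists_isDeRhamPairing (hσ : Function.Injective σ)
    (hs : ∀ (i : Fin (n + 1)) (m : ℤ), s i ≠ m) (hsum : ∀ m : ℤ, ∑ i, s i ≠ m)
    (e : Module.Basis (Fin n) (QdR s) (MdR k σ s)) (he : ∀ j, e j = dRvec k σ s j) :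
    ∃ P : MdRneg k σ s →ₗ[QdR s] MdR k σ s →ₗ[QdR s] QdR s, IsDeRhamPairing P ∧
      ∀ i, P (nu k σ s i) = e.coord i := by
  have hcoe : ∀ i, (expo s i : ℂ) = s i := fun _ => rfl
  obtain ⟨P, hP⟩ := exists_pairing_of_relation (s := expo s) (x := omNeg k σ s) (y := om k σ s)
    (expo_ne_zero hs)
    (fun h => hsum 0 (by
      have := congrArg (fun x : QdR s => (x : ℂ)) h
      simpa [hcoe] using this))
    span_omegaClass span_omegaClass (exists_eq_mul_of_sum_smul_omNeg_eq_zero hσ hs hsum)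
    (exists_eq_mul_of_sum_smul_om_eq_zero hσ hs hsum)
  refine ⟨P, fun p q => ?_, fun i => e.ext fun j => ?_⟩
  · rw [hP]
    have h := isIntersectionNumber (punct_injective hσ) hs hsum (fun i => (p i : ℂ))
      fun i => (q i : ℂ)
    push_cast
    exact h
  · classical
    have h1 : nu k σ s i = ∑ l, (Pi.single i.succ 1 - Pi.single 0 1 : Fin (n + 1) → QdR s) l •
        omNeg k σ s l := by
      simp [nu, sub_smul, Pi.single_apply, ite_smul]
    have h2 : dRvec k σ s j = ∑ l, (Pi.single j.succ (-expo s j.succ) : Fin (n + 1) → QdR s) l •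
        om k σ s l := by
      simp [dRvec, Pi.single_apply, ite_smul]
    rw [Module.Basis.coord_apply, Module.Basis.repr_self, he, h1, h2, hP]
    -- The coefficients of `ν_i` have sum zero, which removes the contribution of infinity. Only the
    -- residue at the puncture of index `j.succ` remains, and the factor `-s_j` normalizes it to the
    -- Kronecker symbol.
    simp only [Pi.sub_apply, Finset.sum_sub_distrib, Finset.sum_pi_single', Finset.mem_univ,
      if_true, sub_self, zero_mul, zero_div, zero_sub]
    rw [Finset.sum_eq_single j.succ]
    · rw [Pi.single_eq_same, Pi.single_eq_of_ne (Fin.succ_ne_zero j), sub_zero, mul_neg, neg_div,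
        neg_neg, mul_div_cancel_right₀ _ (expo_ne_zero hs _), Pi.single_apply,
        Finsupp.single_apply]
      simp only [Fin.succ_inj, eq_comm]
    · intro l _ hl
      rw [Pi.single_eq_of_ne hl, mul_zero, zero_div]
    · simp

/-- The coaction is defined through one chosen basis of each de Rham space; naturality for the
identity morphism allows any other. -/
theorem coaction_mcoeff {QB kdR : IntermediateField ℚ ℂ} {ι : Type*} [Fintype ι]
    (V : Triple QB kdR) (e : Module.Basis ι kdR V.VdR) (τ : Module.Dual QB V.VB) (ω : V.VdR) :
    coaction QB kdR (mcoeff V τ ω) = ∑ l, mcoeff V τ (e l) ⊗ₜ[kdR] dcoeff V (e.coord l) ω := by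
  refine Eq.trans ?_ ((preCoaction_mvar V τ ω).trans (coactionSum_basis _ e τ ω))
  rfl

end Object

end Lauricella

end

theorem mainTheorem8 (k : IntermediateField ℚ ℂ) (n : ℕ) (σ : Fin (n + 1) → k)
    (hσ0 : σ 0 = 0) (hσ : Function.Injective σ) (s : Fin (n + 1) → ℂ)
    (hs : ∀ (i : Fin (n + 1)) (m : ℤ), s i ≠ m) (hsum : ∀ m : ℤ, ∑ i, s i ≠ m) :
    ∃ (_ : FiniteDimensional (Lauricella.QB s) (Lauricella.MB k σ s))
      (c : (ℂ ⊗[Lauricella.QdR s] Lauricella.MdR k σ s) ≃ₗ[ℂ]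
        (ℂ ⊗[Lauricella.QB s] Lauricella.MB k σ s))
      (P : Lauricella.MdRneg k σ s →ₗ[Lauricella.QdR s]
        Lauricella.MdR k σ s →ₗ[Lauricella.QdR s] Lauricella.QdR s),
      Lauricella.IsComparison c ∧
      Lauricella.IsDeRhamPairing P ∧
      (∃ e : Module.Basis (Fin n) (Lauricella.QdR s) (Lauricella.MdR k σ s),
        (∀ j, e j = Lauricella.dRvec k σ s j) ∧
        ∀ i, P (Lauricella.nu k σ s i) = e.coord i) ∧
      ∀ (δ h : Fin n → ℝ → ℂ) (κ : Fin n → Module.Dual (Lauricella.QB s) (Lauricella.MB k σ s)),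
        (∀ i, Lauricella.IsTwistedPath (Lauricella.punct k σ) s i.succ (δ i) (h i) ∧
          Lauricella.IsChainFunctional (Lauricella.QB s) (Lauricella.punct k σ) (-s)
            (δ i) (h i) (κ i)) →
        (Lauricella.lauricellaM c κ).map (Lauricella.coaction (Lauricella.QB s) (Lauricella.QdR s)) =
          Matrix.of fun i j => ∑ l, Lauricella.lauricellaM c κ i l ⊗ₜ[Lauricella.QdR s]
            Lauricella.lauricellaDR c P l j := by
  have hfin : FiniteDimensional (Lauricella.QB s) (Lauricella.MB k σ s) :=
    Lauricella.finiteDimensional_H1 Lauricella.hasMonodromy_QB (by simp [Lauricella.punct, hσ0])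
      (Lauricella.punct_injective hσ)
  obtain ⟨e, he⟩ := Lauricella.exists_basis_dRvec hσ hs hsum
  obtain ⟨c, hc⟩ := Lauricella.exists_isComparison hσ0 hσ hs hsum e he
  obtain ⟨P, hP, hPe⟩ := Lauricella.exists_isDeRhamPairing hσ hs hsum e he
  refine ⟨hfin, c, P, hc, hP, ⟨e, he, hPe⟩, fun δ h κ _ => ?_⟩
  ext i j
  -- In the basis of the `-s_l ω_l`, the coordinate functionals are the pairings with the `ν_l`, so
  -- the sum has the entries of the two matrices as its factors.
  refine (Lauricella.coaction_mcoeff (Lauricella.MSigma c) e (κ i)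
    (Lauricella.dRvec k σ s j)).trans ?_
  refine Finset.sum_congr rfl fun l _ => ?_
  simp only [Lauricella.lauricellaM, Lauricella.lauricellaDR, Matrix.of_apply, hPe]
  rw [← he, ← he]
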